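/- **Setting.** Let $\mathcal V$ be a commutative unital quantale with multiplication $\otimes$ and unit $k$, which is integral ($k=\top$), and let $B\subseteq\mathcal V$ be a basis: for every $x$ the set $\{y\in B\mid y\ll x\}$ is directed with join $x$ (so that the lattice $\mathcal V$ is continuous), where $y\ll x$ means that every $X\subseteq\mathcal V$ with $x\le\bigvee X$ has a finite subset $A$ with $y\le\bigvee A$. The basis is assumed to be closed under finite joins and $\otimes$, and to contain $k$. **Theories.** Fix ground types $G$ and operation symbols $f:A_1,\dots,A_n\to A$ ($n\ge1$), where types are given by $A::=X\in G\mid I\mid A\otimes A\mid A\multimap A$. Terms in context $\Gamma\rhd v:A$ of linear $\lambda$-calculus are $x$, $f(v_1,\dots,v_n)$, $*$, $v\ \mathrm{to}\ *.\,w$, $v\otimes w$, $\mathrm{pm}\ v\ \mathrm{to}\ x\otimes y.\,w$, $\lambda x{:}A.\,v$ and $v\,w$, with the usual linear typing; the context of a compound term is a shuffle of the contexts of its parts. A *linear $\mathcal V\lambda$-theory* $T$ is a class of axioms $\Gamma\rhd v=_qw:A$ with $q\in B$. Its theorems are the smallest class containing the axioms and closed under: - the equations (read as both $v=_\top w$ and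 $w=_\top v$) $\mathrm{pm}\ v\otimes w\ \mathrm{to}\ x\otimes y.\,u=u[v/x,w/y]$; $\ \mathrm{pm}\ v\ \mathrm{to}\ x\otimes y.\,u[x\otimes y/z]=u[v/z]$; $\ *\ \mathrm{to}\ *.\,v=v$; $\ v\ \mathrm{to}\ *.\,w[*/z]=w[v/z]$; $\ (\lambda x.\,v)\,w=v[w/x]$; $\ \lambda x.\,(v\,x)=v$; $\ u[v\ \mathrm{to}\ *.\,w/z]=v\ \mathrm{to}\ *.\,u[w/z]$; $\ u[\mathrm{pm}\ v\ \mathrm{to}\ x\otimes y.\,w/z]=\mathrm{pm}\ v\ \mathrm{to}\ x\otimes y.\,u[w/z]$; - the rules: $v=_\top v$; from $v=_qw$ and $w=_ru$ infer $v=_{q\otimes r}u$; from $v=_qw$ infer $v=_rw$ for $r\le q$; from $v=_rw$ for all $r\ll q$ infer $v=_qw$; from $v=_{q_i}w$ for $i\le n$ infer $v=_{\bigvee_i q_i}w$ (all labels in $B$); each term former is compatible with $=_q$, the labels of the premises being multiplied; permutation of the context; and from $v=_qw$, $v'=_rw'$ infer $v[v'/x]=_{q\otimes r}w[w'/x]$.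 **Enriched autonomous categories and functors.** A $\mathcal V$-category is a class $X$ with $a:X\times X\to\mathcal V$ such that $k\le a(x,x)$ and $a(x,y)\otimes a(y,z)\le a(x,z)$; it is separated if $k\le a(x,y)$ and $k\le a(y,x)$ imply $x=y$. A $\mathcal V$-functor is a map with $a(x,y)\le b(fx,fy)$. A *$\mathcal V\text{-}\mathsf{Cat}_{\mathsf{sep}}$-autonomous category* is a symmetric monoidal closed category whose hom-sets are separated $\mathcal V$-categories, such that composition and $\otimes$ are $\mathcal V$-functors (on the tensor product, $a((f,g),(f',g'))=a(f,f')\otimes a(g,g')$) and the transposition $C(Z\otimes X,Y)\cong C(Z,X\multimap Y)$ is an isomorphism of $\mathcal V$-categories. A *$\mathcal V\text{-}\mathsf{Cat}_{\mathsf{sep}}$-autonomous functor* $F$ is a symmetric strong monoidal functor, with structure isomorphisms $\mathrm{un}:I\to FI$ and $\mu_{X,Y}:FX\otimes FY\to F(X\otimes Y)$, such that the right transpose $m_{X,Y}:F(X\multimap Y)\to(FX\multimap FY)$ of $F(\mathrm{app})\cdot\mu$ is an isomorphism for all $X,Y$ and such that $F$ is a $\mathcal V$-functor on all hom-sets. It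 is *strict* if all of $\mathrm{un}$, $\mu_{X,Y}$, $m_{X,Y}$ are identities. **Models.** An interpretation $M$ in such a category $C$ consists of an object $[\![X]\!]_M$ for each $X\in G$, which is extended to types by $I,\otimes,\multimap$ and to contexts by $[\![x_1{:}A_1,\dots,x_n{:}A_n]\!]=(\cdots([\![A_1]\!]\otimes[\![A_2]\!])\cdots)\otimes[\![A_n]\!]$ (and $I$ if $n=0$), and of a morphism $[\![f]\!]_M:[\![A_1]\!]\otimes\cdots\otimes[\![A_n]\!]\to[\![A]\!]$ for each operation symbol. It extends to terms $[\![v]\!]_M:[\![\Gamma]\!]\to[\![A]\!]$ in the standard way. It is a *model* of $T$ if $q\le a([\![v]\!]_M,[\![w]\!]_M)$ for every axiom $\Gamma\rhd v=_qw:A$. **Syntactic category.** $\mathrm{Syn}(T)$ has the types as objects; its morphisms $A\to A'$ are the classes $[v]$ of terms $x:A\rhd v:A'$, where $a(v,w)=\bigvee\{q\mid v=_qw\text{ is a theorem}\}$ and $v\sim w$ iff $k\le a(v,w)$ and $k\le a(w,v)$. With substitution as composition, the type formers as $I,\otimes,\multimap$ and the induced $a$ it is a $\mathcal V\text{-}\mathsf{Cat}_{\mathsf{sep}}$-autonomous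 category. It carries the interpretation, also written $\mathrm{Syn}(T)$, with $[\![X]\!]=X$ and $[\![f]\!]=[\mathrm{pm}\ x\ \mathrm{to}\ x_1\otimes\cdots\otimes x_n.\,f(x_1,\dots,x_n)]$. For an autonomous functor $F:C\to D$ and an interpretation $M$ in $C$, the interpretation $F_*M$ in $D$ is given by $[\![X]\!]_{F_*M}=F[\![X]\!]_M$ and $[\![f]\!]_{F_*M}=h_A^{-1}\cdot F[\![f]\!]_M\cdot h_{A_1\otimes\cdots\otimes A_n}$, where the isomorphisms $h_A:[\![A]\!]_{F_*M}\to F[\![A]\!]_M$ are $h_X=\mathrm{id}$, $h_I=\mathrm{un}$, $h_{A\otimes A'}=\mu\cdot(h_A\otimes h_{A'})$ and $h_{A\multimap A'}=m^{-1}\cdot(-\cdot h_A^{-1})\cdot(h_{A'}\cdot-)$. **Theorem.** Let $T$ be a linear $\mathcal V\lambda$-theory and $C$ a $\mathcal V\text{-}\mathsf{Cat}_{\mathsf{sep}}$-autonomous category. 1. For every $\mathcal V\text{-}\mathsf{Cat}_{\mathsf{sep}}$-autonomous functor $F:\mathrm{Syn}(T)\to C$, the interpretation $F_*\mathrm{Syn}(T)$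 is a model of $T$ in $C$. 2. For every model $M$ of $T$ in $C$ the assignment $A\mapsto[\![A]\!]_M$, $[v]\mapsto[\![v]\!]_M$ is (well defined and) a strict $\mathcal V\text{-}\mathsf{Cat}_{\mathsf{sep}}$-autonomous functor $\mathrm{Syn}(T)\to C$. 3. These constructions are inverse to each other up to isomorphism: for every $F$ as in 1 there is a (monoidal) natural isomorphism $$\bigl([v]\mapsto[\![v]\!]_{F_*\mathrm{Syn}(T)}\bigr)\cong F,$$ and for every model $M$ $$\bigl([v]\mapsto[\![v]\!]_M\bigr)_*\mathrm{Syn}(T)=M.$$ -/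

import Mathlib

set_option linter.checkUnivs false
set_option linter.unusedSectionVars false

open CategoryTheory MonoidalCategory

universe uG uO uV uC vC uD vD

namespace VLam

/-! ### Quantales, way-below relation, bases -/

/-- `y ≪ x`: every set whose join dominates `x` has a finite subset whose join dominates `y`. -/
def WayBelow {L : Type*} [CompleteLattice L] (y x : L) : Prop :=
  ∀ X : Set L, x ≤ sSup X → ∃ A : Finset L, (A : Set L) ⊆ X ∧ y ≤ sSup (A : Set L)

/-- A basis of the complete lattice `V` (which is then a continuous lattice) that is closed under
finite joins and under the multiplication of `V`, and contains the unit. -/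
structure LabelBasis (V : Type*) [CommMonoid V] [CompleteLattice V] where
  carrier : Set V
  nonempty_below : ∀ x : V, (carrier ∩ {y | WayBelow y x}).Nonempty
  directed_below : ∀ x : V, DirectedOn (· ≤ ·) (carrier ∩ {y | WayBelow y x})
  isLUB_below : ∀ x : V, IsLUB (carrier ∩ {y | WayBelow y x}) x
  iSup_mem : ∀ (n : ℕ) (q : Fin n → V), (∀ i, q i ∈ carrier) → ⨆ i, q i ∈ carrier
  mul_mem : ∀ q r : V, q ∈ carrier → r ∈ carrier → q * r ∈ carrier
  one_mem : (1 : V) ∈ carrier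

/-! ### Types, contexts, shuffles -/

/-- Types of the linear lambda calculus over a class `G` of ground types. -/
inductive Ty (G : Type uG) : Type uG
  | ground (X : G) : Ty G
  | unit : Ty G
  | tensor (A B : Ty G) : Ty G
  | lolli (A B : Ty G) : Ty G

/-- A typing context, as a list of types: variables are represented by their positions. Lists are
read from right to left, i.e. `A :: Γ` is the context `Γ, x : A`, and `Δ ++ Γ` is `Γ, Δ`. -/
abbrev Ctx (G : Type uG) : Type uG := List (Ty G)

/-- The type `(⋯ (A₁ ⊗ A₂) ⊗ ⋯) ⊗ Aₙ` of a context `A₁, …, Aₙ`; it is `I` if `n = 0`. -/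
def tens {G : Type uG} : Ctx G → Ty G
  | [] => .unit
  | [A] => A
  | A :: B :: Γ => .tensor (tens (B :: Γ)) A

/-- `Sf Γ Δ E` is the type of ways in which `E` is a shuffle of `Γ` and `Δ`. -/
inductive Sf {G : Type uG} : Ctx G → Ctx G → Ctx G → Type uG
  | nil : Sf [] [] []
  | left {A : Ty G} {Γ Δ E : Ctx G} (s : Sf Γ Δ E) : Sf (A :: Γ) Δ (A :: E)
  | right {A : Ty G} {Γ Δ E : Ctx G} (s : Sf Γ Δ E) : Sf Γ (A :: Δ) (A :: E)

/-- A signature: ground types and sorted operation symbols `f : A₁, …, Aₙ → A` with `n ≥ 1`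
(the list `A₁, …, Aₙ` is stored as a context). -/
structure Signature where
  Ground : Type uG
  Op : Type uO
  dom : Op → Ctx Ground
  cod : Op → Ty Ground
  dom_ne : ∀ f, dom f ≠ []

/-- What a derivation concludes: a term of a type, or a tuple of terms of types `A₁, …, Aₙ`. -/
inductive Goal (G : Type uG) : Type uG
  | one (A : Ty G) : Goal G
  | many (As : Ctx G) : Goal G

/-- Derivations of linear lambda calculus. As derivations are unique, a term in
context is the same thing as its derivation (up to the names of variables).
The constructors `nil` and `snoc` build the tuples `v₁, …, vₙ` to which operation
symbols are applied, the `i`-th component having its own part of the (shuffled) context. -/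
inductive Der (S : Signature.{uG, uO}) : Ctx S.Ground → Goal S.Ground → Type (max uG uO)
  | op {E : Ctx S.Ground} (f : S.Op) (vs : Der S E (.many (S.dom f))) : Der S E (.one (S.cod f))
  | hyp {A : Ty S.Ground} : Der S [A] (.one A)
  | star : Der S [] (.one .unit)
  | pm {Γ Δ E : Ctx S.Ground} {A B C : Ty S.Ground} (s : Sf Γ Δ E)
      (v : Der S Γ (.one (.tensor A B))) (w : Der S (B :: A :: Δ) (.one C)) : Der S E (.one C)
  | pair {Γ Δ E : Ctx S.Ground} {A B : Ty S.Ground} (s : Sf Γ Δ E)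
      (v : Der S Γ (.one A)) (w : Der S Δ (.one B)) : Der S E (.one (.tensor A B))
  | seq {Γ Δ E : Ctx S.Ground} {A : Ty S.Ground} (s : Sf Γ Δ E)
      (v : Der S Γ (.one .unit)) (w : Der S Δ (.one A)) : Der S E (.one A)
  | lam {Γ : Ctx S.Ground} {A B : Ty S.Ground}
      (v : Der S (A :: Γ) (.one B)) : Der S Γ (.one (.lolli A B))
  | app {Γ Δ E : Ctx S.Ground} {A B : Ty S.Ground} (s : Sf Γ Δ E)
      (v : Der S Γ (.one (.lolli A B))) (w : Der S Δ (.one A)) : Der S E (.one B)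
  | nil : Der S [] (.many [])
  | snoc {Γ Δ E As : Ctx S.Ground} {A : Ty S.Ground} (s : Sf Γ Δ E)
      (vs : Der S Γ (.many As)) (v : Der S Δ (.one A)) : Der S E (.many (A :: As))

/-- `Tm S Γ A`: the terms `v` with `Γ ▷ v : A`. -/
abbrev Tm (S : Signature.{uG, uO}) (Γ : Ctx S.Ground) (A : Ty S.Ground) := Der S Γ (.one A)

/-- `Tup S Γ As`: tuples of terms in the shuffled context `Γ`, with types `As`. -/
abbrev Tup (S : Signature.{uG, uO}) (Γ As : Ctx S.Ground) := Der S Γ (.many As)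

namespace Sf

variable {G : Type uG}

def nilL : (Γ : Ctx G) → Sf [] Γ Γ
  | [] => .nil
  | _ :: Γ => .right (nilL Γ)

def nilR : (Γ : Ctx G) → Sf Γ [] Γ
  | [] => .nil
  | _ :: Γ => .left (nilR Γ)

theorem eq_of_nilL {Γ E : Ctx G} (s : Sf [] Γ E) : Γ = E := by
  induction E generalizing Γ with
  | nil => cases s; rfl
  | cons A E ih =>
    cases s with
    | right s => rw [ih s]

def swap {Γ Δ E : Ctx G} : Sf Γ Δ E → Sf Δ Γ E
  | .nil => .nil
  | .left s => .right s.swap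
  | .right s => .left s.swap

/-- The result of regrouping a shuffle of three contexts. -/
structure Two (B C A E : Ctx G) where
  ctx : Ctx G
  inner : Sf B C ctx
  outer : Sf A ctx E

def Two.pushInner {B C A E : Ctx G} (X : Ty G) (t : Two B C A E) :
    Two (X :: B) C A (X :: E) := ⟨X :: t.ctx, .left t.inner, .right t.outer⟩

def Two.pushInner' {B C A E : Ctx G} (X : Ty G) (t : Two B C A E) :
    Two B (X :: C) A (X :: E) := ⟨X :: t.ctx, .right t.inner, .right t.outer⟩

def Two.pushOuter {B C A E : Ctx G} (X : Ty G) (t : Two B C A E) :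
    Two B C (X :: A) (X :: E) := ⟨t.ctx, t.inner, .left t.outer⟩

/-- From a shuffle of `(A, B), C` to one of `A, (B, C)`. -/
def assoc {A B C F E : Ctx G} : Sf A B F → Sf F C E → Two B C A E
  | .nil, .nil => ⟨[], .nil, .nil⟩
  | p, .right q => (assoc p q).pushInner' _
  | .left p, .left q => (assoc p q).pushOuter _
  | .right p, .left q => (assoc p q).pushInner _

/-- From a shuffle of `(A, B), C` to one of `B, (A, C)`. -/
def assoc' {A B C F E : Ctx G} (p : Sf A B F) (q : Sf F C E) : Two A C B E := assoc p.swap q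

end Sf

namespace Der

variable {S : Signature.{uG, uO}}

/-- A pair of tuples in a shuffled context. -/
structure Split (S : Signature.{uG, uO}) (Γ Δ E : Ctx S.Ground) where
  ctxL : Ctx S.Ground
  ctxR : Ctx S.Ground
  tupL : Tup S ctxL Γ
  tupR : Tup S ctxR Δ
  sf : Sf ctxL ctxR E

def Split.pushL {Γ Δ Γ' Δ' E : Ctx S.Ground} {A : Ty S.Ground} (t : Split S Γ Δ Γ')
    (p : Sf Γ' Δ' E) (v : Tm S Δ' A) : Split S (A :: Γ) Δ E :=
  let r := Sf.assoc' t.sf p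
  ⟨r.ctx, t.ctxR, .snoc r.inner t.tupL v, t.tupR, r.outer.swap⟩

def Split.pushR {Γ Δ Γ' Δ' E : Ctx S.Ground} {A : Ty S.Ground} (t : Split S Γ Δ Γ')
    (p : Sf Γ' Δ' E) (v : Tm S Δ' A) : Split S Γ (A :: Δ) E :=
  let r := Sf.assoc t.sf p
  ⟨t.ctxL, r.ctx, t.tupL, .snoc r.inner t.tupR v, r.outer⟩

/-- Splits a tuple of terms along a shuffle of its list of types. -/
def split : {Γ Δ F E : Ctx S.Ground} → Sf Γ Δ F → Tup S E F → Split S Γ Δ E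
  | _, _, _, _, .nil, .nil => ⟨[], [], .nil, .nil, .nil⟩
  | _, _, _, _, .left s, .snoc p vs v => (split s vs).pushL p v
  | _, _, _, _, .right s, .snoc p vs v => (split s vs).pushR p v

/-- The only component of a tuple of length one. -/
def single : {E : Ctx S.Ground} → {A : Ty S.Ground} → Tup S E [A] → Tm S E A
  | _, _, .snoc p .nil v => p.eq_of_nilL ▸ v

/-- Extension of a substitution below a binder. -/
def lift {E Γ : Ctx S.Ground} (A : Ty S.Ground) (r : Tup S E Γ) : Tup S (A :: E) (A :: Γ) :=
  .snoc (.right (.nilR E)) r .hyp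

/-- The variables of a context. -/
def ids : (Γ : Ctx S.Ground) → Tup S Γ Γ
  | [] => .nil
  | A :: Γ => lift A (ids Γ)

/-- Simultaneous substitution of the components of the tuple for the variables of the context. -/
def sub : {Γ E : Ctx S.Ground} → {g : Goal S.Ground} → Der S Γ g → Tup S E Γ → Der S E g
  | _, _, _, .op f vs, r => .op f (vs.sub r)
  | _, _, _, .hyp, r => single r
  | _, _, _, .star, .nil => .star
  | _, _, _, .pm s v w, r =>
      let t := split s r
      .pm t.sf (v.sub t.tupL) (w.sub (lift _ (lift _ t.tupR)))
  | _, _, _, .pair s v w, r =>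
      let t := split s r
      .pair t.sf (v.sub t.tupL) (w.sub t.tupR)
  | _, _, _, .seq s v w, r =>
      let t := split s r
      .seq t.sf (v.sub t.tupL) (w.sub t.tupR)
  | _, _, _, .lam v, r => .lam (v.sub (lift _ r))
  | _, _, _, .app s v w, r =>
      let t := split s r
      .app t.sf (v.sub t.tupL) (w.sub t.tupR)
  | _, _, _, .nil, .nil => .nil
  | _, _, _, .snoc s vs v, r =>
      let t := split s r
      .snoc t.sf (vs.sub t.tupL) (v.sub t.tupR)

/-- `inst s v w` is `v[w/x]`, where `Γ, x : A ▷ v`, `Δ ▷ w : A` and the context of the result is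
a shuffle of `Γ` and `Δ`. -/
def inst {Γ Δ E : Ctx S.Ground} {A B : Ty S.Ground} (s : Sf Γ Δ E)
    (v : Tm S (A :: Γ) B) (w : Tm S Δ A) : Tm S E B := v.sub (.snoc s (ids Γ) w)

/-- `inst₂ s p u v w` is `u[v/x, w/y]`, where `Θ, x : A, y : B ▷ u`, `Γ ▷ v : A`, `Δ ▷ w : B`. -/
def inst₂ {Γ Δ F Θ E : Ctx S.Ground} {A B C : Ty S.Ground} (s : Sf Γ Δ F) (p : Sf F Θ E)
    (u : Tm S (B :: A :: Θ) C) (v : Tm S Γ A) (w : Tm S Δ B) : Tm S E C :=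
  let r := Sf.assoc' s p
  u.sub (.snoc r.outer.swap (.snoc r.inner.swap (ids Θ) v) w)

end Der

/-! ### Theories and their theorems -/

section Theories

variable {V : Type uV} [CommMonoid V] [CompleteLattice V]

namespace Sf

/-- The shuffle `x : A, y : B` of `x : A` and `y : B`. -/
def two {G : Type uG} (A B : Ty G) : Sf [A] [B] [B, A] := .right (.left .nil)

end Sf

open Der in
/-- The equational system of linear lambda calculus: `LamEq v w` is `Γ ▷ v = w : A`. -/
inductive LamEq {S : Signature.{uG, uO}} :
    {Γ : Ctx S.Ground} → {A : Ty S.Ground} → Tm S Γ A → Tm S Γ A → Prop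
  /-- `pm v ⊗ w to x ⊗ y. u = u[v/x, w/y]` -/
  | pm_beta {Γ Δ F Θ E : Ctx S.Ground} {A B C : Ty S.Ground} (s : Sf Γ Δ F) (p : Sf F Θ E)
      (v : Tm S Γ A) (w : Tm S Δ B) (u : Tm S (B :: A :: Θ) C) :
      LamEq (.pm p (.pair s v w) u) (inst₂ s p u v w)
  /-- `pm v to x ⊗ y. u[x ⊗ y / z] = u[v/z]` -/
  | pm_eta {Γ Θ E : Ctx S.Ground} {A B C : Ty S.Ground} (s : Sf Γ Θ E)
      (v : Tm S Γ (.tensor A B)) (u : Tm S (.tensor A B :: Θ) C) :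
      LamEq (.pm s v (inst (.right (.right (.nilR Θ))) u (.pair (.two A B) .hyp .hyp)))
        (inst s.swap u v)
  /-- `∗ to ∗. v = v` -/
  | seq_beta {Γ : Ctx S.Ground} {A : Ty S.Ground} (v : Tm S Γ A) :
      LamEq (.seq (.nilL Γ) .star v) v
  /-- `v to ∗. w[∗/z] = w[v/z]` -/
  | seq_eta {Γ Θ E : Ctx S.Ground} {C : Ty S.Ground} (s : Sf Γ Θ E)
      (v : Tm S Γ .unit) (w : Tm S (.unit :: Θ) C) :
      LamEq (.seq s v (inst (.nilR Θ) w .star)) (inst s.swap w v)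
  /-- `(λ x : A. v) w = v[w/x]` -/
  | lam_beta {Γ Δ E : Ctx S.Ground} {A B : Ty S.Ground} (s : Sf Γ Δ E)
      (v : Tm S (A :: Γ) B) (w : Tm S Δ A) :
      LamEq (.app s (.lam v) w) (inst s v w)
  /-- `λ x : A. (v x) = v` -/
  | lam_eta {Γ : Ctx S.Ground} {A B : Ty S.Ground} (v : Tm S Γ (.lolli A B)) :
      LamEq (.lam (.app (.right (.nilR Γ)) v .hyp)) v
  /-- `u[v to ∗. w / z] = v to ∗. u[w/z]` -/
  | seq_conv {Γ Δ F Θ E : Ctx S.Ground} {A C : Ty S.Ground} (s : Sf Γ Δ F) (p : Sf F Θ E)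
      (v : Tm S Γ .unit) (w : Tm S Δ A) (u : Tm S (A :: Θ) C) :
      LamEq (inst p.swap u (.seq s v w))
        (.seq (Sf.assoc s p).outer v (inst (Sf.assoc s p).inner.swap u w))
  /-- `u[pm v to x ⊗ y. w / z] = pm v to x ⊗ y. u[w/z]` -/
  | pm_conv {Γ Δ F Θ E : Ctx S.Ground} {A B C D : Ty S.Ground} (s : Sf Γ Δ F) (p : Sf F Θ E)
      (v : Tm S Γ (.tensor A B)) (w : Tm S (B :: A :: Δ) D) (u : Tm S (D :: Θ) C) :
      LamEq (inst p.swap u (.pm s v w))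
        (.pm (Sf.assoc s p).outer v (inst (.right (.right (Sf.assoc s p).inner.swap)) u w))

/-- A bijection between the variables of two contexts: `cons s p` sends the last variable of
`Γ, x : A` to the one singled out by the shuffle `s`, and the others as `p` does. -/
inductive Pm {G : Type uG} : Ctx G → Ctx G → Type uG
  | nil : Pm [] []
  | cons {A : Ty G} {Γ Δ E : Ctx G} (s : Sf Δ [A] E) (p : Pm Γ Δ) : Pm (A :: Γ) E

/-- The renaming that is given by a permutation. -/
def Pm.tup {S : Signature.{uG, uO}} : {Γ Δ : Ctx S.Ground} → Pm Γ Δ → Tup S Δ Γ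
  | _, _, .nil => .nil
  | _, _, .cons s p => .snoc s p.tup .hyp

/-- The same term in a permuted context. -/
def Der.perm {S : Signature.{uG, uO}} {Γ Δ : Ctx S.Ground} {A : Ty S.Ground}
    (p : Pm Γ Δ) (v : Tm S Γ A) : Tm S Δ A := v.sub p.tup

/-- A linear `V`-lambda-theory over the signature `S`: a class of `V`-equations-in-context, the
axioms, with labels in the basis. `ax q v w` says that `Γ ▷ v =_q w : A` is an axiom. -/
structure VTheory (S : Signature.{uG, uO}) (B : LabelBasis V) where
  ax : {Γ : Ctx S.Ground} → {A : Ty S.Ground} → V → Tm S Γ A → Tm S Γ A → Prop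
  label_mem : ∀ {Γ : Ctx S.Ground} {A : Ty S.Ground} (q : V) (v w : Tm S Γ A),
    ax q v w → q ∈ B.carrier

variable {S : Signature.{uG, uO}} {B : LabelBasis V}

open Der in
/-- The theorems `Γ ▷ v =_q w : A` of a theory. The rules `nil` and `snoc` only serve to form the
rule for operation symbols: they collect `vᵢ =_{qᵢ} wᵢ` for all `i`, with label `⨂ qᵢ`. -/
inductive VTheory.Thm (T : VTheory S B) :
    {Γ : Ctx S.Ground} → {g : Goal S.Ground} → V → Der S Γ g → Der S Γ g → Prop
  | ax {Γ : Ctx S.Ground} {A : Ty S.Ground} {q : V} {v w : Tm S Γ A} (h : T.ax q v w) : Thm T q v w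
  | eqn {Γ : Ctx S.Ground} {A : Ty S.Ground} {v w : Tm S Γ A} (h : LamEq v w) : Thm T ⊤ v w
  | eqn' {Γ : Ctx S.Ground} {A : Ty S.Ground} {v w : Tm S Γ A} (h : LamEq v w) : Thm T ⊤ w v
  | refl {Γ : Ctx S.Ground} {A : Ty S.Ground} (v : Tm S Γ A) : Thm T ⊤ v v
  | trans {Γ : Ctx S.Ground} {A : Ty S.Ground} {q r : V} {v w u : Tm S Γ A}
      (h : Thm T q v w) (h' : Thm T r w u) : Thm T (q * r) v u
  | weak {Γ : Ctx S.Ground} {A : Ty S.Ground} {q r : V} {v w : Tm S Γ A}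
      (hr : r ∈ B.carrier) (hrq : r ≤ q) (h : Thm T q v w) : Thm T r v w
  | arch {Γ : Ctx S.Ground} {A : Ty S.Ground} {q : V} {v w : Tm S Γ A}
      (hq : q ∈ B.carrier) (h : ∀ r ∈ B.carrier, WayBelow r q → Thm T r v w) : Thm T q v w
  | join {Γ : Ctx S.Ground} {A : Ty S.Ground} {n : ℕ} {q : Fin n → V} {v w : Tm S Γ A}
      (h : ∀ i, Thm T (q i) v w) : Thm T (⨆ i, q i) v w
  | op {E : Ctx S.Ground} {f : S.Op} {q : V} {vs ws : Tup S E (S.dom f)}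
      (h : Thm T q vs ws) : Thm T q (Der.op f vs) (Der.op f ws)
  | nil : Thm T 1 (Der.nil (S := S)) Der.nil
  | snoc {Γ Δ E As : Ctx S.Ground} {A : Ty S.Ground} {q r : V} (s : Sf Γ Δ E)
      {vs ws : Tup S Γ As} {v w : Tm S Δ A} (h : Thm T q vs ws) (h' : Thm T r v w) :
      Thm T (q * r) (Der.snoc s vs v) (Der.snoc s ws w)
  | pair {Γ Δ E : Ctx S.Ground} {A B : Ty S.Ground} {q r : V} (s : Sf Γ Δ E)
      {v w : Tm S Γ A} {v' w' : Tm S Δ B} (h : Thm T q v w) (h' : Thm T r v' w') :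
      Thm T (q * r) (Der.pair s v v') (Der.pair s w w')
  | seq {Γ Δ E : Ctx S.Ground} {A : Ty S.Ground} {q r : V} (s : Sf Γ Δ E)
      {v w : Tm S Γ .unit} {v' w' : Tm S Δ A} (h : Thm T q v w) (h' : Thm T r v' w') :
      Thm T (q * r) (Der.seq s v v') (Der.seq s w w')
  | lam {Γ : Ctx S.Ground} {A B : Ty S.Ground} {q : V} {v w : Tm S (A :: Γ) B}
      (h : Thm T q v w) : Thm T q (Der.lam v) (Der.lam w)
  | pm {Γ Δ E : Ctx S.Ground} {A B C : Ty S.Ground} {q r : V} (s : Sf Γ Δ E)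
      {v w : Tm S Γ (.tensor A B)} {v' w' : Tm S (B :: A :: Δ) C}
      (h : Thm T q v w) (h' : Thm T r v' w') : Thm T (q * r) (Der.pm s v v') (Der.pm s w w')
  | app {Γ Δ E : Ctx S.Ground} {A B : Ty S.Ground} {q r : V} (s : Sf Γ Δ E)
      {v w : Tm S Γ (.lolli A B)} {v' w' : Tm S Δ A} (h : Thm T q v w) (h' : Thm T r v' w') :
      Thm T (q * r) (Der.app s v v') (Der.app s w w')
  | perm {Γ Δ : Ctx S.Ground} {A : Ty S.Ground} {q : V} (p : Pm Γ Δ) {v w : Tm S Γ A}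
      (h : Thm T q v w) : Thm T q (Der.perm p v) (Der.perm p w)
  | subst {Γ Δ E : Ctx S.Ground} {A B : Ty S.Ground} {q r : V} (s : Sf Γ Δ E)
      {v w : Tm S (A :: Γ) B} {v' w' : Tm S Δ A} (h : Thm T q v w) (h' : Thm T r v' w') :
      Thm T (q * r) (inst s v v') (inst s w w')

end Theories

/-! ### Computation rules for shuffles and substitution -/

namespace Sf

variable {G : Type uG}

theorem swap_nilL (Γ : Ctx G) : (nilL Γ).swap = nilR Γ := by
  induction Γ with
  | nil => rfl
  | cons A Γ ih => simp only [nilL, nilR, swap, ih]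

theorem swap_nilR (Γ : Ctx G) : (nilR Γ).swap = nilL Γ := by
  induction Γ with
  | nil => rfl
  | cons A Γ ih => simp only [nilL, nilR, swap, ih]

theorem swap_swap {Γ Δ E : Ctx G} (s : Sf Γ Δ E) : s.swap.swap = s := by
  induction s with
  | nil => rfl
  | left s ih => simp only [swap, ih]
  | right s ih => simp only [swap, ih]

theorem assoc_right {A B C F E : Ctx G} {X : Ty G} (p : Sf A B F) (q : Sf F C E) :
    assoc p (.right (A := X) q) = (assoc p q).pushInner' X := by
  cases p <;> rfl

theorem assoc_nilR {A B F : Ctx G} (p : Sf A B F) : assoc p (nilR F) = ⟨B, nilR B, p⟩ := by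
  induction p with
  | nil => rfl
  | left s ih => rw [nilR, assoc, ih]; rfl
  | right s ih => rw [nilR, assoc, ih]; rfl

theorem assoc_nilL_left {B C E : Ctx G} (p : Sf B C E) : assoc (nilL B) p = ⟨E, p, nilL E⟩ := by
  induction p with
  | nil => rfl
  | left s ih => rw [nilL, assoc, ih]; rfl
  | right s ih => rw [assoc_right, ih]; rfl

theorem assoc_nilR_left {B C E : Ctx G} (p : Sf B C E) : assoc (nilR B) p = ⟨C, nilL C, p⟩ := by
  induction p with
  | nil => rfl
  | left s ih => rw [nilR, assoc, ih]; rfl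
  | right s ih => rw [assoc_right, ih]; rfl

end Sf

namespace Der

variable {S : Signature.{uG, uO}}

theorem split_left_lift {Γ Δ F E : Ctx S.Ground} {A : Ty S.Ground} (s : Sf Γ Δ F) (r : Tup S E F) :
    split (.left s) (lift A r) = ⟨A :: (split s r).ctxL, (split s r).ctxR,
      lift A (split s r).tupL, (split s r).tupR, .left (split s r).sf⟩ := by
  rw [lift, split, Split.pushL, Sf.assoc', Sf.assoc_right, Sf.assoc_nilR]
  simp only [Sf.Two.pushInner', Sf.swap, Sf.swap_swap, lift]

theorem split_right_lift {Γ Δ F E : Ctx S.Ground} {A : Ty S.Ground} (s : Sf Γ Δ F) (r : Tup S E F) :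
    split (.right s) (lift A r) = ⟨(split s r).ctxL, A :: (split s r).ctxR,
      (split s r).tupL, lift A (split s r).tupR, .right (split s r).sf⟩ := by
  rw [lift, split, Split.pushR, Sf.assoc_right, Sf.assoc_nilR]; rfl

theorem split_ids {Γ Δ F : Ctx S.Ground} (s : Sf Γ Δ F) :
    split s (ids (S := S) F) = ⟨Γ, Δ, ids Γ, ids Δ, s⟩ := by
  induction s with
  | nil => rfl
  | left s ih => rw [ids, split_left_lift, ih]; rfl
  | right s ih => rw [ids, split_right_lift, ih]; rfl

theorem split_nilL {Γ E : Ctx S.Ground} (r : Tup S E Γ) :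
    split (.nilL Γ) r = ⟨[], E, .nil, r, .nilL E⟩ := by
  induction Γ generalizing E with
  | nil => cases r; rfl
  | cons A Γ ih =>
    cases r with
    | snoc p vs v => rw [Sf.nilL, split, ih, Split.pushR, Sf.assoc_nilL_left]

theorem split_nilR {Γ E : Ctx S.Ground} (r : Tup S E Γ) :
    split (.nilR Γ) r = ⟨E, [], r, .nil, .nilR E⟩ := by
  induction Γ generalizing E with
  | nil => cases r; rfl
  | cons A Γ ih =>
    cases r with
    | snoc p vs v =>
      rw [Sf.nilR, split, ih, Split.pushL, Sf.assoc', Sf.swap_nilR, Sf.assoc_nilL_left,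
        Sf.swap_nilL]

theorem sub_ids {Γ : Ctx S.Ground} {g : Goal S.Ground} (v : Der S Γ g) : v.sub (ids Γ) = v := by
  induction v with
  | op f vs ih => simp only [sub, ih]
  | hyp => rfl
  | star => rfl
  | pm s v w ih ih' =>
    rw [sub, split_ids, ih]
    exact congrArg _ ih'
  | pair s v w ih ih' => rw [sub, split_ids, ih, ih']
  | seq s v w ih ih' => rw [sub, split_ids, ih, ih']
  | lam v ih => exact congrArg _ ih
  | app s v w ih ih' => rw [sub, split_ids, ih, ih']
  | nil => rfl
  | snoc s vs v ih ih' => rw [sub, split_ids, ih, ih']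

/-- `f[t/x]` for a term `f` in one variable. -/
def ap {A B : Ty S.Ground} {Γ : Ctx S.Ground} (f : Tm S [A] B) (t : Tm S Γ A) : Tm S Γ B :=
  inst (.nilL Γ) f t

theorem ap_hyp {A B : Ty S.Ground} (f : Tm S [A] B) : ap f .hyp = f := sub_ids f

theorem hyp_sub {A : Ty S.Ground} {Γ : Ctx S.Ground} (t : Tm S Γ A) :
    (Der.hyp : Tm S [A] A).sub (.snoc (.nilL Γ) .nil t) = t := rfl

theorem hyp_ap {A : Ty S.Ground} {Γ : Ctx S.Ground} (t : Tm S Γ A) :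
    ap (Der.hyp : Tm S [A] A) t = t := rfl

theorem app_sub {A B : Ty S.Ground} {Γ E : Ctx S.Ground} (f : Tm S [A] B) (t : Tm S Γ A)
    (r : Tup S E Γ) :
    (Der.app (.nilL Γ) (.lam f) t).sub r = Der.app (.nilL E) (.lam f) (t.sub r) := by
  rw [sub, split_nilL]
  exact congrArg (fun x => Der.app (.nilL E) (.lam x) (t.sub r)) (sub_ids f)

end Der

/-! ### The `V`-categories of terms -/

section Dist

variable {V : Type uV} [CommMonoid V] [CompleteLattice V] {S : Signature.{uG, uO}}
  {B : LabelBasis V} (T : VTheory S B)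

namespace VTheory

open Der

/-- The distance `⋁ {q | v =_q w is a theorem}` of two terms. -/
def dist {Γ : Ctx S.Ground} {A : Ty S.Ground} (v w : Tm S Γ A) : V := sSup {q | T.Thm q v w}

/-- The equivalence relation by which the separated quotient of the `V`-category of terms is formed:
`v ≤ w` and `w ≤ v` in its natural order. -/
def Eqv {Γ : Ctx S.Ground} {A : Ty S.Ground} (v w : Tm S Γ A) : Prop :=
  1 ≤ T.dist v w ∧ 1 ≤ T.dist w v

variable {T}

theorem le_dist {Γ : Ctx S.Ground} {A : Ty S.Ground} {q : V} {v w : Tm S Γ A} (h : T.Thm q v w) :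
    q ≤ T.dist v w := le_sSup h

theorem one_le_dist_self {Γ : Ctx S.Ground} {A : Ty S.Ground} (v : Tm S Γ A) :
    1 ≤ T.dist v v := le_top.trans (le_dist (.refl v))

theorem Eqv.of_eq {Γ : Ctx S.Ground} {A : Ty S.Ground} {v w : Tm S Γ A} (h : v = w) :
    T.Eqv v w := h ▸ ⟨one_le_dist_self v, one_le_dist_self v⟩

theorem Eqv.rfl {Γ : Ctx S.Ground} {A : Ty S.Ground} {v : Tm S Γ A} : T.Eqv v v := .of_eq (Eq.refl _)

theorem Eqv.symm {Γ : Ctx S.Ground} {A : Ty S.Ground} {v w : Tm S Γ A} (h : T.Eqv v w) :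
    T.Eqv w v := ⟨h.2, h.1⟩

theorem Eqv.of_lamEq {Γ : Ctx S.Ground} {A : Ty S.Ground} {v w : Tm S Γ A} (h : LamEq v w) :
    T.Eqv v w := ⟨le_top.trans (le_dist (.eqn h)), le_top.trans (le_dist (.eqn' h))⟩

theorem dist_lam {Γ : Ctx S.Ground} {A B : Ty S.Ground} (v w : Tm S (A :: Γ) B) :
    T.dist v w ≤ T.dist (.lam v) (.lam w) := sSup_le_sSup fun _ => .lam

theorem Eqv.lam {Γ : Ctx S.Ground} {A B : Ty S.Ground} {v w : Tm S (A :: Γ) B}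
    (h : T.Eqv v w) : T.Eqv (.lam v) (.lam w) :=
  ⟨h.1.trans (dist_lam _ _), h.2.trans (dist_lam _ _)⟩

theorem app_eqv_ap {A B : Ty S.Ground} {Γ : Ctx S.Ground} (f : Tm S [A] B) (t : Tm S Γ A) :
    T.Eqv (.app (.nilL Γ) (.lam f) t) (Der.ap f t) := .of_lamEq (.lam_beta _ _ _)

variable [IsQuantale V]

theorem dist_mul_le {Γ Δ E : Ctx S.Ground} {A B C : Ty S.Ground} {v w : Tm S Γ A}
    {v' w' : Tm S Δ B} {u u' : Tm S E C}
    (h : ∀ q r, T.Thm q v w → T.Thm r v' w' → T.Thm (q * r) u u') :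
    T.dist v w * T.dist v' w' ≤ T.dist u u' := by
  unfold dist
  rw [sSup_mul_distrib]
  refine iSup₂_le fun q hq => ?_
  rw [mul_sSup_distrib]
  exact iSup₂_le fun r hr => le_sSup (h q r hq hr)

theorem mul_le_mul_of_quantale {a b c d : V} (h : a ≤ b) (h' : c ≤ d) : a * c ≤ b * d := by
  have key : ∀ x y z : V, y ≤ z → x * y ≤ x * z := fun x y z hyz => by
    have : z = sSup {y, z} := by rw [sSup_pair, sup_eq_right.2 hyz]
    rw [this, mul_sSup_distrib]
    exact le_iSup₂_of_le y (by simp) le_rfl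
  calc a * c ≤ a * d := key _ _ _ h'
    _ = d * a := mul_comm _ _
    _ ≤ d * b := key _ _ _ h
    _ = b * d := mul_comm _ _

theorem one_le_mul_of_quantale {a b : V} (h : 1 ≤ a) (h' : 1 ≤ b) : 1 ≤ a * b := by
  simpa using mul_le_mul_of_quantale h h'

theorem dist_trans {Γ : Ctx S.Ground} {A : Ty S.Ground} (v w u : Tm S Γ A) :
    T.dist v w * T.dist w u ≤ T.dist v u := dist_mul_le fun _ _ => .trans

theorem Eqv.trans {Γ : Ctx S.Ground} {A : Ty S.Ground} {v w u : Tm S Γ A} (h : T.Eqv v w)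
    (h' : T.Eqv w u) : T.Eqv v u :=
  ⟨(one_le_mul_of_quantale h.1 h'.1).trans (dist_trans _ _ _),
    (one_le_mul_of_quantale h'.2 h.2).trans (dist_trans _ _ _)⟩

theorem dist_le_of_eqv {Γ : Ctx S.Ground} {A : Ty S.Ground} {v w v' w' : Tm S Γ A}
    (h : T.Eqv v v') (h' : T.Eqv w w') : T.dist v w ≤ T.dist v' w' := by
  calc T.dist v w = 1 * T.dist v w * 1 := by simp
    _ ≤ T.dist v' v * T.dist v w * T.dist w w' :=
      mul_le_mul_of_quantale (mul_le_mul_of_quantale h.2 le_rfl) h'.1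
    _ ≤ T.dist v' w * T.dist w w' := mul_le_mul_of_quantale (dist_trans _ _ _) le_rfl
    _ ≤ _ := dist_trans _ _ _

theorem dist_congr {Γ : Ctx S.Ground} {A : Ty S.Ground} {v w v' w' : Tm S Γ A}
    (h : T.Eqv v v') (h' : T.Eqv w w') : T.dist v w = T.dist v' w' :=
  le_antisymm (dist_le_of_eqv h h') (dist_le_of_eqv h.symm h'.symm)

theorem Eqv.of_dist {Γ Δ E : Ctx S.Ground} {A B C : Ty S.Ground} {v w : Tm S Γ A}
    {v' w' : Tm S Δ B} {u u' : Tm S E C} (h₁ : T.dist v w * T.dist v' w' ≤ T.dist u u')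
    (h₂ : T.dist w v * T.dist w' v' ≤ T.dist u' u) (h : T.Eqv v w) (h' : T.Eqv v' w') :
    T.Eqv u u' :=
  ⟨(one_le_mul_of_quantale h.1 h'.1).trans h₁, (one_le_mul_of_quantale h.2 h'.2).trans h₂⟩

theorem dist_pair {Γ Δ E : Ctx S.Ground} {A B : Ty S.Ground} (s : Sf Γ Δ E)
    (v w : Tm S Γ A) (v' w' : Tm S Δ B) :
    T.dist v w * T.dist v' w' ≤ T.dist (.pair s v v') (.pair s w w') :=
  dist_mul_le fun _ _ => .pair s

theorem dist_pm {Γ Δ E : Ctx S.Ground} {A B C : Ty S.Ground} (s : Sf Γ Δ E)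
    (v w : Tm S Γ (.tensor A B)) (v' w' : Tm S (B :: A :: Δ) C) :
    T.dist v w * T.dist v' w' ≤ T.dist (.pm s v v') (.pm s w w') :=
  dist_mul_le fun _ _ => .pm s

theorem dist_seq {Γ Δ E : Ctx S.Ground} {A : Ty S.Ground} (s : Sf Γ Δ E)
    (v w : Tm S Γ .unit) (v' w' : Tm S Δ A) :
    T.dist v w * T.dist v' w' ≤ T.dist (.seq s v v') (.seq s w w') :=
  dist_mul_le fun _ _ => .seq s

theorem dist_app {Γ Δ E : Ctx S.Ground} {A B : Ty S.Ground} (s : Sf Γ Δ E)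
    (v w : Tm S Γ (.lolli A B)) (v' w' : Tm S Δ A) :
    T.dist v w * T.dist v' w' ≤ T.dist (.app s v v') (.app s w w') :=
  dist_mul_le fun _ _ => .app s

theorem dist_inst {Γ Δ E : Ctx S.Ground} {A B : Ty S.Ground} (s : Sf Γ Δ E)
    (v w : Tm S (A :: Γ) B) (v' w' : Tm S Δ A) :
    T.dist v w * T.dist v' w' ≤ T.dist (inst s v v') (inst s w w') :=
  dist_mul_le fun _ _ => .subst s

theorem Eqv.pair {Γ Δ E : Ctx S.Ground} {A B : Ty S.Ground} (s : Sf Γ Δ E)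
    {v w : Tm S Γ A} {v' w' : Tm S Δ B} : T.Eqv v w → T.Eqv v' w' →
    T.Eqv (.pair s v v') (.pair s w w') := .of_dist (dist_pair _ _ _ _ _) (dist_pair _ _ _ _ _)

theorem Eqv.pm {Γ Δ E : Ctx S.Ground} {A B C : Ty S.Ground} (s : Sf Γ Δ E)
    {v w : Tm S Γ (.tensor A B)} {v' w' : Tm S (B :: A :: Δ) C} : T.Eqv v w → T.Eqv v' w' →
    T.Eqv (.pm s v v') (.pm s w w') := .of_dist (dist_pm _ _ _ _ _) (dist_pm _ _ _ _ _)

theorem Eqv.seq {Γ Δ E : Ctx S.Ground} {A : Ty S.Ground} (s : Sf Γ Δ E)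
    {v w : Tm S Γ .unit} {v' w' : Tm S Δ A} : T.Eqv v w → T.Eqv v' w' →
    T.Eqv (.seq s v v') (.seq s w w') := .of_dist (dist_seq _ _ _ _ _) (dist_seq _ _ _ _ _)

theorem Eqv.app {Γ Δ E : Ctx S.Ground} {A B : Ty S.Ground} (s : Sf Γ Δ E)
    {v w : Tm S Γ (.lolli A B)} {v' w' : Tm S Δ A} : T.Eqv v w → T.Eqv v' w' →
    T.Eqv (.app s v v') (.app s w w') := .of_dist (dist_app _ _ _ _ _) (dist_app _ _ _ _ _)

theorem Eqv.inst {Γ Δ E : Ctx S.Ground} {A B : Ty S.Ground} (s : Sf Γ Δ E)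
    {v w : Tm S (A :: Γ) B} {v' w' : Tm S Δ A} : T.Eqv v w → T.Eqv v' w' →
    T.Eqv (inst s v v') (inst s w w') := .of_dist (dist_inst _ _ _ _ _) (dist_inst _ _ _ _ _)

theorem Eqv.ap {Γ : Ctx S.Ground} {A B : Ty S.Ground}
    {v w : Tm S [A] B} {v' w' : Tm S Γ A} : T.Eqv v w → T.Eqv v' w' →
    T.Eqv (ap v v') (ap w w') := .inst _

theorem inst_ap {A B C : Ty S.Ground} {Γ Δ E : Ctx S.Ground} (f : Tm S [A] B)
    (t : Tm S (C :: Γ) A) (s : Sf Γ Δ E) (u : Tm S Δ C) :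
    T.Eqv (Der.inst s (Der.ap f t) u) (Der.ap f (Der.inst s t u)) :=
  ((app_eqv_ap f t).symm.inst s .rfl).trans ((Eqv.of_eq (app_sub f t _)).trans (app_eqv_ap f _))

theorem ap_ap {A B C : Ty S.Ground} {Γ : Ctx S.Ground} (g : Tm S [B] C) (f : Tm S [A] B)
    (t : Tm S Γ A) : T.Eqv (Der.ap (Der.ap g f) t) (Der.ap g (Der.ap f t)) := inst_ap g f _ t

end VTheory

end Dist

/-! ### The structural morphisms of the syntactic category, as terms -/

namespace Der

variable {S : Signature.{uG, uO}}

/-- `f ⊗ g`, i.e. `z ▷ pm z to x ⊗ y. f[x] ⊗ g[y]`. -/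
def tHom {A A' B B' : Ty S.Ground} (f : Tm S [A] A') (g : Tm S [B] B') :
    Tm S [.tensor A B] (.tensor A' B') := .pm (.left .nil) .hyp (.pair (.two A B) f g)

/-- `z ▷ pm z to x ⊗ c. pm x to a ⊗ b. a ⊗ (b ⊗ c)`. -/
def aHom (A B C : Ty S.Ground) :
    Tm S [.tensor (.tensor A B) C] (.tensor A (.tensor B C)) :=
  .pm (.left .nil) .hyp (.pm (.two _ _) .hyp
    (.pair (.right (.left (.right .nil))) .hyp (.pair (.left (.right .nil)) .hyp .hyp)))

/-- `z ▷ pm z to a ⊗ x. pm x to b ⊗ c. (a ⊗ b) ⊗ c`. -/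
def aInv (A B C : Ty S.Ground) :
    Tm S [.tensor A (.tensor B C)] (.tensor (.tensor A B) C) :=
  .pm (.left .nil) .hyp (.pm (.left (.right .nil)) .hyp
    (.pair (.right (.left (.left .nil))) (.pair (.two A B) .hyp .hyp) .hyp))

/-- `z ▷ pm z to i ⊗ a. i to ∗. a`. -/
def lHom (A : Ty S.Ground) : Tm S [.tensor .unit A] A :=
  .pm (.left .nil) .hyp (.seq (.two .unit A) .hyp .hyp)

/-- `a ▷ ∗ ⊗ a`. -/
def lInv (A : Ty S.Ground) : Tm S [A] (.tensor .unit A) := .pair (.right .nil) .star .hyp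

/-- `z ▷ pm z to a ⊗ i. i to ∗. a`. -/
def rHom (A : Ty S.Ground) : Tm S [.tensor A .unit] A :=
  .pm (.left .nil) .hyp (.seq (.left (.right .nil)) .hyp .hyp)

/-- `a ▷ a ⊗ ∗`. -/
def rInv (A : Ty S.Ground) : Tm S [A] (.tensor A .unit) := .pair (.left .nil) .hyp .star

/-- `z ▷ pm z to a ⊗ b. b ⊗ a`. -/
def bHom (A B : Ty S.Ground) : Tm S [.tensor A B] (.tensor B A) :=
  .pm (.left .nil) .hyp (.pair (.left (.right .nil)) .hyp .hyp)

/-- `y ▷ λ x. f[x ⊗ y]`. -/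
def cur {A B C : Ty S.Ground} (f : Tm S [.tensor A B] C) : Tm S [B] (.lolli A C) :=
  .lam (ap f (.pair (.left (.right .nil)) .hyp .hyp))

/-- `z ▷ pm z to x ⊗ y. g[y] x`. -/
def unc {A B C : Ty S.Ground} (g : Tm S [B] (.lolli A C)) : Tm S [.tensor A B] C :=
  .pm (.left .nil) .hyp (.app (.left (.right .nil)) g .hyp)

theorem ap_pm {A B C D : Ty S.Ground} {Γ : Ctx S.Ground} (w : Tm S [B, A] C)
    (v : Tm S [D] (.tensor A B)) (t : Tm S Γ D) :
    ap (.pm (.left .nil) v w) t = .pm (.nilR Γ) (ap v t) w := by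
  change Der.sub (.pm (.nilR [D]) v w) _ = _
  rw [sub, split_nilR]
  exact congrArg (Der.pm (.nilR Γ) (ap v t)) (sub_ids w)

theorem inst_pair_left {Γ Δ F Θ E : Ctx S.Ground} {A B C : Ty S.Ground} (s : Sf Γ Δ F)
    (p : Sf F Θ E) (v : Tm S (A :: Γ) B) (w : Tm S Δ C) (t : Tm S Θ A) :
    inst p (.pair (.left s) v w) t =
      .pair (Sf.assoc s.swap p).outer.swap (inst (Sf.assoc s.swap p).inner v t) w := by
  rw [inst, sub, split, split_ids, Split.pushL, sub_ids]
  rfl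

theorem inst_pair_right {Γ Δ F Θ E : Ctx S.Ground} {A B C : Ty S.Ground} (s : Sf Γ Δ F)
    (p : Sf F Θ E) (v : Tm S Γ B) (w : Tm S (A :: Δ) C) (t : Tm S Θ A) :
    inst p (.pair (.right s) v w) t =
      .pair (Sf.assoc s p).outer v (inst (Sf.assoc s p).inner w t) := by
  rw [inst, sub, split, split_ids, Split.pushR, sub_ids]
  rfl

end Der

section Structural

variable {V : Type uV} [CommMonoid V] [CompleteLattice V] [IsQuantale V] {S : Signature.{uG, uO}}
  {B : LabelBasis V} {T : VTheory S B}

namespace VTheory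

open Der

theorem ap_pm_conv {Γ Δ E : Ctx S.Ground} {A B C D : Ty S.Ground} (s : Sf Γ Δ E)
    (v : Tm S Γ (.tensor A B)) (w : Tm S (B :: A :: Δ) D) (f : Tm S [D] C) :
    T.Eqv (Der.ap f (.pm s v w)) (.pm s v (Der.ap f w)) := by
  have h := LamEq.pm_conv s (.nilR E) v w f
  rw [Sf.assoc_nilR, Sf.swap_nilR] at h
  simp only [Sf.swap_nilR] at h
  exact .of_lamEq h

theorem ap_seq_conv {Γ Δ E : Ctx S.Ground} {C D : Ty S.Ground} (s : Sf Γ Δ E)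
    (v : Tm S Γ .unit) (w : Tm S Δ D) (f : Tm S [D] C) :
    T.Eqv (Der.ap f (.seq s v w)) (.seq s v (Der.ap f w)) := by
  have h := LamEq.seq_conv s (.nilR E) v w f
  rw [Sf.assoc_nilR, Sf.swap_nilR] at h
  simp only [Sf.swap_nilR] at h
  exact .of_lamEq h

/-- Two terms in a variable of type `A ⊗ B` are equal if they are so at `a ⊗ b`. -/
theorem ext_pair {A B C : Ty S.Ground} {f g : Tm S [.tensor A B] C}
    (h : T.Eqv (Der.ap f (.pair (.two A B) .hyp .hyp)) (Der.ap g (.pair (.two A B) .hyp .hyp))) :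
    T.Eqv f g := by
  have key : ∀ k : Tm S [.tensor A B] C,
      T.Eqv (.pm (.left .nil) .hyp (Der.ap k (.pair (.two A B) .hyp .hyp))) k := fun k =>
    (Eqv.of_lamEq (LamEq.pm_eta (.left .nil) .hyp k)).trans (.of_eq (ap_hyp k))
  exact (key f).symm.trans ((Eqv.pm _ .rfl h).trans (key g))

theorem ext_star {C : Ty S.Ground} {f g : Tm S [.unit] C}
    (h : T.Eqv (Der.ap f .star) (Der.ap g .star)) : T.Eqv f g := by
  have key : ∀ k : Tm S [.unit] C, T.Eqv (.seq (.left .nil) .hyp (Der.ap k .star)) k := fun k =>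
    (Eqv.of_lamEq (LamEq.seq_eta (.left .nil) .hyp k)).trans (.of_eq (ap_hyp k))
  exact (key f).symm.trans ((Eqv.seq _ .rfl h).trans (key g))

/-- A variable of type `A ⊗ B` of a term may be replaced by `a ⊗ b`. -/
theorem ext_step {A B D C : Ty S.Ground} {Θ E : Ctx S.Ground} (s : Sf [.tensor A B] Θ E)
    (u : Tm S (.tensor A B :: Θ) D) {f g : Tm S [D] C}
    (h : T.Eqv (Der.ap f (inst (.right (.right (.nilR Θ))) u (.pair (.two A B) .hyp .hyp)))
      (Der.ap g (inst (.right (.right (.nilR Θ))) u (.pair (.two A B) .hyp .hyp)))) :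
    T.Eqv (Der.ap f (inst s.swap u .hyp)) (Der.ap g (inst s.swap u .hyp)) := by
  have key : ∀ k : Tm S [D] C, T.Eqv (Der.ap k (inst s.swap u .hyp))
      (.pm s .hyp (Der.ap k (inst (.right (.right (.nilR Θ))) u (.pair (.two A B) .hyp .hyp)))) :=
    fun k => (Eqv.ap .rfl (Eqv.of_lamEq (LamEq.pm_eta s .hyp u)).symm).trans (ap_pm_conv _ _ _ _)
  exact (key f).trans ((Eqv.pm _ .rfl h).trans (key g).symm)

/-- A variable of type `I` of a term may be replaced by `∗`. -/
theorem ext_step_star {D C : Ty S.Ground} {Θ E : Ctx S.Ground} (s : Sf [.unit] Θ E)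
    (u : Tm S (.unit :: Θ) D) {f g : Tm S [D] C}
    (h : T.Eqv (Der.ap f (inst (.nilR Θ) u .star)) (Der.ap g (inst (.nilR Θ) u .star))) :
    T.Eqv (Der.ap f (inst s.swap u .hyp)) (Der.ap g (inst s.swap u .hyp)) := by
  have key : ∀ k : Tm S [D] C, T.Eqv (Der.ap k (inst s.swap u .hyp))
      (.seq s .hyp (Der.ap k (inst (.nilR Θ) u .star))) :=
    fun k => (Eqv.ap .rfl (Eqv.of_lamEq (LamEq.seq_eta s .hyp u)).symm).trans
      (ap_seq_conv _ _ _ _)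
  exact (key f).trans ((Eqv.seq _ .rfl h).trans (key g).symm)

theorem ext_pair_left {A B C D : Ty S.Ground} {f g : Tm S [.tensor (.tensor A B) C] D}
    (h : T.Eqv (Der.ap f (.pair (.left (.left (.right .nil))) (.pair (.two A B) .hyp .hyp) .hyp))
      (Der.ap g (.pair (.left (.left (.right .nil))) (.pair (.two A B) .hyp .hyp) .hyp))) :
    T.Eqv f g := by
  have h' := ext_step (T := T) (f := f) (g := g) (.right (.left .nil))
    (.pair (.left (.right .nil)) .hyp .hyp)
  rw [inst_pair_left, inst_pair_left] at h'
  exact ext_pair (h' h)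

theorem ext_pair_right {A B C D : Ty S.Ground} {f g : Tm S [.tensor A (.tensor B C)] D}
    (h : T.Eqv (Der.ap f (.pair (.right (.right (.left .nil))) .hyp (.pair (.two B C) .hyp .hyp)))
      (Der.ap g (.pair (.right (.right (.left .nil))) .hyp (.pair (.two B C) .hyp .hyp)))) :
    T.Eqv f g := by
  have h' := ext_step (T := T) (f := f) (g := g) (.left (.right .nil))
    (.pair (.right (.left .nil)) .hyp .hyp)
  rw [inst_pair_right, inst_pair_right] at h'
  exact ext_pair (h' h)

theorem ext_star_left {C D : Ty S.Ground} {f g : Tm S [.tensor .unit C] D}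
    (h : T.Eqv (Der.ap f (.pair (.nilL _) .star .hyp)) (Der.ap g (.pair (.nilL _) .star .hyp))) :
    T.Eqv f g := by
  have h' := ext_step_star (T := T) (f := f) (g := g) (.right (.left .nil))
    (.pair (.left (.right .nil)) .hyp .hyp)
  rw [inst_pair_left, inst_pair_left] at h'
  exact ext_pair (h' h)

theorem ext_star_right {C D : Ty S.Ground} {f g : Tm S [.tensor C .unit] D}
    (h : T.Eqv (Der.ap f (.pair (.nilR _) .hyp .star)) (Der.ap g (.pair (.nilR _) .hyp .star))) :
    T.Eqv f g := by
  have h' := ext_step_star (T := T) (f := f) (g := g) (.left (.right .nil))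
    (.pair (.right (.left .nil)) .hyp .hyp)
  rw [inst_pair_right, inst_pair_right] at h'
  exact ext_pair (h' h)

theorem ext_four {A B C D K : Ty S.Ground}
    {f g : Tm S [.tensor (.tensor (.tensor A B) C) D] K}
    (h : T.Eqv (Der.ap f (.pair (.left (.left (.left (.right .nil))))
        (.pair (.left (.left (.right .nil))) (.pair (.two A B) .hyp .hyp) .hyp) .hyp))
      (Der.ap g (.pair (.left (.left (.left (.right .nil))))
        (.pair (.left (.left (.right .nil))) (.pair (.two A B) .hyp .hyp) .hyp) .hyp))) :
    T.Eqv f g := by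
  have h' := ext_step (T := T) (f := f) (g := g) (.right (.left (.right .nil)))
    (.pair (.left (.left (.right .nil))) (.pair (.left (.right .nil)) .hyp .hyp) .hyp)
  rw [inst_pair_left, inst_pair_left, inst_pair_left, inst_pair_left] at h'
  exact ext_pair_left (h' h)

theorem ext_mid {A C K : Ty S.Ground}
    {f g : Tm S [.tensor (.tensor A .unit) C] K}
    (h : T.Eqv (Der.ap f (.pair (.left (.right .nil)) (.pair (.nilR _) .hyp .star) .hyp))
      (Der.ap g (.pair (.left (.right .nil)) (.pair (.nilR _) .hyp .star) .hyp))) :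
    T.Eqv f g := by
  have h' := ext_step_star (T := T) (f := f) (g := g) (.left (.right (.right .nil)))
    (.pair (.left (.left (.right .nil))) (.pair (.right (.left .nil)) .hyp .hyp) .hyp)
  rw [inst_pair_left, inst_pair_right, inst_pair_left, inst_pair_right] at h'
  exact ext_pair_left (h' h)

theorem ap_pm_pair {A B C : Ty S.Ground} {Γ Δ E : Ctx S.Ground} (w : Tm S [B, A] C)
    (s : Sf Γ Δ E) (t : Tm S Γ A) (u : Tm S Δ B) :
    T.Eqv (Der.ap (.pm (.left .nil) .hyp w) (.pair s t u))
      (w.sub (.snoc s (.snoc (.nilL Γ) .nil t) u)) := by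
  rw [ap_pm, hyp_ap]
  have h := LamEq.pm_beta s (.nilR E) t u w
  rw [inst₂, Sf.assoc', Sf.assoc_nilR] at h
  simp only [Sf.swap_swap, Sf.swap_nilR] at h
  exact .of_lamEq h

theorem split_two {A B : Ty S.Ground} {Γ Δ E : Ctx S.Ground}
    (s : Sf Γ Δ E) (t : Tm S Γ A) (u : Tm S Δ B) :
    split (.two A B) (.snoc s (.snoc (.nilL Γ) .nil t) u) =
      ⟨Γ, Δ, .snoc (.nilL Γ) .nil t, .snoc (.nilL Δ) .nil u, s⟩ := by
  change (split (.nilR [A]) (Der.snoc (.nilL Γ) .nil t)).pushR s u = _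
  rw [split_nilR, Split.pushR, Sf.assoc_nilR_left]

theorem split_two' {A B : Ty S.Ground} {Γ Δ E : Ctx S.Ground}
    (s : Sf Γ Δ E) (t : Tm S Γ A) (u : Tm S Δ B) :
    split (.left (.right .nil)) (.snoc s (.snoc (.nilL Γ) .nil t) u) =
      ⟨Δ, Γ, .snoc (.nilL Δ) .nil u, .snoc (.nilL Γ) .nil t, s.swap⟩ := by
  change (split (.nilL [A]) (Der.snoc (.nilL Γ) .nil t)).pushL s u = _
  rw [split_nilL, Split.pushL, Sf.assoc', Sf.swap_nilL, Sf.assoc_nilR_left]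

theorem ap_tHom {A A' B B' : Ty S.Ground} {Γ Δ E : Ctx S.Ground} (f : Tm S [A] A')
    (g : Tm S [B] B') (s : Sf Γ Δ E) (t : Tm S Γ A) (u : Tm S Δ B) :
    T.Eqv (Der.ap (tHom f g) (.pair s t u)) (.pair s (Der.ap f t) (Der.ap g u)) := by
  refine (ap_pm_pair _ _ _ _).trans (.of_eq ?_)
  rw [sub, split_two]
  rfl

theorem ap_bHom {A B : Ty S.Ground} {Γ Δ E : Ctx S.Ground}
    (s : Sf Γ Δ E) (t : Tm S Γ A) (u : Tm S Δ B) :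
    T.Eqv (Der.ap (bHom A B) (.pair s t u)) (.pair s.swap u t) := by
  refine (ap_pm_pair _ _ _ _).trans (.of_eq ?_)
  rw [sub, split_two']
  rfl

theorem ap_lHom {A : Ty S.Ground} {Γ : Ctx S.Ground} (t : Tm S Γ A) :
    T.Eqv (Der.ap (lHom A) (.pair (.nilL Γ) .star t)) t := by
  refine (ap_pm_pair _ _ _ _).trans ((Eqv.of_eq ?_).trans (.of_lamEq (.seq_beta t)))
  rw [sub, split_two]
  rfl

theorem ap_rHom {A : Ty S.Ground} {Γ : Ctx S.Ground} (t : Tm S Γ A) :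
    T.Eqv (Der.ap (rHom A) (.pair (.nilR Γ) t .star)) t := by
  refine (ap_pm_pair _ _ _ _).trans ((Eqv.of_eq ?_).trans (.of_lamEq (.seq_beta t)))
  rw [sub, split_two', Sf.swap_nilR]
  rfl

theorem ap_unc {A B C : Ty S.Ground} {Γ Δ E : Ctx S.Ground} (g : Tm S [B] (.lolli A C))
    (s : Sf Γ Δ E) (t : Tm S Γ A) (u : Tm S Δ B) :
    T.Eqv (Der.ap (unc g) (.pair s t u)) (.app s.swap (Der.ap g u) t) := by
  refine (ap_pm_pair _ _ _ _).trans (.of_eq ?_)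
  rw [sub, split_two']
  rfl

theorem split_aHom {A B C : Ty S.Ground} {Θ : Ctx S.Ground} (v : Tm S Θ C) :
    split (.right (.left (.right .nil))) (lift B (lift A (.snoc (.nilL Θ) .nil v))) =
      ⟨[A], B :: Θ, lift A .nil, lift B (.snoc (.nilL Θ) .nil v), .right (.left (.nilL Θ))⟩ := by
  have h : split (.right .nil) (.snoc (.nilL Θ) .nil v) = _ := split_nilL (Γ := [C]) _
  rw [split_right_lift, split_left_lift, h]

theorem split_aHom' {B C : Ty S.Ground} {Θ : Ctx S.Ground} (v : Tm S Θ C) :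
    split (.left (.right .nil)) (lift B (.snoc (.nilL Θ) .nil v)) =
      ⟨[B], Θ, lift B .nil, .snoc (.nilL Θ) .nil v, .left (.nilL Θ)⟩ := by
  have h : split (.right .nil) (.snoc (.nilL Θ) .nil v) = _ := split_nilL (Γ := [C]) _
  rw [split_left_lift, h]

theorem split_aInv {A B C : Ty S.Ground} {Θ : Ctx S.Ground} (v : Tm S Θ A) :
    split (.right (.left (.left .nil))) (lift C (lift B (.snoc (.nilL Θ) .nil v))) =
      ⟨B :: Θ, [C], lift B (.snoc (.nilL Θ) .nil v), lift C .nil, .right (.left (.nilR Θ))⟩ := by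
  have h : split (.left .nil) (.snoc (.nilL Θ) .nil v) = _ := split_nilR (Γ := [A]) _
  rw [split_right_lift, split_left_lift, h]

theorem split_aInv' {A B : Ty S.Ground} {Θ : Ctx S.Ground} (v : Tm S Θ A) :
    split (.two A B) (lift B (.snoc (.nilL Θ) .nil v)) =
      ⟨Θ, [B], .snoc (.nilL Θ) .nil v, lift B .nil, .right (.nilR Θ)⟩ := by
  have h : split (.left .nil) (.snoc (.nilL Θ) .nil v) = _ := split_nilR (Γ := [A]) _
  rw [Sf.two, split_right_lift, h]

theorem pushL_nilL {A : Ty S.Ground} {Γ Θ E : Ctx S.Ground} (q : Sf Θ Γ E) (t : Tm S Γ A) :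
    (⟨[], Θ, .nil, ids Θ, .nilL Θ⟩ : Split S [] Θ Θ).pushL q t =
      ⟨Γ, Θ, .snoc (.nilL Γ) .nil t, ids Θ, q.swap⟩ := by
  rw [Split.pushL, Sf.assoc', Sf.swap_nilL, Sf.assoc_nilR_left]

theorem pushL_nilR {A : Ty S.Ground} {Γ Θ E : Ctx S.Ground} (q : Sf Θ Γ E) (t : Tm S Γ A) :
    (⟨Θ, [], ids Θ, .nil, .nilR Θ⟩ : Split S Θ [] Θ).pushL q t =
      ⟨E, [], .snoc q (ids Θ) t, .nil, .nilR E⟩ := by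
  rw [Split.pushL, Sf.assoc', Sf.swap_nilR, Sf.assoc_nilL_left, Sf.swap_nilL]

theorem pushR_nilR {A : Ty S.Ground} {Γ Δ Θ E : Ctx S.Ground} (r : Tup S Θ Γ)
    (q : Sf Θ Δ E) (t : Tm S Δ A) :
    (⟨Θ, [], r, .nil, .nilR Θ⟩ : Split S Γ [] Θ).pushR q t =
      ⟨Θ, Δ, r, .snoc (.nilL Δ) .nil t, q⟩ := by
  rw [Split.pushR, Sf.assoc_nilR_left]

theorem split_aHom_beta {A B : Ty S.Ground} {Γ Δ Θ F E : Ctx S.Ground}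
    (q : Sf Θ Γ F) (q' : Sf F Δ E) (t : Tm S Γ A) (u : Tm S Δ B) :
    split (.right (.left (.nilL Θ))) (.snoc q' (.snoc q (ids Θ) t) u) =
      ⟨Γ, (Sf.assoc q.swap q').ctx, .snoc (.nilL Γ) .nil t,
        .snoc (Sf.assoc q.swap q').inner (ids Θ) u, (Sf.assoc q.swap q').outer⟩ := by
  rw [split, split, split_ids]
  exact congrArg (fun x => Split.pushR x q' u) (pushL_nilL q t)

theorem split_aInv_beta {A B : Ty S.Ground} {Γ Δ Θ F E : Ctx S.Ground}
    (q : Sf Θ Γ F) (q' : Sf F Δ E) (t : Tm S Γ A) (u : Tm S Δ B) :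
    split (.right (.left (.nilR Θ))) (.snoc q' (.snoc q (ids Θ) t) u) =
      ⟨F, Δ, .snoc q (ids Θ) t, .snoc (.nilL Δ) .nil u, q'⟩ := by
  rw [split, split, split_ids]
  exact (congrArg (fun x => Split.pushR x q' u) (pushL_nilR q t)).trans (pushR_nilR _ _ _)

theorem ap_aHom {A B C : Ty S.Ground} {Γ Δ Θ F E : Ctx S.Ground}
    (s : Sf Γ Δ F) (p : Sf F Θ E) (t : Tm S Γ A) (u : Tm S Δ B) (v : Tm S Θ C) :
    T.Eqv (Der.ap (aHom A B C) (.pair p (.pair s t u) v))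
      (.pair (Sf.assoc (Sf.assoc s.swap p).inner.swap.swap (Sf.assoc s.swap p).outer.swap).outer t
        (.pair (Sf.assoc (Sf.assoc s.swap p).inner.swap.swap
          (Sf.assoc s.swap p).outer.swap).inner.swap u v)) := by
  refine (ap_pm_pair _ _ _ _).trans ?_
  have e : (Der.pair (S := S) (A := A) (.right (.left (.right .nil))) .hyp
      (.pair (.left (.right .nil)) .hyp .hyp)).sub
        (lift B (lift A (.snoc (.nilL Θ) .nil v))) =
      .pair (.right (.left (.nilL Θ))) .hyp (.pair (.left (.nilL Θ)) .hyp v) := by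
    rw [sub, split_aHom]
    refine congrArg (Der.pair _ _) ?_
    rw [sub, split_aHom']
    rfl
  rw [sub, split_two]
  refine (Eqv.of_eq (congrArg (Der.pm p (.pair s t u)) e)).trans ?_
  refine (Eqv.of_lamEq (LamEq.pm_beta s p t u _)).trans (.of_eq ?_)
  rw [inst₂, sub, Sf.assoc', split_aHom_beta]
  refine congrArg (Der.pair _ _) ?_
  change inst _ (Der.pair (.left (.nilL Θ)) .hyp v) u = _
  rw [inst_pair_left, Sf.swap_nilL, Sf.assoc_nilR_left]
  rfl

theorem ap_aInv {A B C : Ty S.Ground} {Γ Δ Θ F E : Ctx S.Ground}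
    (s : Sf Γ Δ F) (p : Sf Θ F E) (t : Tm S Γ B) (u : Tm S Δ C) (v : Tm S Θ A) :
    T.Eqv (Der.ap (aInv A B C) (.pair p v (.pair s t u)))
      (.pair (Sf.assoc s.swap p.swap).outer.swap
        (.pair (Sf.assoc s.swap p.swap).inner.swap v t) u) := by
  refine (ap_pm_pair _ _ _ _).trans ?_
  have e : (Der.pair (S := S) (.right (.left (.left .nil)))
      (.pair (.two A B) .hyp .hyp) (.hyp (A := C))).sub
        (lift C (lift B (.snoc (.nilL Θ) .nil v))) =
      .pair (.right (.left (.nilR Θ))) (.pair (.right (.nilR Θ)) v .hyp) .hyp := by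
    rw [sub, split_aInv]
    refine congrArg (fun x => Der.pair _ x _) ?_
    rw [sub, split_aInv']
    rfl
  rw [sub, split_two']
  refine (Eqv.of_eq (congrArg (Der.pm p.swap (.pair s t u)) e)).trans ?_
  refine (Eqv.of_lamEq (LamEq.pm_beta s p.swap t u _)).trans (.of_eq ?_)
  rw [inst₂, sub, Sf.assoc', split_aInv_beta]
  refine congrArg (fun x => Der.pair _ x u) ?_
  change inst _ (Der.pair (.right (.nilR Θ)) v .hyp) t = _
  rw [inst_pair_right, Sf.assoc_nilR_left]
  rfl

end VTheory

end Structural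

/-! ### The syntactic category -/

section Syntactic

variable {V : Type uV} [CommMonoid V] [CompleteLattice V] [IsQuantale V] {S : Signature.{uG, uO}}
  {B : LabelBasis V}

/-- The equivalence of terms in context. -/
abbrev VTheory.setoid (T : VTheory S B) (Γ : Ctx S.Ground) (A : Ty S.Ground) :
    Setoid (Tm S Γ A) := ⟨T.Eqv, fun _ => .rfl, .symm, .trans⟩

/-- Equivalence classes `[v]` of terms in context. -/
def Q (T : VTheory S B) (Γ : Ctx S.Ground) (A : Ty S.Ground) : Type (max uG uO) :=
  Quotient (T.setoid Γ A)

namespace Q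

variable {T : VTheory S B}

/-- The class of a term. -/
def mk (T : VTheory S B) {Γ : Ctx S.Ground} {A : Ty S.Ground} (v : Tm S Γ A) : Q T Γ A :=
  Quotient.mk _ v

theorem sound {Γ : Ctx S.Ground} {A : Ty S.Ground} {v w : Tm S Γ A} (h : T.Eqv v w) :
    mk T v = mk T w := Quotient.sound h

theorem exact {Γ : Ctx S.Ground} {A : Ty S.Ground} {v w : Tm S Γ A} (h : mk T v = mk T w) :
    T.Eqv v w := Quotient.exact h

theorem ind {Γ : Ctx S.Ground} {A : Ty S.Ground} {p : Q T Γ A → Prop} (h : ∀ v, p (mk T v))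
    (x : Q T Γ A) : p x := Quotient.ind h x

def ap {A C : Ty S.Ground} {Γ : Ctx S.Ground} : Q T [A] C → Q T Γ A → Q T Γ C :=
  Quotient.map₂ Der.ap fun _ _ h _ _ h' => VTheory.Eqv.ap h h'

def pair {Γ Δ E : Ctx S.Ground} {A C : Ty S.Ground} (s : Sf Γ Δ E) :
    Q T Γ A → Q T Δ C → Q T E (.tensor A C) :=
  Quotient.map₂ (Der.pair s) fun _ _ h _ _ h' => VTheory.Eqv.pair s h h'

def app {Γ Δ E : Ctx S.Ground} {A C : Ty S.Ground} (s : Sf Γ Δ E) :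
    Q T Γ (.lolli A C) → Q T Δ A → Q T E C :=
  Quotient.map₂ (Der.app s) fun _ _ h _ _ h' => VTheory.Eqv.app s h h'

def lam {Γ : Ctx S.Ground} {A C : Ty S.Ground} : Q T (A :: Γ) C → Q T Γ (.lolli A C) :=
  Quotient.map Der.lam fun _ _ h => VTheory.Eqv.lam h

def hyp {A : Ty S.Ground} : Q T [A] A := mk T .hyp

def star : Q T [] .unit := mk T .star

def tHom {A A' C C' : Ty S.Ground} : Q T [A] A' → Q T [C] C' →
    Q T [.tensor A C] (.tensor A' C') :=
  Quotient.map₂ Der.tHom fun _ _ h _ _ h' => VTheory.Eqv.pm _ .rfl (VTheory.Eqv.pair _ h h')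

theorem ap_hyp {A C : Ty S.Ground} (f : Q T [A] C) : f.ap hyp = f := by
  induction f using ind with | h f => exact congrArg (mk T) (Der.ap_hyp f)

theorem hyp_ap {A : Ty S.Ground} {Γ : Ctx S.Ground} (t : Q T Γ A) : (hyp (T := T)).ap t = t := by
  induction t using ind with | h t => rfl

theorem ap_ap {A C D : Ty S.Ground} {Γ : Ctx S.Ground} (g : Q T [C] D) (f : Q T [A] C)
    (t : Q T Γ A) : (g.ap f).ap t = g.ap (f.ap t) := by
  induction t using ind with | h t =>
  induction f using ind with | h f =>
  induction g using ind with | h g => exact sound (VTheory.ap_ap g f t)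

theorem ap_tHom {A A' C C' : Ty S.Ground} {Γ Δ E : Ctx S.Ground} (f : Q T [A] A')
    (g : Q T [C] C') (s : Sf Γ Δ E) (t : Q T Γ A) (u : Q T Δ C) :
    (tHom f g).ap (pair s t u) = pair s (f.ap t) (g.ap u) := by
  induction t using ind with | h t =>
  induction u using ind with | h u =>
  induction f using ind with | h f =>
  induction g using ind with | h g => exact sound (VTheory.ap_tHom f g s t u)

theorem ap_bHom {A C : Ty S.Ground} {Γ Δ E : Ctx S.Ground} (s : Sf Γ Δ E) (t : Q T Γ A)
    (u : Q T Δ C) : (mk T (.bHom A C)).ap (pair s t u) = pair s.swap u t := by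
  induction t using ind with | h t =>
  induction u using ind with | h u => exact sound (VTheory.ap_bHom s t u)

theorem ap_lHom {A : Ty S.Ground} {Γ : Ctx S.Ground} (t : Q T Γ A) :
    (mk T (.lHom A)).ap (pair (.nilL Γ) star t) = t := by
  induction t using ind with | h t => exact sound (VTheory.ap_lHom t)

theorem ap_rHom {A : Ty S.Ground} {Γ : Ctx S.Ground} (t : Q T Γ A) :
    (mk T (.rHom A)).ap (pair (.nilR Γ) t star) = t := by
  induction t using ind with | h t => exact sound (VTheory.ap_rHom t)

theorem ap_aHom {A C D : Ty S.Ground} {Γ Δ Θ F E : Ctx S.Ground}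
    (s : Sf Γ Δ F) (p : Sf F Θ E) (t : Q T Γ A) (u : Q T Δ C) (v : Q T Θ D) :
    (mk T (.aHom A C D)).ap (pair p (pair s t u) v) =
      pair (Sf.assoc (Sf.assoc s.swap p).inner.swap.swap (Sf.assoc s.swap p).outer.swap).outer t
        (pair (Sf.assoc (Sf.assoc s.swap p).inner.swap.swap
          (Sf.assoc s.swap p).outer.swap).inner.swap u v) := by
  induction t using ind with | h t =>
  induction u using ind with | h u =>
  induction v using ind with | h v => exact sound (VTheory.ap_aHom s p t u v)

theorem ap_aInv {A C D : Ty S.Ground} {Γ Δ Θ F E : Ctx S.Ground}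
    (s : Sf Γ Δ F) (p : Sf Θ F E) (t : Q T Γ C) (u : Q T Δ D) (v : Q T Θ A) :
    (mk T (.aInv A C D)).ap (pair p v (pair s t u)) =
      pair (Sf.assoc s.swap p.swap).outer.swap
        (pair (Sf.assoc s.swap p.swap).inner.swap v t) u := by
  induction t using ind with | h t =>
  induction u using ind with | h u =>
  induction v using ind with | h v => exact sound (VTheory.ap_aInv s p t u v)

theorem ap_aHom_of {A C D : Ty S.Ground} {Γ Δ Θ F Y E : Ctx S.Ground}
    (s : Sf Γ Δ F) (p : Sf F Θ E) (o : Sf Γ Y E) (k : Sf Δ Θ Y)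
    (h : Sf.assoc (Sf.assoc s.swap p).inner (Sf.assoc s.swap p).outer.swap = ⟨Y, k.swap, o⟩)
    (t : Q T Γ A) (u : Q T Δ C) (v : Q T Θ D) :
    (mk T (.aHom A C D)).ap (pair p (pair s t u) v) = pair o t (pair k u v) := by
  rw [ap_aHom, Sf.swap_swap, h, Sf.swap_swap]

theorem ap_aInv_of {A C D : Ty S.Ground} {Γ Δ Θ F Y E : Ctx S.Ground}
    (s : Sf Γ Δ F) (p : Sf Θ F E) (o : Sf Y Δ E) (k : Sf Θ Γ Y)
    (h : Sf.assoc s.swap p.swap = ⟨Y, k.swap, o.swap⟩) (t : Q T Γ C) (u : Q T Δ D) (v : Q T Θ A) :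
    (mk T (.aInv A C D)).ap (pair p v (pair s t u)) = pair o (pair k v t) u := by
  rw [ap_aInv, h, Sf.swap_swap, Sf.swap_swap]

theorem ap_lInv {A : Ty S.Ground} {Γ : Ctx S.Ground} (t : Q T Γ A) :
    (mk T (.lInv A)).ap t = pair (.nilL Γ) star t := by
  induction t using ind with | h t =>
  refine congrArg (mk T) ?_
  rw [Der.lInv, Der.ap, Der.inst_pair_right, show Sf.nil.assoc (Sf.nilL Γ) = _ from
    Sf.assoc_nilL_left (Sf.nilL Γ)]
  rfl

theorem ap_rInv {A : Ty S.Ground} {Γ : Ctx S.Ground} (t : Q T Γ A) :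
    (mk T (.rInv A)).ap t = pair (.nilR Γ) t star := by
  induction t using ind with | h t =>
  refine congrArg (mk T) ?_
  rw [Der.rInv, Der.ap, Der.inst_pair_left, Sf.swap, show Sf.nil.assoc (Sf.nilL Γ) = _ from
    Sf.assoc_nilL_left (Sf.nilL Γ), Sf.swap_nilL]
  rfl

theorem ext_pair {A C D : Ty S.Ground} {f g : Q T [.tensor A C] D}
    (h : f.ap (pair (.two A C) hyp hyp) = g.ap (pair (.two A C) hyp hyp)) : f = g := by
  induction f using ind with | h f =>
  induction g using ind with | h g => exact sound (VTheory.ext_pair (exact h))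

theorem ext_pair_left {A C D K : Ty S.Ground} {f g : Q T [.tensor (.tensor A C) D] K}
    (h : f.ap (pair (.left (.left (.right .nil))) (pair (.two A C) hyp hyp) hyp) =
      g.ap (pair (.left (.left (.right .nil))) (pair (.two A C) hyp hyp) hyp)) : f = g := by
  induction f using ind with | h f =>
  induction g using ind with | h g => exact sound (VTheory.ext_pair_left (exact h))

theorem ext_pair_right {A C D K : Ty S.Ground} {f g : Q T [.tensor A (.tensor C D)] K}
    (h : f.ap (pair (.right (.right (.left .nil))) hyp (pair (.two C D) hyp hyp)) =
      g.ap (pair (.right (.right (.left .nil))) hyp (pair (.two C D) hyp hyp))) : f = g := by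
  induction f using ind with | h f =>
  induction g using ind with | h g => exact sound (VTheory.ext_pair_right (exact h))

theorem ext_star_left {C D : Ty S.Ground} {f g : Q T [.tensor .unit C] D}
    (h : f.ap (pair (.nilL _) star hyp) = g.ap (pair (.nilL _) star hyp)) : f = g := by
  induction f using ind with | h f =>
  induction g using ind with | h g => exact sound (VTheory.ext_star_left (exact h))

theorem ext_star_right {C D : Ty S.Ground} {f g : Q T [.tensor C .unit] D}
    (h : f.ap (pair (.nilR _) hyp star) = g.ap (pair (.nilR _) hyp star)) : f = g := by
  induction f using ind with | h f =>
  induction g using ind with | h g => exact sound (VTheory.ext_star_right (exact h))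

theorem ext_four {A C D D' K : Ty S.Ground}
    {f g : Q T [.tensor (.tensor (.tensor A C) D) D'] K}
    (h : f.ap (pair (.left (.left (.left (.right .nil))))
        (pair (.left (.left (.right .nil))) (pair (.two A C) hyp hyp) hyp) hyp) =
      g.ap (pair (.left (.left (.left (.right .nil))))
        (pair (.left (.left (.right .nil))) (pair (.two A C) hyp hyp) hyp) hyp)) : f = g := by
  induction f using ind with | h f =>
  induction g using ind with | h g => exact sound (VTheory.ext_four (exact h))

theorem ext_mid {A C K : Ty S.Ground} {f g : Q T [.tensor (.tensor A .unit) C] K}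
    (h : f.ap (pair (.left (.right .nil)) (pair (.nilR _) hyp star) hyp) =
      g.ap (pair (.left (.right .nil)) (pair (.nilR _) hyp star) hyp)) : f = g := by
  induction f using ind with | h f =>
  induction g using ind with | h g => exact sound (VTheory.ext_mid (exact h))

/-! Laws of the structural morphisms. -/

theorem id_tHom {A C : Ty S.Ground} :
    tHom (hyp : Q T [A] A) (hyp : Q T [C] C) = hyp := by
  refine ext_pair ?_
  rw [ap_tHom, hyp_ap, hyp_ap, hyp_ap]

theorem tHom_ap {A A' A'' C C' C'' : Ty S.Ground} (f : Q T [A] A') (f' : Q T [A'] A'')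
    (g : Q T [C] C') (g' : Q T [C'] C'') :
    (tHom f' g').ap (tHom f g) = tHom (f'.ap f) (g'.ap g) := by
  refine ext_pair ?_
  rw [ap_ap, ap_tHom, ap_tHom, ap_tHom, ap_ap, ap_ap]

theorem aHom_nat {A A' C C' D D' : Ty S.Ground} (f : Q T [A] A') (g : Q T [C] C')
    (h : Q T [D] D') : (mk T (.aHom A' C' D')).ap (tHom (tHom f g) h) =
      (tHom f (tHom g h)).ap (mk T (.aHom A C D)) := by
  refine ext_pair_left ?_
  rw [ap_ap, ap_ap, ap_tHom, ap_tHom,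
    ap_aHom_of (.two _ _) (.left (.left (.right .nil))) (.right (.left (.right .nil)))
      (.left (.right .nil)) rfl,
    ap_aHom_of (.two _ _) (.left (.left (.right .nil))) (.right (.left (.right .nil)))
      (.left (.right .nil)) rfl, ap_tHom, ap_tHom]

theorem lHom_nat {A A' : Ty S.Ground} (f : Q T [A] A') :
    (mk T (.lHom A')).ap (tHom hyp f) = f.ap (mk T (.lHom A)) := by
  refine ext_star_left ?_
  rw [ap_ap, ap_ap, ap_tHom, ap_lHom, hyp_ap, ap_lHom]

theorem rHom_nat {A A' : Ty S.Ground} (f : Q T [A] A') :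
    (mk T (.rHom A')).ap (tHom f hyp) = f.ap (mk T (.rHom A)) := by
  refine ext_star_right ?_
  rw [ap_ap, ap_ap, ap_tHom, ap_rHom, hyp_ap, ap_rHom]

theorem aHom_aInv {A C D : Ty S.Ground} :
    (mk T (.aInv A C D)).ap (mk T (.aHom A C D)) = hyp := by
  refine ext_pair_left ?_
  rw [ap_ap, ap_aHom_of (.two _ _) (.left (.left (.right .nil))) (.right (.left (.right .nil)))
      (.left (.right .nil)) rfl, ap_aInv_of (.left (.right .nil)) (.right (.left (.right .nil)))
      (.left (.left (.right .nil))) (.two _ _) rfl, hyp_ap]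

theorem aInv_aHom {A C D : Ty S.Ground} :
    (mk T (.aHom A C D)).ap (mk T (.aInv A C D)) = hyp := by
  refine ext_pair_right ?_
  rw [ap_ap, ap_aInv_of (.two _ _) (.right (.right (.left .nil))) (.right (.left (.left .nil)))
      (.right (.left .nil)) rfl, ap_aHom_of (.right (.left .nil)) (.right (.left (.left .nil)))
      (.right (.right (.left .nil))) (.two _ _) rfl, hyp_ap]

theorem lHom_lInv {A : Ty S.Ground} : (mk T (.lInv A)).ap (mk T (.lHom A)) = hyp := by
  refine ext_star_left ?_
  rw [ap_ap, ap_lHom, ap_lInv, hyp_ap]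

theorem lInv_lHom {A : Ty S.Ground} : (mk T (.lHom A)).ap (mk T (.lInv A)) = hyp := by
  rw [← ap_hyp (mk T (.lInv A)), ap_lInv, ap_lHom]

theorem rHom_rInv {A : Ty S.Ground} : (mk T (.rInv A)).ap (mk T (.rHom A)) = hyp := by
  refine ext_star_right ?_
  rw [ap_ap, ap_rHom, ap_rInv, hyp_ap]

theorem rInv_rHom {A : Ty S.Ground} : (mk T (.rHom A)).ap (mk T (.rInv A)) = hyp := by
  rw [← ap_hyp (mk T (.rInv A)), ap_rInv, ap_rHom]

theorem pentagon {A C D E : Ty S.Ground} :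
    ((tHom hyp (mk T (.aHom C D E))).ap (mk T (.aHom A (.tensor C D) E))).ap
      (tHom (mk T (.aHom A C D)) hyp) =
      (mk T (.aHom A C (.tensor D E))).ap (mk T (.aHom (.tensor A C) D E)) := by
  refine ext_four ?_
  rw [ap_ap, ap_ap, ap_ap, ap_tHom,
    ap_aHom_of (.two _ _) (.left (.left (.right .nil))) (.right (.left (.right .nil)))
      (.left (.right .nil)) rfl, hyp_ap,
    ap_aHom_of (.right (.left (.right .nil))) (.left (.left (.left (.right .nil))))
      (.right (.left (.right (.right .nil)))) (.left (.left (.right .nil))) rfl, ap_tHom, hyp_ap,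
    ap_aHom_of (.left (.right .nil)) (.left (.left (.right .nil)))
      (.left (.right (.right .nil))) (.left (.right .nil)) rfl,
    ap_aHom_of (.left (.left (.right .nil))) (.left (.left (.left (.right .nil))))
      (.left (.left (.right (.right .nil)))) (.left (.right .nil)) rfl,
    ap_aHom_of (.two _ _) (.left (.left (.right (.right .nil))))
      (.right (.left (.right (.right .nil)))) (.left (.right (.right .nil))) rfl]

theorem triangle {A C : Ty S.Ground} :
    (tHom hyp (mk T (.lHom C))).ap (mk T (.aHom A .unit C)) = tHom (mk T (.rHom A)) hyp := by
  refine ext_mid ?_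
  rw [ap_ap, ap_aHom_of (.nilR _) (.left (.right .nil)) (.left (.right .nil)) (.nilL _) rfl,
    ap_tHom, ap_tHom, ap_rHom, ap_lHom, hyp_ap, hyp_ap]

theorem bHom_nat {A A' C C' : Ty S.Ground} (f : Q T [A] A') (g : Q T [C] C') :
    (mk T (.bHom A' C')).ap (tHom f g) = (tHom g f).ap (mk T (.bHom A C)) := by
  refine ext_pair ?_
  rw [ap_ap, ap_ap, ap_tHom, ap_bHom, ap_bHom, ap_tHom]

theorem bHom_bHom {A C : Ty S.Ground} : (mk T (.bHom C A)).ap (mk T (.bHom A C)) = hyp := by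
  refine ext_pair ?_
  rw [ap_ap, ap_bHom, ap_bHom, hyp_ap, Sf.swap_swap]

theorem hexagon {A C D : Ty S.Ground} :
    ((mk T (.aHom C D A)).ap (mk T (.bHom A (.tensor C D)))).ap (mk T (.aHom A C D)) =
      ((tHom hyp (mk T (.bHom A D))).ap (mk T (.aHom C A D))).ap
        (tHom (mk T (.bHom A C)) hyp) := by
  refine ext_pair_left ?_
  rw [ap_ap, ap_ap, ap_ap, ap_ap, ap_tHom, hyp_ap,
    ap_aHom_of (.two _ _) (.left (.left (.right .nil))) (.right (.left (.right .nil)))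
      (.left (.right .nil)) rfl, ap_bHom, ap_bHom,
    ap_aHom_of (.left (.right .nil)) (Sf.swap (.right (.left (.right .nil))))
      (.left (.right (.right .nil))) (.right (.left .nil)) rfl,
    ap_aHom_of (Sf.two _ _).swap (.left (.left (.right .nil)))
      (.left (.right (.right .nil))) (.left (.right .nil)) rfl, ap_tHom, hyp_ap, ap_bHom]
  rfl

theorem hexagon' {A C D : Ty S.Ground} :
    ((mk T (.aInv D A C)).ap (mk T (.bHom (.tensor A C) D))).ap (mk T (.aInv A C D)) =
      ((tHom (mk T (.bHom A D)) hyp).ap (mk T (.aInv A D C))).ap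
        (tHom hyp (mk T (.bHom C D))) := by
  refine ext_pair_right ?_
  rw [ap_ap, ap_ap, ap_ap, ap_ap, ap_tHom, hyp_ap,
    ap_aInv_of (.two _ _) (.right (.right (.left .nil))) (.right (.left (.left .nil)))
      (.right (.left .nil)) rfl, ap_bHom, ap_bHom,
    ap_aInv_of (.right (.left .nil)) (Sf.swap (.right (.left (.left .nil))))
      (.left (.right (.left .nil))) (.left (.right .nil)) rfl,
    ap_aInv_of (Sf.two _ _).swap (.right (.right (.left .nil)))
      (.left (.right (.left .nil))) (.right (.left .nil)) rfl, ap_tHom, hyp_ap, ap_bHom]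
  rfl

end Q

/-- The objects of the syntactic category are the types. -/
def Syn (_ : VTheory S B) : Type uG := Ty S.Ground

namespace Syn

variable {T : VTheory S B}

/-- The morphisms are the classes of terms in one variable, composed by substitution. -/
instance : Category.{max uG uO} (Syn T) where
  Hom A C := Q T [A] C
  id _ := Q.hyp
  comp f g := g.ap f
  id_comp f := Q.ap_hyp f
  comp_id f := Q.hyp_ap f
  assoc f g h := (Q.ap_ap h g f).symm

instance : MonoidalCategoryStruct (Syn T) where
  tensorObj A C := Ty.tensor A C
  whiskerLeft _ _ _ f := Q.tHom Q.hyp f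
  whiskerRight f _ := Q.tHom f Q.hyp
  tensorHom f g := Q.tHom f g
  tensorUnit := Ty.unit
  associator A C D := ⟨Q.mk T (.aHom A C D), Q.mk T (.aInv A C D), Q.aHom_aInv, Q.aInv_aHom⟩
  leftUnitor A := ⟨Q.mk T (.lHom A), Q.mk T (.lInv A), Q.lHom_lInv, Q.lInv_lHom⟩
  rightUnitor A := ⟨Q.mk T (.rHom A), Q.mk T (.rInv A), Q.rHom_rInv, Q.rInv_rHom⟩

instance : MonoidalCategory (Syn T) := .ofTensorHom
  (id_tensorHom_id := fun _ _ => Q.id_tHom)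
  (id_tensorHom := fun _ _ _ _ => rfl)
  (tensorHom_id := fun _ _ => rfl)
  (tensorHom_comp_tensorHom := fun f₁ f₂ g₁ g₂ => Q.tHom_ap f₁ g₁ f₂ g₂)
  (associator_naturality := fun f g h => Q.aHom_nat f g h)
  (leftUnitor_naturality := fun f => Q.lHom_nat f)
  (rightUnitor_naturality := fun f => Q.rHom_nat f)
  (pentagon := fun W X Y Z => Q.pentagon (A := W) (C := X) (D := Y) (E := Z))
  (triangle := fun X Y => Q.triangle (A := X) (C := Y))

instance : SymmetricCategory (Syn T) where
  braiding A C := ⟨Q.mk T (.bHom A C), Q.mk T (.bHom C A), Q.bHom_bHom, Q.bHom_bHom⟩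
  braiding_naturality_right _ _ _ f := Q.bHom_nat Q.hyp f
  braiding_naturality_left f _ := Q.bHom_nat f Q.hyp
  hexagon_forward X Y Z := Q.hexagon (A := X) (C := Y) (D := Z)
  hexagon_reverse X Y Z := Q.hexagon' (A := X) (C := Y) (D := Z)
  symmetry _ _ := Q.bHom_bHom

end Syn

end Syntactic

section Closed

variable {V : Type uV} [CommMonoid V] [CompleteLattice V] [IsQuantale V] {S : Signature.{uG, uO}}
  {B : LabelBasis V} {T : VTheory S B}

namespace VTheory

theorem unc_cur {A C D : Ty S.Ground} (f : Tm S [.tensor A C] D) :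
    T.Eqv (Der.unc (Der.cur f)) f := by
  refine ext_pair ((ap_unc _ _ _ _).trans ?_)
  rw [Der.ap_hyp]
  refine (Eqv.of_lamEq (LamEq.lam_beta _ _ _)).trans ((inst_ap f _ _ _).trans ?_)
  rw [Der.inst_pair_left]
  exact Eqv.rfl

theorem cur_unc {A C D : Ty S.Ground} (g : Tm S [C] (.lolli A D)) :
    T.Eqv (Der.cur (Der.unc g)) g := by
  refine (Eqv.lam (ap_unc _ _ _ _)).trans ?_
  rw [Der.ap_hyp]
  exact .of_lamEq (LamEq.lam_eta g)

end VTheory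

namespace Q

/-- `y ▷ λ x. f[x ⊗ y]`. -/
def cur {A C D : Ty S.Ground} : Q T [.tensor A C] D → Q T [C] (.lolli A D) :=
  Quotient.map Der.cur fun _ _ h => VTheory.Eqv.lam (VTheory.Eqv.ap h .rfl)

/-- `z ▷ pm z to x ⊗ y. g[y] x`. -/
def unc {A C D : Ty S.Ground} : Q T [C] (.lolli A D) → Q T [.tensor A C] D :=
  Quotient.map Der.unc fun _ _ h => VTheory.Eqv.pm _ .rfl (VTheory.Eqv.app _ h .rfl)

theorem unc_cur {A C D : Ty S.Ground} (f : Q T [.tensor A C] D) : unc (cur f) = f := by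
  induction f using ind with | h f => exact sound (VTheory.unc_cur f)

theorem cur_unc {A C D : Ty S.Ground} (g : Q T [C] (.lolli A D)) : cur (unc g) = g := by
  induction g using ind with | h g => exact sound (VTheory.cur_unc g)

theorem ap_unc {A C D : Ty S.Ground} {Γ Δ E : Ctx S.Ground} (g : Q T [C] (.lolli A D))
    (s : Sf Γ Δ E) (t : Q T Γ A) (u : Q T Δ C) :
    (unc g).ap (pair s t u) = app s.swap (g.ap u) t := by
  induction t using ind with | h t =>
  induction u using ind with | h u =>
  induction g using ind with | h g => exact sound (VTheory.ap_unc g s t u)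

theorem unc_nat {A C C' D : Ty S.Ground} (g : Q T [C'] (.lolli A D)) (f : Q T [C] C') :
    unc (g.ap f) = (unc g).ap (tHom hyp f) := by
  refine ext_pair ?_
  rw [ap_ap, ap_tHom, ap_unc, ap_unc, ap_ap, hyp_ap]

theorem cur_nat {A C C' D : Ty S.Ground} (g : Q T [.tensor A C'] D) (f : Q T [C] C') :
    cur (g.ap (tHom hyp f)) = (cur g).ap f := by
  rw [← cur_unc ((cur g).ap f), unc_nat, unc_cur]

/-- The `V`-category structure of the quotient. -/
def dist {Γ : Ctx S.Ground} {A : Ty S.Ground} : Q T Γ A → Q T Γ A → V :=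
  Quotient.lift₂ T.dist fun _ _ _ _ h h' => VTheory.dist_congr h h'

theorem one_le_dist {Γ : Ctx S.Ground} {A : Ty S.Ground} (x : Q T Γ A) : 1 ≤ dist x x := by
  induction x using ind with | h v => exact VTheory.one_le_dist_self v

theorem dist_trans {Γ : Ctx S.Ground} {A : Ty S.Ground} (x y z : Q T Γ A) :
    dist x y * dist y z ≤ dist x z := by
  induction x using ind with | h v =>
  induction y using ind with | h w =>
  induction z using ind with | h u => exact VTheory.dist_trans v w u

theorem dist_sep {Γ : Ctx S.Ground} {A : Ty S.Ground} (x y : Q T Γ A) (h : 1 ≤ dist x y)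
    (h' : 1 ≤ dist y x) : x = y := by
  induction x using ind with | h v =>
  induction y using ind with | h w => exact sound ⟨h, h'⟩

theorem dist_ap {A C : Ty S.Ground} {Γ : Ctx S.Ground} (f g : Q T [A] C) (x y : Q T Γ A) :
    dist f g * dist x y ≤ dist (f.ap x) (g.ap y) := by
  induction x using ind with | h v =>
  induction y using ind with | h w =>
  induction f using ind with | h f =>
  induction g using ind with | h g => exact VTheory.dist_inst _ f g v w

theorem dist_tHom {A A' C C' : Ty S.Ground} (f g : Q T [A] A') (f' g' : Q T [C] C') :
    dist f g * dist f' g' ≤ dist (tHom f f') (tHom g g') := by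
  induction f using ind with | h f =>
  induction g using ind with | h g =>
  induction f' using ind with | h f' =>
  induction g' using ind with | h g' =>
    refine (VTheory.dist_pair (.two _ _) f g f' g').trans ?_
    refine le_trans ?_ (VTheory.dist_pm (.left .nil) .hyp .hyp _ _)
    refine le_trans (le_of_eq (one_mul _).symm) ?_
    exact VTheory.mul_le_mul_of_quantale (VTheory.one_le_dist_self _) le_rfl

theorem dist_cur {A C D : Ty S.Ground} (f g : Q T [.tensor A C] D) :
    dist f g ≤ dist (cur f) (cur g) := by
  induction f using ind with | h f =>
  induction g using ind with | h g =>
    refine le_trans ?_ (VTheory.dist_lam _ _)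
    refine le_trans ?_ (VTheory.dist_inst _ f g _ _)
    refine le_trans (le_of_eq (mul_one _).symm) ?_
    exact VTheory.mul_le_mul_of_quantale le_rfl (VTheory.one_le_dist_self _)

theorem dist_unc {A C D : Ty S.Ground} (f g : Q T [C] (.lolli A D)) :
    dist f g ≤ dist (unc f) (unc g) := by
  induction f using ind with | h f =>
  induction g using ind with | h g =>
    refine le_trans ?_ (VTheory.dist_pm _ .hyp .hyp _ _)
    refine le_trans ?_ (VTheory.mul_le_mul_of_quantale (VTheory.one_le_dist_self _)
      (VTheory.dist_app _ f g .hyp .hyp))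
    rw [one_mul]
    refine le_trans (le_of_eq (mul_one _).symm) ?_
    exact VTheory.mul_le_mul_of_quantale le_rfl (VTheory.one_le_dist_self _)

end Q

namespace Syn

/-- Currying `λ x. f[x ⊗ y]` as a bijection. -/
def curEquiv (A C D : Syn T) : (A ⊗ C ⟶ D) ≃ (C ⟶ (Ty.lolli A D : Syn T)) :=
  ⟨Q.cur (A := A) (C := C) (D := D), Q.unc, Q.unc_cur, Q.cur_unc⟩

instance : MonoidalClosed (Syn T) where
  closed A :=
    { rightAdj := Adjunction.rightAdjointOfEquiv (F := tensorLeft A) (curEquiv A)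
        fun _ _ _ f g => Q.cur_nat g f
      adj := Adjunction.adjunctionOfEquivRight (F := tensorLeft A) (curEquiv A)
        fun _ _ _ f g => Q.cur_nat g f }

end Syn

end Closed

/-! ### `V`-categories and enriched autonomous categories -/

section Enriched

/-- A `V`-category with the underlying set `X`. -/
structure VCat (V : Type uV) [CommMonoid V] [CompleteLattice V] (X : Type uC) where
  a : X → X → V
  one_le : ∀ x, 1 ≤ a x x
  trans : ∀ x y z, a x y * a y z ≤ a x z

variable {V : Type uV} [CommMonoid V] [CompleteLattice V]

/-- Separated `V`-categories. -/
def VCat.IsSeparated {X : Type uC} (M : VCat V X) : Prop :=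
  ∀ x y, 1 ≤ M.a x y → 1 ≤ M.a y x → x = y

/-- `V`-functors. -/
def VCat.IsVFunctor {X : Type uC} {Y : Type uD} (M : VCat V X) (N : VCat V Y) (f : X → Y) : Prop :=
  ∀ x y, M.a x y ≤ N.a (f x) (f y)

/-- The tensor product of two `V`-categories. -/
def VCat.tensor [IsQuantale V] {X : Type uC} {Y : Type uD} (M : VCat V X) (N : VCat V Y) :
    VCat V (X × Y) where
  a x y := M.a x.1 y.1 * N.a x.2 y.2
  one_le x := VTheory.one_le_mul_of_quantale (M.one_le _) (N.one_le _)
  trans x y z := by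
    rw [mul_mul_mul_comm]
    exact VTheory.mul_le_mul_of_quantale (M.trans _ _ _) (N.trans _ _ _)

section Transpose

variable {C : Type uC} [Category.{vC} C] [MonoidalCategory C] [SymmetricCategory C]
  [MonoidalClosed C]

/-- The internal hom `X ⊸ Y`. -/
abbrev lolli (X Y : C) : C := (ihom X).obj Y

/-- The right transpose `Z ⟶ (X ⊸ Y)` of `f : Z ⊗ X ⟶ Y`. (In Mathlib `X ⊸ -` is the right adjoint
of `X ⊗ -`.) -/
def transpose {X Y Z : C} (f : Z ⊗ X ⟶ Y) : Z ⟶ lolli X Y :=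
  MonoidalClosed.curry ((β_ X Z).hom ≫ f)

/-- The application morphism `(X ⊸ Y) ⊗ X ⟶ Y`. -/
def appHom (X Y : C) : lolli X Y ⊗ X ⟶ Y := (β_ (lolli X Y) X).hom ≫ (ihom.ev X).app Y

/-- `(- · f)`. -/
def preHom {X X' : C} (Y : C) (f : X' ⟶ X) : lolli X Y ⟶ lolli X' Y :=
  transpose (lolli X Y ◁ f ≫ appHom X Y)

/-- `(g · -)`. -/
def postHom (X : C) {Y Y' : C} (g : Y ⟶ Y') : lolli X Y ⟶ lolli X Y' :=
  transpose (appHom X Y ≫ g)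

theorem preHom_eq {X X' : C} (Y : C) (f : X' ⟶ X) :
    preHom Y f = (MonoidalClosed.pre f).app Y := by
  apply MonoidalClosed.uncurry_injective
  simp [preHom, transpose, appHom, MonoidalClosed.uncurry_pre]

theorem postHom_eq (X : C) {Y Y' : C} (g : Y ⟶ Y') : postHom X g = (ihom X).map g := by
  apply MonoidalClosed.uncurry_injective
  simp [postHom, transpose, appHom, MonoidalClosed.uncurry_eq]

end Transpose

/-- A `V-Cat_sep`-enriched autonomous category (an autonomous category is a symmetric monoidal
closed category). -/
class VCatSepAutonomous (V : Type uV) [CommMonoid V] [CompleteLattice V] [IsQuantale V]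
    (C : Type uC) [Category.{vC} C] [MonoidalCategory C] [SymmetricCategory C]
    [MonoidalClosed C] where
  hom : ∀ X Y : C, VCat V (X ⟶ Y)
  sep : ∀ X Y : C, (hom X Y).IsSeparated
  comp : ∀ X Y Z : C, ((hom X Y).tensor (hom Y Z)).IsVFunctor (hom X Z) fun p => p.1 ≫ p.2
  tensor : ∀ X Y X' Y' : C, ((hom X Y).tensor (hom X' Y')).IsVFunctor (hom (X ⊗ X') (Y ⊗ Y'))
    fun p => p.1 ⊗ₘ p.2
  /-- Transposition is a `V`-isomorphism. -/
  adj : ∀ (X Y Z : C) (f g : Z ⊗ X ⟶ Y),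
    (hom Z (lolli X Y)).a (transpose f) (transpose g) = (hom (Z ⊗ X) Y).a f g

/-- `a(f, g)`. -/
def homDist (V : Type uV) [CommMonoid V] [CompleteLattice V] [IsQuantale V]
    {C : Type uC} [Category.{vC} C] [MonoidalCategory C] [SymmetricCategory C]
    [MonoidalClosed C] [VCatSepAutonomous V C] {X Y : C} (f g : X ⟶ Y) : V :=
  (VCatSepAutonomous.hom X Y).a f g

theorem Syn.curry_eq [IsQuantale V] {S : Signature.{uG, uO}} {B : LabelBasis V} {T : VTheory S B}
    {X Y Z : Syn T} (f : X ⊗ Z ⟶ Y) : MonoidalClosed.curry f = Q.cur f := by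
  exact DFunLike.congr_fun (congrFun (congrFun
    (Adjunction.mkOfHomEquiv_homEquiv (F := tensorLeft X) _) Z) Y) f

instance [IsQuantale V] {S : Signature.{uG, uO}} {B : LabelBasis V} (T : VTheory S B) :
    VCatSepAutonomous V (Syn T) where
  hom _ _ := ⟨Q.dist, Q.one_le_dist, Q.dist_trans⟩
  sep _ _ := Q.dist_sep
  comp _ _ _ x y := (mul_comm _ _).trans_le (Q.dist_ap x.2 y.2 x.1 y.1)
  tensor _ _ _ _ x y := Q.dist_tHom x.1 y.1 x.2 y.2
  adj X Y Z f g := by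
    have key : ∀ {A C D : Ty S.Ground} (b : Q T [A] C) (f g : Q T [C] D),
        Q.dist f g ≤ Q.dist (f.ap b) (g.ap b) := fun b f g => by
      refine le_trans ?_ (Q.dist_ap f g b b)
      exact (mul_one _).symm.trans_le (VTheory.mul_le_mul_of_quantale le_rfl (Q.one_le_dist b))
    have inv : ∀ h : Z ⊗ X ⟶ Y,
        h = Q.ap (Q.ap h (Q.mk T (.bHom X Z))) (Q.mk T (.bHom Z X)) := fun h =>
      ((Q.ap_ap h _ _).trans ((congrArg (Q.ap h) Q.bHom_bHom).trans (Q.ap_hyp h))).symm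
    have tr : ∀ h : Z ⊗ X ⟶ Y, transpose h = Q.cur (Q.ap h (Q.mk T (.bHom X Z))) := fun h =>
      Syn.curry_eq _
    rw [tr, tr]
    refine le_antisymm ?_ ((key (Q.mk T (.bHom X Z)) f g).trans (Q.dist_cur _ _))
    refine (Q.dist_unc _ _).trans ?_
    refine (le_of_eq (congrArg₂ Q.dist (Q.unc_cur _) (Q.unc_cur _))).trans ?_
    refine (key (Q.mk T (.bHom Z X)) _ _).trans (le_of_eq ?_)
    exact (congrArg₂ Q.dist (inv f) (inv g)).symm

end Enriched

/-! ### Enriched autonomous functors -/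

section Functors

variable {C : Type uC} [Category.{vC} C] [MonoidalCategory C] [SymmetricCategory C]
  [MonoidalClosed C] {D : Type uD} [Category.{vD} D] [MonoidalCategory D] [SymmetricCategory D]
  [MonoidalClosed D]

/-- The right transpose `F(X ⊸ Y) ⟶ (F X ⊸ F Y)` of `F(app) · μ`. -/
def homComparison (F : C ⥤ D) [F.Monoidal] (X Y : C) :
    F.obj (lolli X Y) ⟶ lolli (F.obj X) (F.obj Y) :=
  transpose (Functor.LaxMonoidal.μ F (lolli X Y) X ≫ F.map (appHom X Y))

/-- `V-Cat_sep`-autonomous functors: symmetric strong monoidal functors that preserve internal homs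
up to isomorphism and are `V`-functors on hom-sets. -/
structure VAutFunctor (V : Type uV) [CommMonoid V] [CompleteLattice V] [IsQuantale V]
    (C : Type uC) [Category.{vC} C] [MonoidalCategory C] [SymmetricCategory C]
    [MonoidalClosed C] [VCatSepAutonomous V C]
    (D : Type uD) [Category.{vD} D] [MonoidalCategory D] [SymmetricCategory D]
    [MonoidalClosed D] [VCatSepAutonomous V D] where
  functor : C ⥤ D
  [braided : functor.Braided]
  [isIso : ∀ X Y : C, IsIso (homComparison functor X Y)]
  enriched : ∀ X Y : C, (VCatSepAutonomous.hom (V := V) X Y).IsVFunctor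
    (VCatSepAutonomous.hom (functor.obj X) (functor.obj Y)) functor.map

attribute [instance] VAutFunctor.braided VAutFunctor.isIso

/-- A morphism is an identity. -/
def IsId {X Y : D} (f : X ⟶ Y) : Prop := ∃ h : X = Y, f = eqToHom h

/-- Strictness: all comparison morphisms are identities. -/
def VAutFunctor.IsStrict {V : Type uV} [CommMonoid V] [CompleteLattice V] [IsQuantale V]
    [VCatSepAutonomous V C] [VCatSepAutonomous V D] (F : VAutFunctor V C D) : Prop :=
  IsId (Functor.LaxMonoidal.ε F.functor) ∧
  (∀ X Y : C, IsId (Functor.LaxMonoidal.μ F.functor X Y)) ∧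
  ∀ X Y : C, IsId (homComparison F.functor X Y)

end Functors

/-! ### Interpretations and models -/

section Interpretations

variable {C : Type uC} [Category.{vC} C] [MonoidalCategory C] [SymmetricCategory C]
  [MonoidalClosed C]

/-- The interpretation of types that extends an interpretation of the ground types. -/
def tyOf {G : Type uG} (g : G → C) : Ty G → C
  | .ground X => g X
  | .unit => 𝟙_ C
  | .tensor A B => tyOf g A ⊗ tyOf g B
  | .lolli A B => lolli (tyOf g A) (tyOf g B)

/-- The interpretation of contexts, `⟦A₁⟧ ⊗ ⋯ ⊗ ⟦Aₙ⟧`. -/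
abbrev ctxOf {G : Type uG} (g : G → C) (Γ : Ctx G) : C := tyOf g (tens Γ)

/-- `⟦Γ⟧ ⊗ ⟦A⟧ ≅ ⟦Γ, x : A⟧`. -/
def join {G : Type uG} (g : G → C) : (Γ : Ctx G) → (A : Ty G) →
    (ctxOf g Γ ⊗ tyOf g A ≅ ctxOf g (A :: Γ))
  | [], A => λ_ (tyOf g A)
  | _ :: _, _ => Iso.refl _

/-- The morphism `⟦E⟧ ⟶ ⟦Γ⟧ ⊗ ⟦Δ⟧` that permutes the variables of a shuffle `E` of `Γ` and `Δ` back
to `Γ, Δ`, and then splits. -/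
def splitHom {G : Type uG} (g : G → C) : {Γ Δ E : Ctx G} → Sf Γ Δ E →
    (ctxOf g E ⟶ ctxOf g Γ ⊗ ctxOf g Δ)
  | _, _, _, .nil => (λ_ (𝟙_ C)).inv
  | _, _, _, .left (A := A) (Γ := Γ) (Δ := Δ) (E := E) s =>
      (join g E A).inv ≫ splitHom g s ▷ tyOf g A ≫ (α_ _ _ _).hom ≫
        ctxOf g Γ ◁ (β_ (ctxOf g Δ) (tyOf g A)).hom ≫ (α_ _ _ _).inv ≫
          (join g Γ A).hom ▷ ctxOf g Δ
  | _, _, _, .right (A := A) (Γ := Γ) (Δ := Δ) (E := E) s =>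
      (join g E A).inv ≫ splitHom g s ▷ tyOf g A ≫ (α_ _ _ _).hom ≫
        ctxOf g Γ ◁ (join g Δ A).hom

/-- Interpretations of a signature: an object for each ground type, and a morphism
`⟦A₁⟧ ⊗ ⋯ ⊗ ⟦Aₙ⟧ ⟶ ⟦A⟧` for each operation symbol. -/
structure Interp (S : Signature.{uG, uO}) (C : Type uC) [Category.{vC} C] [MonoidalCategory C]
    [SymmetricCategory C] [MonoidalClosed C] where
  ground : S.Ground → C
  op : ∀ f : S.Op, ctxOf ground (S.dom f) ⟶ tyOf ground (S.cod f)

namespace Interp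

variable {S : Signature.{uG, uO}} (M : Interp S C)

/-- `⟦A⟧` -/
abbrev ty (A : Ty S.Ground) : C := tyOf M.ground A

/-- `⟦Γ⟧` -/
abbrev ctx (Γ : Ctx S.Ground) : C := ctxOf M.ground Γ

/-- The object in which a term, or a tuple of terms, takes its values. -/
def goal : Goal S.Ground → C
  | .one A => M.ty A
  | .many As => M.ctx As

/-- The interpretation of derivations. -/
def interp : {Γ : Ctx S.Ground} → {g : Goal S.Ground} → Der S Γ g → (M.ctx Γ ⟶ M.goal g)
  | _, _, .op f vs => interp vs ≫ M.op f
  | _, _, .hyp => 𝟙 _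
  | _, _, .star => 𝟙 _
  | _, _, .pm (Δ := Δ) (A := A) (B := B) s v w =>
      splitHom M.ground s ≫ interp v ▷ M.ctx Δ ≫ (β_ (M.ty A ⊗ M.ty B) (M.ctx Δ)).hom ≫
        (α_ (M.ctx Δ) (M.ty A) (M.ty B)).inv ≫ (join M.ground Δ A).hom ▷ M.ty B ≫
          (join M.ground (A :: Δ) B).hom ≫ interp w
  | _, _, .pair s v w => splitHom M.ground s ≫ (interp v ⊗ₘ interp w)
  | _, _, .seq (Δ := Δ) s v w =>
      splitHom M.ground s ≫ interp v ▷ M.ctx Δ ≫ (λ_ (M.ctx Δ)).hom ≫ interp w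
  | _, _, .lam (Γ := Γ) (A := A) v => transpose ((join M.ground Γ A).hom ≫ interp v)
  | _, _, .app (A := A) (B := B) s v w =>
      splitHom M.ground s ≫ (interp v ⊗ₘ interp w) ≫ appHom (M.ty A) (M.ty B)
  | _, _, .nil => 𝟙 _
  | _, _, .snoc (As := As) (A := A) s vs v =>
      splitHom M.ground s ≫ (interp vs ⊗ₘ interp v) ≫ (join M.ground As A).hom

/-- The interpretation of terms in context. -/
def tm {Γ : Ctx S.Ground} {A : Ty S.Ground} (v : Tm S Γ A) : M.ctx Γ ⟶ M.ty A := M.interp v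

end Interp

variable {V : Type uV} [CommMonoid V] [CompleteLattice V] [IsQuantale V] {S : Signature.{uG, uO}}
  {B : LabelBasis V}

/-- An interpretation is a model of a theory if it satisfies the axioms. -/
def VTheory.IsModel (T : VTheory S B) [VCatSepAutonomous V C] (M : Interp S C) : Prop :=
  ∀ (Γ : Ctx S.Ground) (A : Ty S.Ground) (q : V) (v w : Tm S Γ A), T.ax q v w →
    q ≤ homDist V (M.tm v) (M.tm w)

/-- Models of a theory. -/
structure Model (T : VTheory S B) (C : Type uC) [Category.{vC} C] [MonoidalCategory C]
    [SymmetricCategory C] [MonoidalClosed C] [VCatSepAutonomous V C] extends Interp S C where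
  isModel : T.IsModel toInterp

/-! ### Change of the interpretation domain along a functor -/

section Push

variable {D : Type uD} [Category.{vD} D] [MonoidalCategory D] [SymmetricCategory D]
  [MonoidalClosed D] (F : C ⥤ D) [F.Monoidal] [∀ X Y, IsIso (homComparison F X Y)]

/-- `(- · i⁻¹) · (j · -)` as an isomorphism of internal homs. -/
def lolliIso {X X' Y Y' : D} (i : X ≅ X') (j : Y ≅ Y') : lolli X Y ≅ lolli X' Y' where
  hom := postHom X j.hom ≫ preHom Y' i.inv
  inv := postHom X' j.inv ≫ preHom Y i.hom
  hom_inv_id := by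
    simp only [preHom_eq, postHom_eq, Category.assoc, NatTrans.naturality_assoc]
    rw [← Functor.map_comp_assoc, j.hom_inv_id, CategoryTheory.Functor.map_id, Category.id_comp,
      ← NatTrans.comp_app, ← MonoidalClosed.pre_map, i.hom_inv_id, MonoidalClosed.pre_id]
    rfl
  inv_hom_id := by
    simp only [preHom_eq, postHom_eq, Category.assoc, NatTrans.naturality_assoc]
    rw [← Functor.map_comp_assoc, j.inv_hom_id, CategoryTheory.Functor.map_id, Category.id_comp,
      ← NatTrans.comp_app, ← MonoidalClosed.pre_map, i.inv_hom_id, MonoidalClosed.pre_id]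
    rfl

/-- The isomorphism `h_A : ⟦A⟧_{F_* M} ≅ F ⟦A⟧_M`. -/
noncomputable def hIso {G : Type uG} (g : G → C) :
    (A : Ty G) → (tyOf (fun X => F.obj (g X)) A ≅ F.obj (tyOf g A))
  | .ground X => Iso.refl (F.obj (g X))
  | .unit => Functor.Monoidal.εIso F
  | .tensor A B => (hIso g A ⊗ᵢ hIso g B) ≪≫ Functor.Monoidal.μIso F (tyOf g A) (tyOf g B)
  | .lolli A B => lolliIso (hIso g A) (hIso g B) ≪≫
      (asIso (homComparison F (tyOf g A) (tyOf g B))).symm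

/-- The interpretation `F_* M`. -/
noncomputable def Interp.push (M : Interp S C) : Interp S D where
  ground X := F.obj (M.ground X)
  op f := (hIso F M.ground (tens (S.dom f))).hom ≫ F.map (M.op f) ≫
    (hIso F M.ground (S.cod f)).inv

end Push

end Interpretations

/-! ### The syntactic category as an interpretation -/

section SynInterp

namespace Sf

/-- The shuffle `Γ, x : A, Δ` of `Γ, Δ` and `x : A` (contexts being read from right to left). -/
def mid {G : Type uG} (A : Ty G) : (Γ Δ : Ctx G) → Sf (Γ ++ Δ) [A] (Γ ++ A :: Δ)
  | [], Δ => .right (.nilR Δ)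
  | _ :: Γ, Δ => .left (mid A Γ Δ)

end Sf

namespace Der

variable {S : Signature.{uG, uO}}

/-- `pm x to x₁ ⊗ ⋯ ⊗ xₙ. t`, where `x₁ : A₁, …, xₙ : Aₙ` is the context `Γ`. It stands for
`pm x to y ⊗ xₙ. pm y to ⋯. t`; if `n = 1` it is `t`. The variables of `Δ` are untouched. -/
def unpack {C : Ty S.Ground} : (Γ Δ : Ctx S.Ground) → Tm S (Γ ++ Δ) C → Tm S (tens Γ :: Δ) C
  | [], Δ, t => .seq (.left (.nilL Δ)) .hyp t
  | [_], _, t => t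
  | A :: B :: Γ, Δ, t =>
      .pm (.left (.nilL Δ)) .hyp
        (inst (.left (.right (.nilR Δ)))
          (unpack (B :: Γ) (A :: Δ) (inst (Sf.mid A (B :: Γ) Δ) t .hyp)) .hyp)

/-- The variables `x₁, …, xₙ` of a context. -/
def vars : (Γ : Ctx S.Ground) → Tup S (Γ ++ []) Γ
  | [] => .nil
  | A :: Γ => lift A (vars Γ)

end Der

variable {V : Type uV} [CommMonoid V] [CompleteLattice V] [IsQuantale V] {S : Signature.{uG, uO}}
  {B : LabelBasis V} (T : VTheory S B)

theorem tyOf_syn (A : Ty S.Ground) : tyOf (C := Syn T) Ty.ground A = A := by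
  induction A with
  | ground X => rfl
  | unit => rfl
  | tensor A B ihA ihB => exact congrArg₂ Ty.tensor ihA ihB
  | lolli A B ihA ihB => exact congrArg₂ Ty.lolli ihA ihB

/-- The class `[v]` of `x : A ▷ v : B` as a morphism of the syntactic category. -/
def Syn.cls {A C : Ty S.Ground} (v : Tm S [A] C) : (show Syn T from A) ⟶ (show Syn T from C) :=
  Q.mk T v

/-- The interpretation in the syntactic category: `X` is interpreted by `X`, and `f` by the class of
`pm x to x₁ ⊗ ⋯ ⊗ xₙ. f(x₁, …, xₙ)`. -/
def synInterp : Interp S (Syn T) where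
  ground := Ty.ground
  op f := eqToHom (tyOf_syn T _) ≫
    Syn.cls T (Der.unpack (S.dom f) [] (.op f (Der.vars (S.dom f)))) ≫
      eqToHom (tyOf_syn T _).symm

/-- The functor `F` is `[v] ↦ ⟦v⟧_M`. -/
def IsInducedBy {C : Type uC} [Category.{vC} C] [MonoidalCategory C] [SymmetricCategory C]
    [MonoidalClosed C] (F : Syn T ⥤ C) (M : Interp S C) : Prop :=
  ∃ h : ∀ A : Ty S.Ground, F.obj A = M.ty A, ∀ (A C : Ty S.Ground) (v : Tm S [A] C),
    F.map (Syn.cls T v) = eqToHom (h A) ≫ M.tm v ≫ eqToHom (h C).symm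

end SynInterp

end VLam

/-! The proof combines soundness, transport along functors and a computation of denotations inside
the syntactic category.

Soundness. Shuffles of contexts denote coherence isomorphisms that are compatible with swapping and
regrouping (`splitHom_swap`, `splitHom_assoc`). They are natural in substitutions (`tup_split`), so
substitution is denoted by composition (`interp_sub`). Hence the equations of the calculus hold in
every autonomous category (`tm_eq_of_lamEq`). The labelled rules hold because composition and tensor
are `V`-functors and transposition is an isometry; integrality gives the label `⊤` of the equations
and of reflexivity, and the basis property gives the rule with premises `r ≪ q`. Thus `dist v w` is
at most the distance of the denotations (`le_homDist_of_thm`). By separatedness of `C`, `[v] ↦ ⟦v⟧`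
is well defined. It is strict because the terms defining the monoidal and closed structure of the
syntactic category denote the corresponding structure of `C`.

Transport. All the operations by which denotations are built are preserved by an autonomous functor
up to the isomorphisms `h_A`. By pasting squares, `⟦v⟧` in `F_* M` is `F ⟦v⟧` conjugated by `h`
(`mapSq_interp`).

Denotations in the syntactic category. Its morphisms act on classes of terms in any context
(generalized elements), and the denotation of a term, applied to a tuple, gives the class of the
substituted term (`act_interp`). So a one-variable term denotes its own class. For several
variables, abstraction reduces distances to the empty context (`dist_act_gten`), so an axiom
labelled `q` is satisfied in the syntactic category up to `q`. Transport along `F` then shows that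
`F_* Syn(T)` is a model.

The two round trips. The transport square for a one-variable term is a naturality square from `⟦v⟧`
in `F_* Syn(T)` to `F [v]`; its vertical sides are built from `ε` and `μ`, so the natural
isomorphism is monoidal. If `F` is induced by `M`, these sides are identities, and the square for
the term representing an operation symbol gives back the operation of `M` (`tm_unpack_op`,
`push_induced`). -/

namespace VLam

/-! ### Coherence of the shuffle morphisms. -/

section SplitHom

variable {C : Type uC} [Category.{vC} C] [MonoidalCategory C] [SymmetricCategory C]
  [MonoidalClosed C] {G : Type uG} (g : G → C)

theorem splitHom_left {A : Ty G} {Γ Δ E : Ctx G} (s : Sf Γ Δ E) :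
    splitHom g (.left (A := A) s) =
      (join g E A).inv ≫ splitHom g s ▷ tyOf g A ≫ (α_ _ _ _).hom ≫
        ctxOf g Γ ◁ (β_ (ctxOf g Δ) (tyOf g A)).hom ≫ (α_ _ _ _).inv ≫
          (join g Γ A).hom ▷ ctxOf g Δ := rfl

theorem splitHom_right {A : Ty G} {Γ Δ E : Ctx G} (s : Sf Γ Δ E) :
    splitHom g (.right (A := A) s) =
      (join g E A).inv ≫ splitHom g s ▷ tyOf g A ≫ (α_ _ _ _).hom ≫
        ctxOf g Γ ◁ (join g Δ A).hom := rfl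

/-- Each new variable is absorbed into the braiding of the two parts by a hexagon identity. In the
`left` case the variable crosses `Δ` twice, and symmetry cancels the two crossings. -/
theorem splitHom_swap {Γ Δ E : Ctx G} (s : Sf Γ Δ E) :
    splitHom g s.swap = splitHom g s ≫ (β_ _ _).hom := by
  induction s with
  | nil =>
    simp only [Sf.swap, splitHom, tens, ctxOf, tyOf, braiding_tensorUnit_left]
    simp
    exact unitors_inv_equal
  | left s ih =>
    simp only [Sf.swap, splitHom_left, splitHom_right, ih, Category.assoc,
      BraidedCategory.braiding_naturality_left, BraidedCategory.braiding_tensor_left_hom]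
    simp [-comp_whiskerRight, ← whiskerLeft_comp_assoc]
    simp
  | right s ih =>
    simp only [Sf.swap, splitHom_left, splitHom_right, ih, Category.assoc,
      BraidedCategory.braiding_naturality_right, BraidedCategory.braiding_tensor_right_hom]
    simp

/-- Both sides realize the same permutation of variables, so this is symmetric monoidal coherence.
Peeling off the last variable of `E` leaves one crossing to check: past `B` and `D` if it belongs to
`A`, past `D` if it belongs to `B`, none if it belongs to `D`. -/
theorem splitHom_assoc {A B D F E : Ctx G} (p : Sf A B F) (q : Sf F D E) :
    splitHom g q ≫ splitHom g p ▷ ctxOf g D ≫ (α_ _ _ _).hom =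
      splitHom g (Sf.assoc p q).outer ≫ ctxOf g A ◁ splitHom g (Sf.assoc p q).inner := by
  induction q generalizing A B with
  | nil => 
    cases p
    change (λ_ (𝟙_ C)).inv ≫ (λ_ (𝟙_ C)).inv ▷ 𝟙_ C ≫ (α_ (𝟙_ C) (𝟙_ C) (𝟙_ C)).hom =
      (λ_ (𝟙_ C)).inv ≫ 𝟙_ C ◁ (λ_ (𝟙_ C)).inv
    monoidal
  | @right X F D E q ih =>
    rw [Sf.assoc_right]
    simp only [Sf.Two.pushInner', splitHom_right]
    -- The induction hypothesis is tensored with the last variable and continued by the morphisms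
    -- that carry this variable to its place. The cases differ only in that continuation.
    have h := congrArg (fun f => (join g E X).inv ≫ f ▷ tyOf g X ≫ (α_ _ _ _).hom ≫
      ctxOf g A ◁ (α_ _ _ _).hom ≫ ctxOf g A ◁ ctxOf g B ◁ (join g D X).hom) (ih p)
    simpa [whisker_exchange_assoc] using h
  | @left X F D E q ih =>
    cases p with
    | @left _ A _ _ p =>
      have h := congrArg (fun f => (join g E X).inv ≫ f ▷ tyOf g X ≫ (α_ _ _ _).hom ≫
        ctxOf g A ◁ (β_ _ _).hom ≫ (α_ _ _ _).inv ≫ (join g A X).hom ▷ _) (ih p)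
      change splitHom g (.left q) ≫ splitHom g (.left p) ▷ ctxOf g D ≫ (α_ _ _ _).hom =
        splitHom g (.left (Sf.assoc p q).outer) ≫ _ ◁ splitHom g (Sf.assoc p q).inner
      simp only [splitHom_left]
      simp at h ⊢
      rw [← whisker_exchange, ← associator_inv_naturality_right_assoc, ← whiskerLeft_comp_assoc,
        ← BraidedCategory.braiding_naturality_left, whiskerLeft_comp_assoc,
        BraidedCategory.braiding_tensor_left_hom]
      rw [← associator_inv_naturality_left_assoc, whisker_exchange_assoc,
        ← associator_naturality_left_assoc]
      refine Eq.trans ?_ (h.trans ?_) <;> monoidal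
    | @right _ _ B _ p =>
      have h := congrArg (fun f => (join g E X).inv ≫ f ▷ tyOf g X ≫ (α_ _ _ _).hom ≫
        ctxOf g A ◁ ((α_ _ _ _).hom ≫ _ ◁ (β_ _ _).hom ≫ (α_ _ _ _).inv ≫ (join g B X).hom ▷ _))
          (ih p)
      change splitHom g (.left q) ≫ splitHom g (.right p) ▷ ctxOf g D ≫ (α_ _ _ _).hom =
        splitHom g (.right (Sf.assoc p q).outer) ≫ _ ◁ splitHom g (.left (Sf.assoc p q).inner)
      simp only [splitHom_left, splitHom_right]
      simp at h ⊢
      rw [← h, ← associator_inv_naturality_left_assoc, whisker_exchange_assoc,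
        ← associator_naturality_left_assoc]
      monoidal
end SplitHom

/-! ### Diagrams for splitting a tuple. -/

section Auxiliary

variable {C : Type uC} [Category.{vC} C] [MonoidalCategory C]

theorem leftUnitor_inv_whisker_join {X Y Z : C} (j : X ⊗ Y ≅ Z) :
    j.inv ≫ (λ_ X).inv ▷ Y ≫ (α_ (𝟙_ C) X Y).hom ≫ 𝟙_ C ◁ j.hom = (λ_ Z).inv := by
  rw [Iso.inv_comp_eq, leftUnitor_inv_naturality, leftUnitor_tensor_inv, Category.assoc]

/-- Inductive step of `tup_split` for a variable going to the right part: `h` is the induction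
hypothesis and `hA` the regrouping of shuffles. As in the later auxiliary lemmas, the objects are
arbitrary: interpretations of contexts are tensor products only after unfolding, which would
obstruct rewriting. -/
theorem tensor_join_split_right {E P Q F G D L R W A AF AD : C} {p : E ⟶ P ⊗ Q} {vs : P ⟶ F}
    {v : Q ⟶ A} {s : F ⟶ G ⊗ D} {t : P ⟶ L ⊗ R} {a : L ⟶ G} {b : R ⟶ D}
    (h : vs ≫ s = t ≫ (a ⊗ₘ b)) {o : E ⟶ L ⊗ W} {i : W ⟶ R ⊗ Q}
    (hA : p ≫ t ▷ Q ≫ (α_ _ _ _).hom = o ≫ L ◁ i) (j : F ⊗ A ≅ AF) (k : D ⊗ A ≅ AD) :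
    (p ≫ (vs ⊗ₘ v) ≫ j.hom) ≫ j.inv ≫ s ▷ A ≫ (α_ _ _ _).hom ≫ G ◁ k.hom =
      o ≫ (a ⊗ₘ (i ≫ (b ⊗ₘ v) ≫ k.hom)) := by
  calc _ = p ≫ ((vs ≫ s) ⊗ₘ v) ≫ (α_ _ _ _).hom ≫ G ◁ k.hom := by
        simp [MonoidalCategory.tensorHom_def, whisker_exchange_assoc]
    _ = (p ≫ t ▷ _ ≫ (α_ _ _ _).hom) ≫ (a ⊗ₘ (b ⊗ₘ v)) ≫ G ◁ k.hom := by
        rw [h]; simp [MonoidalCategory.tensorHom_def]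
    _ = _ := by
        rw [hA]
        simp only [MonoidalCategory.tensorHom_def, Category.assoc]
        rw [whisker_exchange_assoc]
        simp

theorem whisker_join_id {X Y A XA YA : C} (j : X ⊗ A ≅ XA) (k : Y ⊗ A ≅ YA) (f : X ⟶ Y) :
    (j.inv ≫ (ρ_ X).inv ▷ A ≫ (α_ _ _ _).hom ≫ X ◁ (λ_ A).hom) ≫ (f ⊗ₘ 𝟙 A) ≫ k.hom =
      j.inv ≫ f ▷ A ≫ k.hom := by simp

variable [SymmetricCategory C]

/-- The middle of three factors reaches the last place either by crossing the third, or by first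
going to the front and then crossing the other two. By symmetry the detour past the first factor
cancels. -/
theorem tensor_comp_mid_braiding {X X' Y Y' Z Z' : C} (a : X ⟶ X') (b : Y ⟶ Y') (c : Z ⟶ Z') :
    ((a ⊗ₘ b) ⊗ₘ c) ≫ (α_ X' Y' Z').hom ≫ X' ◁ (β_ Y' Z').hom ≫ (α_ X' Z' Y').inv =
      (β_ X Y).hom ▷ Z ≫ (α_ Y X Z).hom ≫ (β_ Y (X ⊗ Z)).hom ≫ ((a ⊗ₘ c) ⊗ₘ b) := by
  have h : (α_ X Y Z).hom ≫ X ◁ (β_ Y Z).hom ≫ (α_ X Z Y).inv =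
      (β_ X Y).hom ▷ Z ≫ (α_ Y X Z).hom ≫ (β_ Y (X ⊗ Z)).hom := by
    rw [BraidedCategory.braiding_tensor_right_hom, Iso.hom_inv_id_assoc, ← comp_whiskerRight_assoc,
      SymmetricCategory.symmetry]
    simp
  rw [associator_naturality_assoc, ← id_tensorHom, tensorHom_comp_tensorHom_assoc,
    BraidedCategory.braiding_naturality, Category.comp_id, ← Category.id_comp a,
    ← tensorHom_comp_tensorHom_assoc, associator_inv_naturality, id_tensorHom]
  simpa only [Category.assoc, Category.id_comp] using
    h =≫ ((a ⊗ₘ c) ⊗ₘ b)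

/-- Inductive step of `tup_split` for a variable going to the left part. The regrouping `Sf.assoc'`
first swaps the inner shuffle, which accounts for the braiding in `hA`. -/
theorem tensor_join_split_left {E P Q F G D L R W A AF AG : C} {p : E ⟶ P ⊗ Q} {vs : P ⟶ F}
    {v : Q ⟶ A} {s : F ⟶ G ⊗ D} {t : P ⟶ L ⊗ R} {a : L ⟶ G} {b : R ⟶ D}
    (h : vs ≫ s = t ≫ (a ⊗ₘ b)) {o : E ⟶ R ⊗ W} {i : W ⟶ L ⊗ Q}
    (hA : p ≫ (t ≫ (β_ L R).hom) ▷ Q ≫ (α_ _ _ _).hom = o ≫ R ◁ i)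
    (j : F ⊗ A ≅ AF) (k : G ⊗ A ≅ AG) :
    (p ≫ (vs ⊗ₘ v) ≫ j.hom) ≫ j.inv ≫ s ▷ A ≫ (α_ _ _ _).hom ≫ G ◁ (β_ _ _).hom ≫
        (α_ _ _ _).inv ≫ k.hom ▷ D =
      (o ≫ (β_ _ _).hom) ≫ ((i ≫ (a ⊗ₘ v) ≫ k.hom) ⊗ₘ b) := by
  calc _ = p ≫ ((vs ≫ s) ⊗ₘ v) ≫ (α_ _ _ _).hom ≫ G ◁ (β_ _ _).hom ≫
        (α_ _ _ _).inv ≫ k.hom ▷ D := by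
        simp [MonoidalCategory.tensorHom_def, whisker_exchange_assoc]
    _ = p ≫ t ▷ Q ≫ (((a ⊗ₘ b) ⊗ₘ v) ≫ (α_ _ _ _).hom ≫ G ◁ (β_ _ _).hom ≫ (α_ _ _ _).inv) ≫
        k.hom ▷ D := by
        rw [h]; simp [MonoidalCategory.tensorHom_def]
    _ = (p ≫ (t ≫ (β_ L R).hom) ▷ Q ≫ (α_ _ _ _).hom) ≫ (β_ _ _).hom ≫ ((a ⊗ₘ v) ⊗ₘ b) ≫
        k.hom ▷ D := by
        rw [tensor_comp_mid_braiding]; simp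
    _ = _ := by
        rw [hA, Category.assoc, BraidedCategory.braiding_naturality_right_assoc]
        simp only [MonoidalCategory.tensorHom_def, Category.assoc, comp_whiskerRight]
        rw [← whisker_exchange]

end Auxiliary

/-! ### Shuffles with an empty part or a single variable. -/

section SplitUnits

theorem Sf.eq_nilL {G : Type uG} {Γ : Ctx G} (s : Sf [] Γ Γ) : s = .nilL Γ := by
  induction Γ with
  | nil => cases s; rfl
  | cons A Γ ih => cases s with | right s => rw [ih s]; rfl

variable {C : Type uC} [Category.{vC} C] [MonoidalCategory C] [SymmetricCategory C]
  [MonoidalClosed C] {G : Type uG} (g : G → C)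

theorem splitHom_nilL (Γ : Ctx G) : splitHom g (.nilL Γ) = (λ_ (ctxOf g Γ)).inv := by
  induction Γ with
  | nil => rfl
  | cons A Γ ih =>
    rw [Sf.nilL, splitHom_right, ih]
    exact leftUnitor_inv_whisker_join (join g Γ A)

theorem splitHom_nilR (Γ : Ctx G) : splitHom g (.nilR Γ) = (ρ_ (ctxOf g Γ)).inv := by
  rw [← Sf.swap_nilL, splitHom_swap, splitHom_nilL]
  exact leftUnitor_inv_braiding _

theorem splitHom_right_nilR (Γ : Ctx G) (A : Ty G) :
    splitHom g (.right (A := A) (.nilR Γ)) = (join g Γ A).inv := by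
  rw [splitHom_right, splitHom_nilR]
  have aux : ∀ {X Y Z : C} (j : X ⊗ Y ≅ Z),
    j.inv ≫ (ρ_ X).inv ▷ Y ≫ (α_ _ _ _).hom ≫ X ◁ (λ_ Y).hom = j.inv := by simp
  exact aux _

theorem splitHom_left_nilL (Γ : Ctx G) (A : Ty G) :
    splitHom g (.left (A := A) (.nilL Γ)) = (join g Γ A).inv ≫ (β_ _ _).hom := by
  rw [show Sf.left (Sf.nilL Γ) = (Sf.right (A := A) (Sf.nilR Γ)).swap by
    rw [Sf.swap, Sf.swap_nilR], splitHom_swap, splitHom_right_nilR]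
  rfl

end SplitUnits

/-! ### Denotations of tuples. -/

namespace Interp

variable {C : Type uC} [Category.{vC} C] [MonoidalCategory C] [SymmetricCategory C]
  [MonoidalClosed C] {S : Signature.{uG, uO}} (M : Interp S C)

open Der

/-- The interpretation of tuples. -/
def tup {Γ Δ : Ctx S.Ground} (r : Tup S Γ Δ) : M.ctx Γ ⟶ M.ctx Δ := M.interp r

theorem tm_op {E : Ctx S.Ground} (f : S.Op) (vs : Tup S E (S.dom f)) :
    M.tm (.op f vs) = M.tup vs ≫ M.op f := rfl

theorem tm_hyp {A : Ty S.Ground} : M.tm (.hyp (A := A)) = 𝟙 (M.ty A) := rfl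

theorem tm_star : M.tm .star = 𝟙 (𝟙_ C) := rfl

theorem tm_pm {Γ Δ E : Ctx S.Ground} {A B K : Ty S.Ground} (s : Sf Γ Δ E)
    (v : Tm S Γ (.tensor A B)) (w : Tm S (B :: A :: Δ) K) :
    M.tm (.pm s v w) = splitHom M.ground s ≫ M.tm v ▷ M.ctx Δ ≫
      (β_ (M.ty A ⊗ M.ty B) (M.ctx Δ)).hom ≫ (α_ (M.ctx Δ) (M.ty A) (M.ty B)).inv ≫
        (join M.ground Δ A).hom ▷ M.ty B ≫ (join M.ground (A :: Δ) B).hom ≫ M.tm w := rfl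

theorem tm_pair {Γ Δ E : Ctx S.Ground} {A B : Ty S.Ground} (s : Sf Γ Δ E)
    (v : Tm S Γ A) (w : Tm S Δ B) :
    M.tm (.pair s v w) = splitHom M.ground s ≫ (M.tm v ⊗ₘ M.tm w) := rfl

theorem tm_seq {Γ Δ E : Ctx S.Ground} {A : Ty S.Ground} (s : Sf Γ Δ E)
    (v : Tm S Γ .unit) (w : Tm S Δ A) :
    M.tm (.seq s v w) = splitHom M.ground s ≫ M.tm v ▷ M.ctx Δ ≫ (λ_ (M.ctx Δ)).hom ≫ M.tm w := rfl

theorem tm_lam {Γ : Ctx S.Ground} {A B : Ty S.Ground} (v : Tm S (A :: Γ) B) :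
    M.tm (.lam v) = transpose ((join M.ground Γ A).hom ≫ M.tm v) := rfl

theorem tm_app {Γ Δ E : Ctx S.Ground} {A B : Ty S.Ground} (s : Sf Γ Δ E)
    (v : Tm S Γ (.lolli A B)) (w : Tm S Δ A) :
    M.tm (.app s v w) = splitHom M.ground s ≫ (M.tm v ⊗ₘ M.tm w) ≫ appHom (M.ty A) (M.ty B) := rfl

theorem tup_snoc {Γ Δ E As : Ctx S.Ground} {A : Ty S.Ground} (s : Sf Γ Δ E)
    (vs : Tup S Γ As) (v : Tm S Δ A) :
    M.tup (.snoc s vs v) =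
      splitHom M.ground s ≫ (M.tup vs ⊗ₘ M.tm v) ≫ (join M.ground As A).hom := rfl

/-- Naturality of the shuffle morphisms in substitutions. Together with `tup_lift` for binders it is
all that the substitution lemma needs to know about the combinatorics of contexts. -/
theorem tup_split {Γ Δ F E : Ctx S.Ground} (s : Sf Γ Δ F) (r : Tup S E F) :
    M.tup r ≫ splitHom M.ground s = splitHom M.ground (split s r).sf ≫
      (M.tup (split s r).tupL ⊗ₘ M.tup (split s r).tupR) := by
  induction s generalizing E with
  | nil =>
    cases r
    change 𝟙 (𝟙_ C) ≫ (λ_ (𝟙_ C)).inv = (λ_ (𝟙_ C)).inv ≫ (𝟙 (𝟙_ C) ⊗ₘ 𝟙 (𝟙_ C))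
    simp
  | @left A Γ Δ F s ih =>
    cases r with
    | @snoc Γ' Δ' _ _ _ p vs v =>
      have hA := splitHom_assoc M.ground (split s vs).sf.swap p
      rw [splitHom_swap] at hA
      rw [split]
      simp only [Split.pushL, Sf.assoc', splitHom_swap, tup_snoc, splitHom_left]
      exact tensor_join_split_left (ih vs) hA _ _
  | @right A Γ Δ F s ih =>
    cases r with
    | @snoc Γ' Δ' _ _ _ p vs v =>
      rw [split]
      simp only [Split.pushR, tup_snoc, splitHom_right]
      exact tensor_join_split_right (ih vs) (splitHom_assoc M.ground (split s vs).sf p) _ _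

theorem tup_lift {E Γ : Ctx S.Ground} (A : Ty S.Ground) (r : Tup S E Γ) :
    M.tup (lift A r) = (join M.ground E A).inv ≫ M.tup r ▷ M.ty A ≫ (join M.ground Γ A).hom := by
  rw [lift, tup_snoc, splitHom_right, splitHom_nilR, tm_hyp]
  exact whisker_join_id _ _ _

theorem tup_ids (Γ : Ctx S.Ground) : M.tup (ids Γ) = 𝟙 (M.ctx Γ) := by
  induction Γ with
  | nil => rfl
  | cons A Γ ih => rw [ids, tup_lift, ih]; simp

theorem tm_single {E : Ctx S.Ground} {A : Ty S.Ground} (r : Tup S E [A]) :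
    M.tm (single r) = M.tup r := by
  cases r with
  | snoc p vs v =>
    cases vs
    -- Once the two contexts are identified, the cast in `single` is trivial and `p` is the only
    -- shuffle with an empty left part.
    cases p.eq_of_nilL
    have : p = .nilL _ := p.eq_nilL
    subst this
    have h : M.tm v = (λ_ (M.ctx E)).inv ≫ (𝟙 (𝟙_ C) ⊗ₘ M.tm v) ≫ (λ_ (M.ty A)).hom := by simp
    rw [tup_snoc, splitHom_nilL]
    exact h

end Interp

/-! ### The universal property of the internal hom. -/

section Transposes

variable {C : Type uC} [Category.{vC} C] [MonoidalCategory C] [SymmetricCategory C]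
  [MonoidalClosed C]

theorem transpose_whisker_appHom {X Y Z : C} (f : Z ⊗ X ⟶ Y) :
    transpose f ▷ X ≫ appHom X Y = f := by
  rw [appHom, transpose, BraidedCategory.braiding_naturality_left_assoc,
    ← MonoidalClosed.uncurry_eq, MonoidalClosed.uncurry_curry, SymmetricCategory.symmetry_assoc]

theorem transpose_eta {X Y Z : C} (h : Z ⟶ lolli X Y) : transpose (h ▷ X ≫ appHom X Y) = h := by
  rw [appHom, transpose, BraidedCategory.braiding_naturality_left_assoc,
    SymmetricCategory.symmetry_assoc, ← MonoidalClosed.uncurry_eq, MonoidalClosed.curry_uncurry]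

theorem comp_transpose {X Y Z W : C} (h : W ⟶ Z) (f : Z ⊗ X ⟶ Y) :
    h ≫ transpose f = transpose (h ▷ X ≫ f) := by
  rw [← transpose_eta (h ≫ transpose f), comp_whiskerRight, Category.assoc,
    transpose_whisker_appHom]

theorem lolli_hom_ext {X Y Z : C} {f g : Z ⟶ lolli X Y}
    (h : f ▷ X ≫ appHom X Y = g ▷ X ≫ appHom X Y) : f = g := by
  rw [← transpose_eta f, h, transpose_eta]

theorem transpose_appHom (X Y : C) : transpose (appHom X Y) = 𝟙 (lolli X Y) := by
  simpa using transpose_eta (𝟙 (lolli X Y))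

end Transposes

/-! ### Diagrams for the term formers and the conversions. -/

section Auxiliary

variable {C : Type uC} [Category.{vC} C] [MonoidalCategory C] [SymmetricCategory C]

theorem braiding_tensor_unassoc (X Y Z : C) :
    (β_ (X ⊗ Y) Z).hom ≫ (α_ Z X Y).inv =
      (β_ X Y).hom ▷ Z ≫ (α_ Y X Z).hom ≫ Y ◁ (β_ X Z).hom ≫ (β_ Y (Z ⊗ X)).hom := by
  have h := tensor_comp_mid_braiding (𝟙 X) (𝟙 Y) (𝟙 Z)
  simp only [id_tensorHom_id, Category.id_comp, Category.comp_id] at h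
  rw [BraidedCategory.braiding_naturality_right, ← reassoc_of% h]
  simp

/-- The substitution for the untouched variables moves through the braiding by naturality, and each
conjugation by `j` or `k`, coming from `tup_lift`, cancels against the adjacent join. The hypothesis
`h` is supplied by `tup_split`. -/
theorem sub_pm_aux {E F L R D X A B XA DA XB DB K : C} {r : E ⟶ F} {s : F ⟶ X ⊗ D}
    {t : E ⟶ L ⊗ R} {a : L ⟶ X} {b : R ⟶ D} (h : r ≫ s = t ≫ (a ⊗ₘ b)) (v : X ⟶ A ⊗ B)
    (j : R ⊗ A ≅ XA) (k : XA ⊗ B ≅ XB) (j' : D ⊗ A ≅ DA) (k' : DA ⊗ B ≅ DB) (w : DB ⟶ K) :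
    t ≫ (a ≫ v) ▷ R ≫ (β_ _ _).hom ≫ (α_ _ _ _).inv ≫ j.hom ▷ B ≫ k.hom ≫
        (k.inv ≫ (j.inv ≫ b ▷ A ≫ j'.hom) ▷ B ≫ k'.hom) ≫ w =
      r ≫ s ≫ v ▷ D ≫ (β_ _ _).hom ≫ (α_ _ _ _).inv ≫ j'.hom ▷ B ≫ k'.hom ≫ w := by
  rw [reassoc_of% h, MonoidalCategory.tensorHom_def]
  simp only [Category.assoc]
  rw [whisker_exchange_assoc, BraidedCategory.braiding_naturality_right_assoc]
  simp

theorem sub_seq_aux {E F L R D X K : C} {r : E ⟶ F} {s : F ⟶ X ⊗ D}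
    {t : E ⟶ L ⊗ R} {a : L ⟶ X} {b : R ⟶ D} (h : r ≫ s = t ≫ (a ⊗ₘ b)) (v : X ⟶ 𝟙_ C)
    (w : D ⟶ K) :
    t ≫ (a ≫ v) ▷ R ≫ (λ_ R).hom ≫ b ≫ w = r ≫ s ≫ v ▷ D ≫ (λ_ D).hom ≫ w := by
  rw [reassoc_of% h, MonoidalCategory.tensorHom_def]
  simp only [Category.assoc]
  rw [whisker_exchange_assoc]
  simp

theorem sub_tensor_aux {E F L R D X Y Z K : C} {r : E ⟶ F} {s : F ⟶ X ⊗ D}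
    {t : E ⟶ L ⊗ R} {a : L ⟶ X} {b : R ⟶ D} (h : r ≫ s = t ≫ (a ⊗ₘ b)) (v : X ⟶ Y)
    (w : D ⟶ Z) (k : Y ⊗ Z ⟶ K) :
    t ≫ ((a ≫ v) ⊗ₘ (b ≫ w)) ≫ k = r ≫ s ≫ (v ⊗ₘ w) ≫ k := by
  rw [reassoc_of% h, tensorHom_comp_tensorHom_assoc]

/-- Simultaneous substitution by `inst₂` regroups the context as `Y, (X, T)`, whence the shape of
`h`. `braiding_tensor_unassoc` brings the braiding in the denotation of `pm` into the same form. -/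
theorem pm_beta_aux {E F T W X Y A B TA TB K : C} {p : E ⟶ F ⊗ T} {s : F ⟶ X ⊗ Y}
    {o : E ⟶ Y ⊗ W} {i : W ⟶ X ⊗ T}
    (h : p ≫ (s ≫ (β_ X Y).hom) ▷ T ≫ (α_ _ _ _).hom = o ≫ Y ◁ i) (v : X ⟶ A) (w : Y ⟶ B)
    (j : T ⊗ A ⟶ TA) (k : TA ⊗ B ⟶ TB) (u : TB ⟶ K) :
    p ≫ (s ≫ (v ⊗ₘ w)) ▷ T ≫ (β_ _ _).hom ≫ (α_ _ _ _).inv ≫ j ▷ B ≫ k ≫ u =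
      ((o ≫ (β_ _ _).hom) ≫ (((i ≫ (β_ _ _).hom) ≫ (𝟙 T ⊗ₘ v) ≫ j) ⊗ₘ w) ≫ k) ≫ u := by
  calc _ = p ≫ s ▷ T ≫ ((β_ (X ⊗ Y) T).hom ≫ (α_ _ _ _).inv) ≫ ((T ◁ v ≫ j) ⊗ₘ w) ≫ k ≫ u := by
        rw [comp_whiskerRight_assoc, BraidedCategory.braiding_naturality_left_assoc]
        simp only [MonoidalCategory.tensorHom_def, whiskerLeft_comp, Category.assoc,
          comp_whiskerRight]
        rw [← associator_inv_naturality_middle_assoc, associator_inv_naturality_right_assoc,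
          whisker_exchange_assoc]
    _ = (p ≫ (s ≫ (β_ X Y).hom) ▷ T ≫ (α_ _ _ _).hom) ≫ Y ◁ (β_ _ _).hom ≫ (β_ _ _).hom ≫
          ((T ◁ v ≫ j) ⊗ₘ w) ≫ k ≫ u := by rw [braiding_tensor_unassoc]; simp
    _ = _ := by
        rw [h]
        simp only [id_tensorHom]
        simp only [Category.assoc, MonoidalCategory.tensorHom_def, comp_whiskerRight,
          ← BraidedCategory.braiding_naturality_right_assoc]

theorem pm_eta_aux {E X T A B TA TB TAB K : C} (s : E ⟶ X ⊗ T) (v : X ⟶ A ⊗ B)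
    (j : T ⊗ A ≅ TA) (k : TA ⊗ B ≅ TB) (l : T ⊗ (A ⊗ B) ⟶ TAB) (u : TAB ⟶ K) :
    s ≫ v ▷ T ≫ (β_ _ _).hom ≫ (α_ _ _ _).inv ≫ j.hom ▷ B ≫ k.hom ≫
        ((k.inv ≫ (j.inv ≫ (ρ_ T).inv ▷ A ≫ (α_ _ _ _).hom ≫ T ◁ (λ_ A).hom) ▷ B ≫
          (α_ _ _ _).hom ≫ T ◁ 𝟙 _) ≫ (𝟙 T ⊗ₘ 𝟙 (A ⊗ B)) ≫ l) ≫ u =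
      ((s ≫ (β_ _ _).hom) ≫ (𝟙 T ⊗ₘ v) ≫ l) ≫ u := by
  simp [-BraidedCategory.braiding_tensor_left_hom, ← BraidedCategory.braiding_naturality_left_assoc]

theorem seq_eta_aux {E X T TI K : C} (s : E ⟶ X ⊗ T) (v : X ⟶ 𝟙_ C) (l : T ⊗ 𝟙_ C ⟶ TI)
    (u : TI ⟶ K) :
    s ≫ v ▷ T ≫ (λ_ _).hom ≫ ((ρ_ T).inv ≫ (𝟙 T ⊗ₘ 𝟙 _) ≫ l) ≫ u =
      ((s ≫ (β_ _ _).hom) ≫ (𝟙 T ⊗ₘ v) ≫ l) ≫ u := by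
  simp [-BraidedCategory.braiding_tensor_left_hom, ← BraidedCategory.braiding_naturality_left_assoc]

theorem seq_conv_aux {E F T W X Y A TA K : C} {p : E ⟶ F ⊗ T} {s : F ⟶ X ⊗ Y}
    {o : E ⟶ X ⊗ W} {i : W ⟶ Y ⊗ T}
    (h : p ≫ s ▷ T ≫ (α_ _ _ _).hom = o ≫ X ◁ i) (v : X ⟶ 𝟙_ C) (w : Y ⟶ A)
    (j : T ⊗ A ⟶ TA) (u : TA ⟶ K) :
    ((p ≫ (β_ _ _).hom) ≫ (𝟙 T ⊗ₘ (s ≫ v ▷ Y ≫ (λ_ Y).hom ≫ w)) ≫ j) ≫ u =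
      o ≫ v ▷ W ≫ (λ_ W).hom ≫ ((i ≫ (β_ _ _).hom) ≫ (𝟙 T ⊗ₘ w) ≫ j) ≫ u := by
  calc _ = (p ≫ s ▷ T ≫ (α_ _ _ _).hom) ≫ v ▷ _ ≫ (λ_ _).hom ≫ w ▷ T ≫ (β_ _ _).hom ≫ j ≫ u := by
        simp [-BraidedCategory.braiding_tensor_left_hom,
          ← BraidedCategory.braiding_naturality_left_assoc]
    _ = _ := by
        rw [h, Category.assoc, whisker_exchange_assoc]
        simp [-BraidedCategory.braiding_tensor_left_hom]

theorem pm_conv_aux {E F T W X Y A B D YA YB WA WB TD K : C} {p : E ⟶ F ⊗ T} {s : F ⟶ X ⊗ Y}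
    {o : E ⟶ X ⊗ W} {i : W ⟶ Y ⊗ T}
    (h : p ≫ s ▷ T ≫ (α_ _ _ _).hom = o ≫ X ◁ i) (v : X ⟶ A ⊗ B) (j : Y ⊗ A ⟶ YA)
    (k : YA ⊗ B ⟶ YB) (w : YB ⟶ D) (j' : W ⊗ A ≅ WA) (k' : WA ⊗ B ≅ WB)
    (l : T ⊗ D ⟶ TD) (u : TD ⟶ K) :
    ((p ≫ (β_ _ _).hom) ≫ (𝟙 T ⊗ₘ (s ≫ v ▷ Y ≫ (β_ _ _).hom ≫ (α_ _ _ _).inv ≫ j ▷ B ≫ k ≫ w)) ≫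
        l) ≫ u =
      o ≫ v ▷ W ≫ (β_ _ _).hom ≫ (α_ _ _ _).inv ≫ j'.hom ▷ B ≫ k'.hom ≫
        ((k'.inv ≫ (j'.inv ≫ (i ≫ (β_ _ _).hom) ▷ A ≫ (α_ _ _ _).hom ≫ T ◁ j) ▷ B ≫
          (α_ _ _ _).hom ≫ T ◁ k) ≫ (𝟙 T ⊗ₘ w) ≫ l) ≫ u := by
  -- Both sides take `P, Y, T` to `T, Y, P`. On the left `P` crosses `Y` before the pair crosses
  -- `T`; on the right `P` crosses `Y` and `T` at once, and these two cross each other afterwards.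
  have key : ∀ P : C, (α_ P Y T).inv ≫ (β_ P Y).hom ▷ T ≫ (β_ (Y ⊗ P) T).hom =
      (β_ P (Y ⊗ T)).hom ≫ (β_ Y T).hom ▷ P ≫ (α_ T Y P).hom := fun P => by
    rw [BraidedCategory.braiding_tensor_right_hom, BraidedCategory.braiding_tensor_left_hom]
    simp
  calc _ = (p ≫ s ▷ T ≫ (α_ _ _ _).hom) ≫ v ▷ _ ≫ ((α_ _ _ _).inv ≫ (β_ (A ⊗ B) Y).hom ▷ T ≫
        (β_ _ _).hom) ≫ T ◁ ((α_ _ _ _).inv ≫ j ▷ B ≫ k ≫ w) ≫ l ≫ u := by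
        rw [id_tensorHom, Category.assoc, Category.assoc, Category.assoc,
          ← BraidedCategory.braiding_naturality_left_assoc]
        simp only [comp_whiskerRight, Category.assoc, whiskerLeft_comp,
          BraidedCategory.braiding_naturality_left_assoc]
        have hv : T ◁ v ▷ Y ≫ T ◁ (β_ (A ⊗ B) Y).hom = T ◁ (β_ X Y).hom ≫ T ◁ Y ◁ v := by
          rw [← whiskerLeft_comp, BraidedCategory.braiding_naturality_left, whiskerLeft_comp]
        simp [reassoc_of% hv, -BraidedCategory.braiding_tensor_left_hom,
          -BraidedCategory.braiding_tensor_right_hom]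
    _ = o ≫ v ▷ W ≫ (β_ _ _).hom ≫ i ▷ (A ⊗ B) ≫ (β_ Y T).hom ▷ (A ⊗ B) ≫ (α_ _ _ _).hom ≫
          T ◁ ((α_ _ _ _).inv ≫ j ▷ B ≫ k ≫ w) ≫ l ≫ u := by
        rw [h, Category.assoc, whisker_exchange_assoc, key,
          ← BraidedCategory.braiding_naturality_right_assoc (A ⊗ B) i]
        simp only [Category.assoc]
    _ = _ := by
        simp [-BraidedCategory.braiding_tensor_left_hom, -BraidedCategory.braiding_tensor_right_hom]

end Auxiliary

/-! ### The substitution lemma. -/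

namespace Interp

variable {C : Type uC} [Category.{vC} C] [MonoidalCategory C] [SymmetricCategory C]
  [MonoidalClosed C] {S : Signature.{uG, uO}} (M : Interp S C)

open Der

/-- Shared contexts are handled by `tup_split` and binders by `tup_lift`; what is left in each case
is naturality of the morphisms denoting the term former. Tuples are included because the arguments
of an operation symbol form one. -/
theorem interp_sub {Γ E : Ctx S.Ground} {k : Goal S.Ground} (v : Der S Γ k) (r : Tup S E Γ) :
    M.interp (v.sub r) = M.tup r ≫ M.interp v := by
  induction v generalizing E with
  | op f vs ih => exact (congrArg (· ≫ M.op f) (ih r)).trans (Category.assoc _ _ _)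
  | hyp => exact (M.tm_single r).trans (Category.comp_id _).symm
  | star => cases r; exact (Category.id_comp _).symm
  | pm s v w ihv ihw =>
    change M.tm (.pm _ _ _) = M.tup r ≫ M.tm (.pm _ _ _)
    rw [tm_pm, tm_pm,
      show M.tm (v.sub _) = _ from ihv _, show M.tm (w.sub _) = _ from ihw _, tup_lift, tup_lift]
    exact sub_pm_aux (M.tup_split s r) _ _ _ _ _ _
  | pair s v w ihv ihw =>
    change M.tm (.pair _ _ _) = M.tup r ≫ M.tm (.pair _ _ _)
    rw [tm_pair, tm_pair,
      show M.tm (v.sub _) = _ from ihv _, show M.tm (w.sub _) = _ from ihw _]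
    exact (congrArg _ (Category.comp_id _).symm).trans
      ((sub_tensor_aux (M.tup_split s r) (M.tm v) (M.tm w) (𝟙 _)).trans
        (congrArg (fun x => M.tup r ≫ splitHom M.ground s ≫ x) (Category.comp_id _)))
  | seq s v w ihv ihw =>
    change M.tm (.seq _ _ _) = M.tup r ≫ M.tm (.seq _ _ _)
    rw [tm_seq, tm_seq,
      show M.tm (v.sub _) = _ from ihv _, show M.tm (w.sub _) = _ from ihw _]
    exact sub_seq_aux (M.tup_split s r) _ _
  | @lam Γ A B v ih =>
    change M.tm (.lam _) = M.tup r ≫ M.tm (.lam _)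
    rw [tm_lam, tm_lam, show M.tm (v.sub _) = _ from ih _, tup_lift]
    refine Eq.trans ?_ (comp_transpose _ _).symm
    refine congrArg transpose ?_
    have aux : ∀ {X Y Z W K : C} (j : X ≅ Y) (x : X ⟶ Z) (k : Z ⟶ W) (v : W ⟶ K),
        j.hom ≫ (j.inv ≫ x ≫ k) ≫ v = x ≫ k ≫ v := by simp
    exact aux _ _ _ _
  | app s v w ihv ihw =>
    change M.tm (.app _ _ _) = M.tup r ≫ M.tm (.app _ _ _)
    rw [tm_app, tm_app,
      show M.tm (v.sub _) = _ from ihv _, show M.tm (w.sub _) = _ from ihw _]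
    exact sub_tensor_aux (M.tup_split s r) _ _ _
  | nil => cases r; exact (Category.id_comp _).symm
  | snoc s vs v ih ih' =>
    change M.tup (.snoc _ _ _) = M.tup r ≫ M.tup (.snoc _ _ _)
    rw [tup_snoc, tup_snoc,
      show M.tup (vs.sub _) = _ from ih _, show M.tm (v.sub _) = _ from ih' _]
    exact sub_tensor_aux (M.tup_split s r) _ _ _

end Interp

/-! ### Soundness of the equations. -/

namespace Interp

variable {C : Type uC} [Category.{vC} C] [MonoidalCategory C] [SymmetricCategory C]
  [MonoidalClosed C] {S : Signature.{uG, uO}} (M : Interp S C)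

open Der

theorem tm_sub {Γ E : Ctx S.Ground} {A : Ty S.Ground} (v : Tm S Γ A) (r : Tup S E Γ) :
    M.tm (v.sub r) = M.tup r ≫ M.tm v := M.interp_sub v r

theorem tm_inst {Γ Δ E : Ctx S.Ground} {A B : Ty S.Ground} (s : Sf Γ Δ E)
    (v : Tm S (A :: Γ) B) (w : Tm S Δ A) :
    M.tm (inst s v w) = (splitHom M.ground s ≫ (𝟙 (M.ctx Γ) ⊗ₘ M.tm w) ≫
      (join M.ground Γ A).hom) ≫ M.tm v := by
  rw [inst, tm_sub, tup_snoc, tup_ids]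

theorem tm_pair_two (A B : Ty S.Ground) :
    M.tm (.pair (.two A B) .hyp .hyp) = 𝟙 (M.ty A ⊗ M.ty B) := by
  rw [tm_pair, Sf.two, show Sf.left .nil = Sf.nilR [A] from rfl, splitHom_right_nilR]
  exact (Category.id_comp _).trans (id_tensorHom_id _ _)

/-- No enrichment is involved. The laws for `⊸` are the universal property of transposition; pattern
matching on `⊗` and `I` is denoted by coherence isomorphisms, so its laws and conversions follow
from naturality and `splitHom_assoc`. -/
theorem tm_eq_of_lamEq {Γ : Ctx S.Ground} {A : Ty S.Ground} {v w : Tm S Γ A} (h : LamEq v w) :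
    M.tm v = M.tm w := by
  induction h with
  | pm_beta s p v w u =>
    have h := splitHom_assoc M.ground s.swap p
    rw [splitHom_swap] at h
    rw [inst₂, tm_sub, tup_snoc, tup_snoc, tup_ids, tm_pm, tm_pair, splitHom_swap, splitHom_swap]
    exact pm_beta_aux h _ _ _ _ _
  | pm_eta s v u =>
    rw [tm_pm, tm_inst, tm_inst, splitHom_swap, tm_pair_two, splitHom_right, splitHom_right,
      splitHom_nilR]
    exact pm_eta_aux (C := C) _ _ _ _ _ _
  | seq_beta v =>
    rw [tm_seq, splitHom_nilL, tm_star]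
    have aux : ∀ {X Y : C} (v : X ⟶ Y), (λ_ X).inv ≫ 𝟙 _ ▷ X ≫ (λ_ X).hom ≫ v = v := by simp
    exact aux _
  | seq_eta s v w =>
    rw [tm_seq, tm_inst, tm_inst, splitHom_swap, tm_star, splitHom_nilR]
    exact seq_eta_aux _ _ _ _
  | lam_beta s v w =>
    rw [tm_app, tm_inst, tm_lam]
    have aux : ∀ {E X Y Z W K : C} (s : E ⟶ X ⊗ Y) (w : Y ⟶ Z) (j : X ⊗ Z ⟶ W) (v : W ⟶ K),
        s ≫ (transpose (j ≫ v) ⊗ₘ w) ≫ appHom Z K = (s ≫ (𝟙 X ⊗ₘ w) ≫ j) ≫ v := fun s w j v => by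
      rw [tensorHom_def', Category.assoc, transpose_whisker_appHom]
      simp
    exact aux _ _ _ _
  | lam_eta v =>
    rw [tm_lam, tm_app, tm_hyp, splitHom_right_nilR]
    refine Eq.trans (congrArg transpose ?_) (transpose_eta (M.tm v))
    have aux : ∀ {X Y Z W K : C} (j : X ⊗ Z ≅ W) (v : X ⟶ Y) (a : Y ⊗ Z ⟶ K),
      j.hom ≫ j.inv ≫ (v ⊗ₘ 𝟙 Z) ≫ a = v ▷ Z ≫ a := by simp
    exact aux _ _ _
  | seq_conv s p v w u =>
    rw [tm_seq, tm_inst, tm_inst, tm_seq, splitHom_swap, splitHom_swap]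
    exact seq_conv_aux (splitHom_assoc M.ground s p) _ _ _ _
  | pm_conv s p v w u =>
    rw [tm_pm, tm_inst, tm_inst, tm_pm, splitHom_swap, splitHom_right, splitHom_right,
      splitHom_swap]
    exact pm_conv_aux (splitHom_assoc M.ground s p) _ _ _ _ _ _ _ _

end Interp

/-! ### Quantitative soundness. -/

section Distance

variable {V : Type uV} [CommMonoid V] [CompleteLattice V] [IsQuantale V]
  {C : Type uC} [Category.{vC} C] [MonoidalCategory C] [SymmetricCategory C]
  [MonoidalClosed C] [VCatSepAutonomous V C]

open VTheory (mul_le_mul_of_quantale)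

theorem one_le_homDist {X Y : C} (f : X ⟶ Y) : 1 ≤ homDist V f f :=
  (VCatSepAutonomous.hom X Y).one_le f

theorem homDist_trans {X Y : C} (f g h : X ⟶ Y) :
    homDist V f g * homDist V g h ≤ homDist V f h :=
  (VCatSepAutonomous.hom X Y).trans f g h

theorem homDist_comp {X Y Z : C} (f f' : X ⟶ Y) (g g' : Y ⟶ Z) :
    homDist V f f' * homDist V g g' ≤ homDist V (f ≫ g) (f' ≫ g') :=
  VCatSepAutonomous.comp X Y Z (f, g) (f', g')

theorem homDist_tensor {X Y X' Y' : C} (f f' : X ⟶ Y) (g g' : X' ⟶ Y') :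
    homDist V f f' * homDist V g g' ≤ homDist V (f ⊗ₘ g) (f' ⊗ₘ g') :=
  VCatSepAutonomous.tensor X Y X' Y' (f, g) (f', g')

theorem homDist_transpose {X Y Z : C} (f g : Z ⊗ X ⟶ Y) :
    homDist V (transpose f) (transpose g) = homDist V f g :=
  VCatSepAutonomous.adj X Y Z f g

theorem homDist_comp_left {X Y Z : C} (f : X ⟶ Y) (g g' : Y ⟶ Z) :
    homDist V g g' ≤ homDist V (f ≫ g) (f ≫ g') := by
  refine le_trans ?_ (homDist_comp f f g g')
  refine (one_mul _).symm.trans_le (mul_le_mul_of_quantale (one_le_homDist f) le_rfl)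

theorem homDist_comp_right {X Y Z : C} (f f' : X ⟶ Y) (g : Y ⟶ Z) :
    homDist V f f' ≤ homDist V (f ≫ g) (f' ≫ g) := by
  refine le_trans ?_ (homDist_comp f f' g g)
  refine (mul_one _).symm.trans_le (mul_le_mul_of_quantale le_rfl (one_le_homDist g))

theorem homDist_whiskerRight {X Y : C} (f f' : X ⟶ Y) (Z : C) :
    homDist V f f' ≤ homDist V (f ▷ Z) (f' ▷ Z) := by
  rw [← tensorHom_id, ← tensorHom_id]
  refine le_trans ?_ (homDist_tensor f f' (𝟙 Z) (𝟙 Z))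
  refine (mul_one _).symm.trans_le (mul_le_mul_of_quantale le_rfl (one_le_homDist _))

end Distance

namespace Interp

variable {V : Type uV} [CommMonoid V] [CompleteLattice V] [IsQuantale V]
  {C : Type uC} [Category.{vC} C] [MonoidalCategory C] [SymmetricCategory C]
  [MonoidalClosed C] [VCatSepAutonomous V C] {S : Signature.{uG, uO}} {B : LabelBasis V}
  {T : VTheory S B} {M : Interp S C}

open VTheory (mul_le_mul_of_quantale)

/-- Rules with multiplied labels follow from the `V`-category laws and from `V`-functoriality of
composition and tensor; `lam` uses that transposition preserves distances. The label `⊤` is correct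
since `1 = ⊤` and equal morphisms have distance at least `1`. Tuples are covered so that the premise
of the rule for operation symbols has an induction hypothesis. -/
theorem le_homDist_of_thm (hV : (1 : V) = ⊤) (hM : T.IsModel M) {Γ : Ctx S.Ground}
    {k : Goal S.Ground} {q : V} {v w : Der S Γ k} (h : T.Thm q v w) :
    q ≤ homDist V (M.interp v) (M.interp w) := by
  have self : ∀ {X Y : C} {f g : X ⟶ Y}, f = g → (⊤ : V) ≤ homDist V f g := fun h => by
    rw [h, ← hV]; exact one_le_homDist _
  have two : ∀ {q r : V} {X Y X' Y' X'' Y'' : C} {f g : X ⟶ Y} {f' g' : X' ⟶ Y'}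
      {f'' g'' : X'' ⟶ Y''}, homDist V f g * homDist V f' g' ≤ homDist V f'' g'' →
      q ≤ homDist V f g → r ≤ homDist V f' g' → q * r ≤ homDist V f'' g'' := fun h h₁ h₂ =>
    (mul_le_mul_of_quantale h₁ h₂).trans h
  induction h with
  | ax h => exact hM _ _ _ _ _ h
  | eqn h => exact self (M.tm_eq_of_lamEq h)
  | eqn' h => exact self (M.tm_eq_of_lamEq h).symm
  | refl v => exact self rfl
  | trans _ _ ih ih' => exact two (homDist_trans _ _ _) ih ih'
  | weak _ hrq _ ih => exact hrq.trans ih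
  -- Since `q` is the join of the basis elements way below it, an upper bound of these is above `q`.
  | @arch _ _ q v w _ _ ih => exact (B.isLUB_below q).2 fun r hr => ih r hr.1 hr.2
  | join _ ih => exact iSup_le ih
  | op _ ih => exact ih.trans (homDist_comp_right _ _ _)
  | nil => exact one_le_homDist _
  | snoc s _ _ ih ih' =>
    exact (two (homDist_tensor _ _ _ _) ih ih').trans
      ((homDist_comp_right _ _ _).trans (homDist_comp_left _ _ _))
  | pair s _ _ ih ih' =>
    exact (two (homDist_tensor _ _ _ _) ih ih').trans (homDist_comp_left _ _ _)
  | seq s _ _ ih ih' =>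
    exact (two (homDist_comp _ _ _ _) (ih.trans (homDist_whiskerRight _ _ _))
      (ih'.trans (homDist_comp_left _ _ _))).trans (homDist_comp_left _ _ _)
  | lam _ ih => exact (ih.trans (homDist_comp_left _ _ _)).trans (homDist_transpose _ _).ge
  | pm s _ _ ih ih' =>
    exact (two (homDist_comp _ _ _ _) (ih.trans (homDist_whiskerRight _ _ _))
      (ih'.trans ((homDist_comp_left _ _ _).trans ((homDist_comp_left _ _ _).trans
        ((homDist_comp_left _ _ _).trans (homDist_comp_left _ _ _)))))).trans
          (homDist_comp_left _ _ _)
  | app s _ _ ih ih' =>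
    exact (two (homDist_tensor _ _ _ _) ih ih').trans
      ((homDist_comp_right _ _ _).trans (homDist_comp_left _ _ _))
  | perm p _ ih =>
    rw [Der.perm, Der.perm, interp_sub, interp_sub]
    exact ih.trans (homDist_comp_left _ _ _)
  | @subst Γ Δ E A K q r s v w v' w' _ _ ih ih' =>
    refine le_trans ?_ (le_of_eq (congrArg₂ (homDist V) (M.tm_inst s v v') (M.tm_inst s w w')).symm)
    -- The denotation of `inst` composes the substituted term first and the body second, whereas the
    -- label has the factor of the body first.
    rw [mul_comm]
    refine two (homDist_comp _ _ _ _) (le_trans ?_ ((homDist_comp_right _ _ _).trans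
      (homDist_comp_left _ _ _))) ih
    refine le_trans ih' (le_trans ?_ (homDist_tensor _ _ _ _))
    exact (one_mul _).symm.trans_le (mul_le_mul_of_quantale (one_le_homDist _) le_rfl)

end Interp

/-! ### Concatenation and unpacking of contexts. -/

section Append

variable {C : Type uC} [Category.{vC} C] [MonoidalCategory C] [SymmetricCategory C]
  [MonoidalClosed C]

/-- `⟦Δ⟧ ⊗ ⟦Γ⟧ ⟶ ⟦Δ, Γ⟧`. -/
def appendHom {G : Type uG} (g : G → C) : (Γ Δ : Ctx G) → (ctxOf g Δ ⊗ ctxOf g Γ ⟶ ctxOf g (Γ ++ Δ))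
  | [], Δ => (ρ_ (ctxOf g Δ)).hom
  | A :: Γ, Δ => ctxOf g Δ ◁ (join g Γ A).inv ≫ (α_ _ _ _).inv ≫ appendHom g Γ Δ ▷ tyOf g A ≫
      (join g (Γ ++ Δ) A).hom

theorem append_mid_nil_aux {X A XA : C} (j : X ⊗ A ≅ XA) :
    (ρ_ XA).hom ≫ j.inv = j.inv ▷ 𝟙_ C ≫ (α_ _ _ _).hom ≫ X ◁ (β_ A (𝟙_ C)).hom ≫
      (α_ _ _ _).inv ≫ (ρ_ X).hom ▷ A := by
  simp

/-- Inductive step of `appendHom_mid`: `h` moves `A` past `G`, and a hexagon combines this with the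
crossing of the further variable `X`. -/
theorem append_mid_cons_aux {D A DA X G GX E E' EX EX' : C} (j : G ⊗ X ≅ GX) (i : D ⊗ A ≅ DA)
    (a : DA ⊗ G ⟶ E) (a' : D ⊗ G ⟶ E') (k : E ⊗ X ≅ EX) (k' : E' ⊗ X ≅ EX') (s : E ⟶ E' ⊗ A)
    (h : a ≫ s = i.inv ▷ G ≫ (α_ _ _ _).hom ≫ D ◁ (β_ A G).hom ≫ (α_ _ _ _).inv ≫ a' ▷ A) :
    (DA ◁ j.inv ≫ (α_ _ _ _).inv ≫ a ▷ X ≫ k.hom) ≫ k.inv ≫ s ▷ X ≫ (α_ _ _ _).hom ≫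
        E' ◁ (β_ A X).hom ≫ (α_ _ _ _).inv ≫ k'.hom ▷ A =
      i.inv ▷ GX ≫ (α_ _ _ _).hom ≫ D ◁ (β_ A GX).hom ≫ (α_ _ _ _).inv ≫
        (D ◁ j.inv ≫ (α_ _ _ _).inv ≫ a' ▷ X ≫ k'.hom) ▷ A := by
  calc _ = DA ◁ j.inv ≫ (α_ _ _ _).inv ≫ (a ≫ s) ▷ X ≫ (α_ _ _ _).hom ≫
        E' ◁ (β_ A X).hom ≫ (α_ _ _ _).inv ≫ k'.hom ▷ A := by simp
    _ = i.inv ▷ GX ≫ (D ⊗ A) ◁ j.inv ≫ (α_ _ _ _).hom ≫ D ◁ (β_ A (G ⊗ X)).hom ≫ (α_ _ _ _).inv ≫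
        ((α_ _ _ _).inv ≫ a' ▷ X ≫ k'.hom) ▷ A := by
      rw [h, BraidedCategory.braiding_tensor_right_hom]
      simp only [comp_whiskerRight, Category.assoc]
      rw [associator_naturality_left_assoc, ← whisker_exchange_assoc,
        associator_inv_naturality_left_assoc, ← associator_inv_naturality_left_assoc,
        ← whisker_exchange_assoc]
      simp
    _ = _ := by
      rw [associator_naturality_right_assoc, ← whiskerLeft_comp_assoc,
        BraidedCategory.braiding_naturality_right]
      simp

theorem appendHom_mid {G : Type uG} (g : G → C) (A : Ty G) (Γ Δ : Ctx G) :
    appendHom g Γ (A :: Δ) ≫ splitHom g (.mid A Γ Δ) =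
      (join g Δ A).inv ▷ ctxOf g Γ ≫ (α_ _ _ _).hom ≫ ctxOf g Δ ◁ (β_ _ _).hom ≫
        (α_ _ _ _).inv ≫ appendHom g Γ Δ ▷ tyOf g A := by
  induction Γ with
  | nil =>
    rw [Sf.mid]
    refine (congrArg (_ ≫ ·) (splitHom_right_nilR g Δ A)).trans ?_
    exact append_mid_nil_aux _
  | cons X Γ ih => exact append_mid_cons_aux _ _ _ _ _ _ _ ih

/-- Recursive step of `tm_unpack`. The term moves the last variable, of type `A`, before the packed
remainder `X`, so that the recursion can treat it as untouched; `Sf.mid` later moves it back. The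
two crossings cancel by symmetry. -/
theorem tm_unpack_aux {D X A J DX DXA DA P E E' EA K : C} (j : D ⊗ (X ⊗ A) ≅ J)
    (jX : D ⊗ X ≅ DX) (jXA : DX ⊗ A ≅ DXA) (jA : D ⊗ A ≅ DA) (k : DA ⊗ X ≅ P)
    (a : DA ⊗ X ⟶ E) (a' : D ⊗ X ⟶ E') (s : E ⟶ E' ⊗ A) (l : E' ⊗ A ⟶ EA) (t : EA ⟶ K)
    (h : a ≫ s = jA.inv ▷ X ≫ (α_ _ _ _).hom ≫ D ◁ (β_ A X).hom ≫ (α_ _ _ _).inv ≫ a' ▷ A)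
    (b : DXA ⟶ K)
    (hb : b = ((jXA.inv ≫ jX.inv ▷ A ≫ (α_ _ _ _).hom ≫ D ◁ (β_ X A).hom ≫ (α_ _ _ _).inv ≫
        jA.hom ▷ X) ≫ (𝟙 DA ⊗ₘ 𝟙 X) ≫ k.hom) ≫
      k.inv ≫ a ≫ (s ≫ (𝟙 E' ⊗ₘ 𝟙 A) ≫ l) ≫ t) :
    (j.inv ≫ (β_ D (X ⊗ A)).hom) ≫ 𝟙 (X ⊗ A) ▷ D ≫ (β_ (X ⊗ A) D).hom ≫ (α_ D X A).inv ≫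
        jX.hom ▷ A ≫ jXA.hom ≫ b =
      j.inv ≫ (D ◁ 𝟙 (X ⊗ A) ≫ (α_ D X A).inv ≫ a' ▷ A ≫ l) ≫ t := by
  calc _ = j.inv ≫ (α_ D X A).inv ≫ (α_ _ _ _).hom ≫ D ◁ (β_ X A).hom ≫ (α_ _ _ _).inv ≫
        jA.hom ▷ X ≫ (a ≫ s) ≫ l ≫ t := by
        rw [hb]
        simp [-BraidedCategory.braiding_tensor_left_hom, -BraidedCategory.braiding_tensor_right_hom]
    _ = _ := by
        rw [h]
        have e : D ◁ (β_ X A).hom ≫ D ◁ (β_ A X).hom = 𝟙 _ := by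
          rw [← whiskerLeft_comp, SymmetricCategory.symmetry, whiskerLeft_id]
        simp [reassoc_of% e]

end Append

namespace Interp

variable {C : Type uC} [Category.{vC} C] [MonoidalCategory C] [SymmetricCategory C]
  [MonoidalClosed C] {S : Signature.{uG, uO}} (M : Interp S C)

open Der

/-- Nested pattern matching merely reassociates the variables, so its denotation is the coherence
morphism `appendHom` before that of the body. The untouched context `Δ` is general because the
recursion enlarges it. -/
theorem tm_unpack {K : Ty S.Ground} : (Γ Δ : Ctx S.Ground) → (t : Tm S (Γ ++ Δ) K) →
    M.tm (unpack Γ Δ t) = (join M.ground Δ (tens Γ)).inv ≫ appendHom M.ground Γ Δ ≫ M.tm t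
  | [], Δ, t => by
    refine (M.tm_seq _ _ _).trans ?_
    rw [splitHom_left_nilL]
    have aux : ∀ {X Y Z : C} (j : X ⊗ 𝟙_ C ≅ Y) (t : X ⟶ Z),
      (j.inv ≫ (β_ _ _).hom) ≫ 𝟙 (𝟙_ C) ▷ X ≫ (λ_ X).hom ≫ t = j.inv ≫ (ρ_ X).hom ≫ t := by simp
    exact aux _ _
  | [A], Δ, t => by
    have aux : ∀ {X Y Z A : C} (j : X ⊗ A ≅ Y) (t : Y ⟶ Z),
      t = j.inv ≫ (X ◁ (λ_ A).inv ≫ (α_ _ _ _).inv ≫ (ρ_ X).hom ▷ A ≫ j.hom) ≫ t := by simp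
    exact aux _ _
  | A :: B :: Γ, Δ, t => by
    have hm := appendHom_mid M.ground A (B :: Γ) Δ
    refine (M.tm_pm _ _ _).trans ?_
    have hb := (M.tm_inst (.left (.right (.nilR Δ)))
      (unpack (B :: Γ) (A :: Δ) (inst (.mid A (B :: Γ) Δ) t .hyp)) .hyp).trans
      (congrArg (_ ≫ ·) ((tm_unpack (B :: Γ) (A :: Δ) _).trans
        (congrArg (fun x => _ ≫ _ ≫ x) (M.tm_inst _ _ _))))
    rw [splitHom_left, splitHom_right_nilR] at hb
    rw [splitHom_left_nilL]
    exact tm_unpack_aux _ _ _ _ _ _ _ _ _ _ hm _ hb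

theorem appendHom_vars (Γ : Ctx S.Ground) :
    appendHom M.ground Γ [] ≫ M.tup (vars Γ) = (λ_ (M.ctx Γ)).hom := by
  induction Γ with
  | nil => exact (Category.comp_id _).trans unitors_equal.symm
  | cons A Γ ih =>
    rw [vars]
    refine (congrArg (_ ≫ ·) (M.tup_lift A (vars Γ))).trans ?_
    have aux : ∀ {X XA E EA A : C} (j : X ⊗ A ≅ XA) (a : 𝟙_ C ⊗ X ⟶ E) (k : E ⊗ A ≅ EA) (v : E ⟶ X)
        (h : a ≫ v = (λ_ X).hom), (𝟙_ C ◁ j.inv ≫ (α_ _ _ _).inv ≫ a ▷ A ≫ k.hom) ≫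
          k.inv ≫ v ▷ A ≫ j.hom = (λ_ XA).hom := fun {X XA E EA A} j a k v h => by
      calc _ = 𝟙_ C ◁ j.inv ≫ (α_ _ _ _).inv ≫ (a ≫ v) ▷ A ≫ j.hom := by simp
        _ = _ := by rw [h]; simp
    exact aux _ _ _ _ ih

/-- Every interpretation can be recovered from the denotations of one-variable terms. This is used
to identify the operations of the syntactic interpretation and, at the end, those of a model. -/
theorem tm_unpack_op (f : S.Op) :
    M.tm (unpack (S.dom f) [] (.op f (vars (S.dom f)))) = M.op f := by
  rw [tm_unpack, tm_op]
  refine (congrArg (_ ≫ ·) ((Category.assoc _ _ _).symm.trans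
    (congrArg (· ≫ M.op f) (M.appendHom_vars (S.dom f))))).trans ?_
  exact Iso.inv_hom_id_assoc (λ_ _) _

end Interp

/-! ### Denotations of the structural terms. -/

section StructuralTerms

variable {C : Type uC} [Category.{vC} C] [MonoidalCategory C] [SymmetricCategory C]
  [MonoidalClosed C] {S : Signature.{uG, uO}} (M : Interp S C)

theorem splitHom_two {G : Type uG} (g : G → C) (A B : Ty G) :
    splitHom g (.two A B) = 𝟙 (tyOf g A ⊗ tyOf g B) := splitHom_right_nilR g [A] B

theorem splitHom_two_swap {G : Type uG} (g : G → C) (A B : Ty G) :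
    splitHom g (.left (A := B) (.right (A := A) .nil)) = (β_ (tyOf g A) (tyOf g B)).hom :=
  (splitHom_swap g (.two A B)).trans
    ((congrArg (· ≫ (β_ _ _).hom) (splitHom_two g A B)).trans (Category.id_comp _))

namespace Interp

open Der

theorem tm_ap {Γ : Ctx S.Ground} {A B : Ty S.Ground} (f : Tm S [A] B) (t : Tm S Γ A) :
    M.tm (ap f t) = M.tm t ≫ M.tm f := by
  rw [ap, tm_inst, splitHom_nilL]
  have aux : ∀ {X Y Z : C} (t : X ⟶ Y) (f : Y ⟶ Z),
    ((λ_ X).inv ≫ (𝟙 (𝟙_ C) ⊗ₘ t) ≫ (λ_ Y).hom) ≫ f = t ≫ f := by simp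
  exact aux _ _

/-- The untouched context is empty, so only a composite of unit isomorphisms equal to the identity
remains; the context of the body already denotes the tensor product of its two types. -/
theorem tm_pm_hyp {A B K : Ty S.Ground} (w : Tm S [B, A] K) :
    M.tm (.pm (.left .nil) .hyp w) = M.tm w := by
  refine (M.tm_pm (.nilR [.tensor A B]) .hyp w).trans ?_
  rw [splitHom_nilR]
  have aux : ∀ {X Y Z : C} (w : X ⊗ Y ⟶ Z), (ρ_ (X ⊗ Y)).inv ≫ 𝟙 (X ⊗ Y) ▷ 𝟙_ C ≫
      (β_ (X ⊗ Y) (𝟙_ C)).hom ≫ (α_ (𝟙_ C) X Y).inv ≫ (λ_ X).hom ▷ Y ≫ 𝟙 (X ⊗ Y) ≫ w = w := by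
    simp
  exact aux (X := M.ty A) (Y := M.ty B) (M.tm w)

theorem tm_tHom {A A' B B' : Ty S.Ground} (f : Tm S [A] A') (g : Tm S [B] B') :
    M.tm (tHom f g) = M.tm f ⊗ₘ M.tm g := by
  rw [tHom, tm_pm_hyp, tm_pair, splitHom_two]
  exact Category.id_comp _

theorem tm_bHom (A B : Ty S.Ground) : M.tm (bHom A B) = (β_ (M.ty A) (M.ty B)).hom := by
  rw [bHom, tm_pm_hyp, tm_pair, splitHom_two_swap]
  have aux : ∀ {X Y Z : C} (b : X ⟶ Y ⊗ Z), b ≫ (𝟙 Y ⊗ₘ 𝟙 Z) = b := by simp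
  exact aux _

theorem tm_lHom (A : Ty S.Ground) : M.tm (lHom A) = (λ_ (M.ty A)).hom := by
  rw [lHom, tm_pm_hyp, tm_seq, splitHom_two]
  have aux : ∀ X : C, 𝟙 (𝟙_ C ⊗ X) ≫ 𝟙 (𝟙_ C) ▷ X ≫ (λ_ X).hom ≫ 𝟙 X = (λ_ X).hom := by simp
  exact aux _

theorem tm_rHom (A : Ty S.Ground) : M.tm (rHom A) = (ρ_ (M.ty A)).hom := by
  rw [rHom, tm_pm_hyp, tm_seq, splitHom_two_swap]
  have aux : ∀ X : C, (β_ X (𝟙_ C)).hom ≫ 𝟙 (𝟙_ C) ▷ X ≫ (λ_ X).hom ≫ 𝟙 X = (ρ_ X).hom := by simp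
  exact aux _

theorem tm_aHom (A B K : Ty S.Ground) :
    M.tm (aHom A B K) = (α_ (M.ty A) (M.ty B) (M.ty K)).hom := by
  rw [aHom, tm_pm_hyp, tm_pm, tm_pair, tm_pair, splitHom_two, splitHom_two_swap, splitHom_right,
    splitHom_two_swap]
  have aux : ∀ X Y Z : C, 𝟙 ((X ⊗ Y) ⊗ Z) ≫ 𝟙 (X ⊗ Y) ▷ Z ≫ (β_ (X ⊗ Y) Z).hom ≫
      (α_ Z X Y).inv ≫ 𝟙 (Z ⊗ X) ▷ Y ≫ 𝟙 _ ≫ (𝟙 _ ≫ (β_ Z X).hom ▷ Y ≫ (α_ _ _ _).hom ≫ X ◁ 𝟙 _) ≫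
      (𝟙 X ⊗ₘ ((β_ Z Y).hom ≫ (𝟙 Y ⊗ₘ 𝟙 Z))) = (α_ X Y Z).hom := fun X Y Z => by
    have e : X ◁ (β_ Y Z).hom ≫ X ◁ (β_ Z Y).hom = 𝟙 _ := by
      rw [← whiskerLeft_comp, SymmetricCategory.symmetry, whiskerLeft_id]
    have e' : (β_ X Z).hom ▷ Y ≫ (β_ Z X).hom ▷ Y = 𝟙 _ := by
      rw [← comp_whiskerRight, SymmetricCategory.symmetry, id_whiskerRight]
    simp [e, reassoc_of% e']
  exact aux _ _ _

theorem tm_cur {A B K : Ty S.Ground} (f : Tm S [.tensor A B] K) :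
    M.tm (cur f) = transpose ((β_ (M.ty B) (M.ty A)).hom ≫ M.tm f) := by
  rw [cur, tm_lam, tm_ap, tm_pair, splitHom_two_swap]
  have aux : ∀ {X Y Z K : C} (b : X ⟶ Y ⊗ Z) (f : Y ⊗ Z ⟶ K),
    𝟙 X ≫ (b ≫ (𝟙 Y ⊗ₘ 𝟙 Z)) ≫ f = b ≫ f := by simp
  exact congrArg transpose (aux _ _)

end Interp

end StructuralTerms

/-! ### The strict functor induced by a model. -/

section InducedFunctor

variable {V : Type uV} [CommMonoid V] [CompleteLattice V] [IsQuantale V]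
  {S : Signature.{uG, uO}} {B : LabelBasis V} {T : VTheory S B}

theorem Syn.transpose_eq {X Y Z : Syn T} (f : Z ⊗ X ⟶ Y) :
    transpose f = Q.cur (Q.ap f (Q.mk T (.bHom X Z))) := Syn.curry_eq _

section Induced

variable {C : Type uC} [Category.{vC} C] [MonoidalCategory C] [SymmetricCategory C]
  [MonoidalClosed C] [VCatSepAutonomous V C] {M : Interp S C}

open Functor

theorem Interp.dist_le_homDist (hV : (1 : V) = ⊤) (hM : T.IsModel M) {Γ : Ctx S.Ground}
    {A : Ty S.Ground} (v w : Tm S Γ A) : T.dist v w ≤ homDist V (M.tm v) (M.tm w) :=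
  sSup_le fun _ h => Interp.le_homDist_of_thm hV hM h

/-- Separatedness of the hom-sets of `C` turns mutual distances above `1` into equality. This makes
denotation well defined on classes. -/
theorem Interp.tm_eq_of_eqv (hV : (1 : V) = ⊤) (hM : T.IsModel M) {Γ : Ctx S.Ground}
    {A : Ty S.Ground} {v w : Tm S Γ A} (h : T.Eqv v w) : M.tm v = M.tm w :=
  VCatSepAutonomous.sep (V := V) _ _ _ _ (h.1.trans (Interp.dist_le_homDist hV hM v w))
    (h.2.trans (Interp.dist_le_homDist hV hM w v))

/-- The functor `[v] ↦ ⟦v⟧_M`. -/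
def inducedFunctor (hV : (1 : V) = ⊤) (hM : T.IsModel M) : Syn T ⥤ C where
  obj A := M.ty A
  map f := Quotient.lift M.tm (fun _ _ h => Interp.tm_eq_of_eqv hV hM h) f
  map_id _ := rfl
  map_comp f g := by
    induction f using Q.ind with | h f =>
    induction g using Q.ind with | h g => exact M.tm_ap g f

/-- The functor `[v] ↦ ⟦v⟧_M` preserves the tensor product strictly. -/
def inducedCoreMonoidal (hV : (1 : V) = ⊤) (hM : T.IsModel M) :
    (inducedFunctor hV hM).CoreMonoidal where
  εIso := Iso.refl (𝟙_ C)
  μIso A K := Iso.refl (M.ty A ⊗ M.ty K)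
  μIso_hom_natural_left {A A'} f K := by
    induction f using Q.ind with | h f =>
    refine (Category.comp_id _).trans (Eq.trans ?_ (Category.id_comp _).symm)
    exact ((M.tm_tHom f .hyp).trans (tensorHom_id _ _)).symm
  μIso_hom_natural_right {A A'} K f := by
    induction f using Q.ind with | h f =>
    refine (Category.comp_id _).trans (Eq.trans ?_ (Category.id_comp _).symm)
    exact ((M.tm_tHom .hyp f).trans (id_tensorHom _ _)).symm
  associativity A K L := by
    have aux : ∀ {X Y Z : C} (a : (X ⊗ Y) ⊗ Z ⟶ X ⊗ Y ⊗ Z), a = (α_ X Y Z).hom →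
        𝟙 (X ⊗ Y) ▷ Z ≫ 𝟙 _ ≫ a = (α_ X Y Z).hom ≫ X ◁ 𝟙 (Y ⊗ Z) ≫ 𝟙 _ := by
      rintro _ _ _ _ rfl; simp
    exact aux _ (M.tm_aHom A K L)
  left_unitality A := by
    have aux : ∀ {X : C} (a : 𝟙_ C ⊗ X ⟶ X), a = (λ_ X).hom →
        (λ_ X).hom = 𝟙 (𝟙_ C) ▷ X ≫ 𝟙 _ ≫ a := by rintro _ _ rfl; simp
    exact aux _ (M.tm_lHom A)
  right_unitality A := by
    have aux : ∀ {X : C} (a : X ⊗ 𝟙_ C ⟶ X), a = (ρ_ X).hom →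
        (ρ_ X).hom = X ◁ 𝟙 (𝟙_ C) ≫ 𝟙 _ ≫ a := by rintro _ _ rfl; simp
    exact aux _ (M.tm_rHom A)

/-- The functor `[v] ↦ ⟦v⟧_M` preserves the braiding. -/
@[reducible]
def inducedBraided (hV : (1 : V) = ⊤) (hM : T.IsModel M) : (inducedFunctor hV hM).Braided where
  __ := (inducedCoreMonoidal hV hM).toMonoidal
  braided A K := (Category.id_comp _).trans ((M.tm_bHom A K).trans (Category.comp_id _).symm)

/-- A transpose in the syntactic category is a curried term precomposed with the braiding, and the
denotation of currying contains another braiding. The two cancel. -/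
theorem inducedFunctor_transpose (hV : (1 : V) = ⊤) (hM : T.IsModel M) {X Y Z : Syn T}
    (f : Z ⊗ X ⟶ Y) : (inducedFunctor hV hM).map (transpose f) =
      transpose (X := M.ty X) (Y := M.ty Y) (Z := M.ty Z) ((inducedFunctor hV hM).map f) := by
  rw [Syn.transpose_eq]
  induction f using Q.ind with | h f =>
  refine (M.tm_cur (A := X) (B := Z) _).trans (congrArg transpose ?_)
  refine (congrArg ((β_ (M.ty Z) (M.ty X)).hom ≫ ·) ((M.tm_ap (A := .tensor Z X) f _).trans
    (congrArg (· ≫ M.tm f) (M.tm_bHom X Z)))).trans ?_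
  exact SymmetricCategory.symmetry_assoc _ _ _

/-- As `μ` is an identity and transposes are preserved on the nose, the comparison is the image of
the transpose of application, which is an identity. -/
theorem inducedFunctor_homComparison (hV : (1 : V) = ⊤) (hM : T.IsModel M) (X Y : Syn T) :
    letI := inducedBraided hV hM
    homComparison (inducedFunctor hV hM) X Y = 𝟙 (lolli (M.ty X) (M.ty Y)) := by
  refine (congrArg transpose (Category.id_comp _)).trans ?_
  refine (inducedFunctor_transpose hV hM (appHom X Y)).symm.trans ?_
  rw [transpose_appHom]
  exact (inducedFunctor hV hM).map_id _

/-- The autonomous functor `[v] ↦ ⟦v⟧_M`. -/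
def inducedVAutFunctor (hV : (1 : V) = ⊤) (hM : T.IsModel M) : VAutFunctor V (Syn T) C where
  functor := inducedFunctor hV hM
  braided := inducedBraided hV hM
  isIso X Y := by
    rw [inducedFunctor_homComparison]
    exact IsIso.id (lolli (M.ty X) (M.ty Y))
  enriched X Y f g := by
    induction f using Q.ind with | h f =>
    induction g using Q.ind with | h g => exact Interp.dist_le_homDist hV hM f g

theorem inducedVAutFunctor_isStrict (hV : (1 : V) = ⊤) (hM : T.IsModel M) :
    (inducedVAutFunctor hV hM).IsStrict :=
  ⟨⟨rfl, rfl⟩, fun _ _ => ⟨rfl, rfl⟩, fun X Y => ⟨rfl, inducedFunctor_homComparison hV hM X Y⟩⟩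

theorem inducedVAutFunctor_isInducedBy (hV : (1 : V) = ⊤) (hM : T.IsModel M) :
    IsInducedBy T (inducedVAutFunctor hV hM).functor M :=
  ⟨fun _ => rfl, fun _ _ _ => ((Category.id_comp _).trans (Category.comp_id _)).symm⟩

end Induced

end InducedFunctor

/-! ### Transport of denotations along an autonomous functor. -/

section MapSq

open Functor.LaxMonoidal (ε μ)

variable {C : Type uC} [Category.{vC} C] [MonoidalCategory C] [SymmetricCategory C]
  [MonoidalClosed C] {D : Type uD} [Category.{vD} D] [MonoidalCategory D] [SymmetricCategory D]
  [MonoidalClosed D] (F : C ⥤ D)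

/-- The square with horizontal sides `f'` and `F f` and vertical sides `h` and `k` commutes. -/
def MapSq {X Y : C} {X' Y' : D} (h : X' ⟶ F.obj X) (k : Y' ⟶ F.obj Y) (f' : X' ⟶ Y')
    (f : X ⟶ Y) : Prop := f' ≫ k = h ≫ F.map f

namespace MapSq

variable {F} {X Y Z W : C} {X' Y' Z' W' : D} {h : X' ⟶ F.obj X} {k : Y' ⟶ F.obj Y}
  {l : Z' ⟶ F.obj Z} {n : W' ⟶ F.obj W}

theorem id (h : X' ⟶ F.obj X) : MapSq F h h (𝟙 X') (𝟙 X) := by simp [MapSq]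

theorem comp {f' : X' ⟶ Y'} {f : X ⟶ Y} {g' : Y' ⟶ Z'} {g : Y ⟶ Z} (s : MapSq F h k f' f)
    (t : MapSq F k l g' g) : MapSq F h l (f' ≫ g') (f ≫ g) := by
  rw [MapSq] at *
  rw [Category.assoc, t, ← Category.assoc, s, Category.assoc, F.map_comp]

theorem inv {f' : X' ≅ Y'} {f : X ≅ Y} (s : MapSq F h k f'.hom f.hom) :
    MapSq F k h f'.inv f.inv := by
  rw [MapSq] at *
  rw [Iso.inv_comp_eq, ← Category.assoc, s, Category.assoc, ← F.map_comp, f.hom_inv_id, F.map_id,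
    Category.comp_id]

variable [F.Monoidal]

theorem tensor {f' : X' ⟶ Y'} {f : X ⟶ Y} {g' : Z' ⟶ W'} {g : Z ⟶ W} (s : MapSq F h k f' f)
    (t : MapSq F l n g' g) :
    MapSq F ((h ⊗ₘ l) ≫ μ F X Z) ((k ⊗ₘ n) ≫ μ F Y W) (f' ⊗ₘ g') (f ⊗ₘ g) := by
  rw [MapSq] at *
  rw [tensorHom_comp_tensorHom_assoc, s, t, Category.assoc, ← Functor.LaxMonoidal.μ_natural,
    tensorHom_comp_tensorHom_assoc]

theorem whiskerRight {f' : X' ⟶ Y'} {f : X ⟶ Y} (s : MapSq F h k f' f) (l : Z' ⟶ F.obj Z) :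
    MapSq F ((h ⊗ₘ l) ≫ μ F X Z) ((k ⊗ₘ l) ≫ μ F Y Z) (f' ▷ Z') (f ▷ Z) := by
  simpa using s.tensor (MapSq.id l)

theorem whiskerLeft (l : Z' ⟶ F.obj Z) {f' : X' ⟶ Y'} {f : X ⟶ Y} (s : MapSq F h k f' f) :
    MapSq F ((l ⊗ₘ h) ≫ μ F Z X) ((l ⊗ₘ k) ≫ μ F Z Y) (Z' ◁ f') (Z ◁ f) := by
  simpa using (MapSq.id l).tensor s

theorem associator (h : X' ⟶ F.obj X) (k : Y' ⟶ F.obj Y) (l : Z' ⟶ F.obj Z) :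
    MapSq F ((((h ⊗ₘ k) ≫ μ F X Y) ⊗ₘ l) ≫ μ F (X ⊗ Y) Z) ((h ⊗ₘ ((k ⊗ₘ l) ≫ μ F Y Z)) ≫
      μ F X (Y ⊗ Z)) (α_ X' Y' Z').hom (α_ X Y Z).hom := by
  rw [MapSq]
  have e := Functor.LaxMonoidal.associativity F X Y Z
  calc _ = (α_ _ _ _).hom ≫ (h ⊗ₘ (k ⊗ₘ l)) ≫ F.obj X ◁ μ F Y Z ≫ μ F X (Y ⊗ Z) := by
        rw [← id_tensorHom, tensorHom_comp_tensorHom_assoc, Category.comp_id]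
    _ = ((h ⊗ₘ k) ⊗ₘ l) ≫ μ F X Y ▷ F.obj Z ≫ μ F (X ⊗ Y) Z ≫ F.map (α_ X Y Z).hom := by
        rw [e, associator_naturality_assoc]
    _ = _ := by
        rw [← tensorHom_id, tensorHom_comp_tensorHom_assoc, Category.comp_id, Category.assoc]

theorem leftUnitor (h : X' ⟶ F.obj X) :
    MapSq F ((ε F ⊗ₘ h) ≫ μ F (𝟙_ C) X) h (λ_ X').hom (λ_ X).hom := by
  rw [MapSq, Category.assoc, tensorHom_def', Category.assoc,
    ← Functor.LaxMonoidal.left_unitality, leftUnitor_naturality]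

/-- By its definition `homComparison` turns application in `D` into `μ` followed by the image of
application. Its inverse in the left side cancels it, and the precomposition with `i.inv` cancels
`i.hom`. -/
theorem app [∀ X Y, IsIso (homComparison F X Y)] (i : X' ≅ F.obj X) (j : Y' ≅ F.obj Y) :
    MapSq F (((lolliIso i j ≪≫ (asIso (homComparison F X Y)).symm).hom ⊗ₘ i.hom) ≫ μ F _ _) j.hom
      (appHom X' Y') (appHom X Y) := by
  have e : homComparison F X Y ▷ F.obj X ≫ appHom _ _ = μ F _ _ ≫ F.map (appHom X Y) :=
    transpose_whisker_appHom _
  have e' : preHom (F.obj Y) i.inv ▷ F.obj X ≫ appHom _ _ = _ ◁ i.inv ≫ appHom _ _ :=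
    transpose_whisker_appHom _
  have e'' : postHom X' j.hom ▷ X' ≫ appHom _ _ = appHom _ _ ≫ j.hom :=
    transpose_whisker_appHom _
  rw [MapSq, Category.assoc, ← e, tensorHom_def', Category.assoc, ← comp_whiskerRight_assoc,
    Iso.trans_hom, Iso.symm_hom, Category.assoc, asIso_inv, IsIso.inv_hom_id, Category.comp_id,
    lolliIso, comp_whiskerRight_assoc, e', ← whisker_exchange_assoc, ← whiskerLeft_comp_assoc,
    i.hom_inv_id, whiskerLeft_id, Category.id_comp, e'']

/-- Since `homComparison` is invertible, a morphism into `F (X ⊸ Y)` is determined by its composite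
with the image of application. After application the square of transposes becomes the given square
`s`. -/
theorem transpose [∀ X Y, IsIso (homComparison F X Y)] {i : X' ≅ F.obj X} {j : Y' ≅ F.obj Y}
    {f' : Z' ⊗ X' ⟶ Y'} {f : Z ⊗ X ⟶ Y} (s : MapSq F ((l ⊗ₘ i.hom) ≫ μ F Z X) j.hom f' f) :
    MapSq F l (lolliIso i j ≪≫ (asIso (homComparison F X Y)).symm).hom
      (VLam.transpose f') (VLam.transpose f) := by
  have ext : ∀ {k k' : Z' ⟶ F.obj (lolli X Y)},
      ((k ⊗ₘ i.hom) ≫ μ F _ _) ≫ F.map (appHom X Y) =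
        ((k' ⊗ₘ i.hom) ≫ μ F _ _) ≫ F.map (appHom X Y) → k = k' := fun {k k'} e => by
    have e' : homComparison F X Y ▷ F.obj X ≫ appHom _ _ = μ F _ _ ≫ F.map (appHom X Y) :=
      transpose_whisker_appHom _
    rw [← cancel_mono (homComparison F X Y)]
    refine lolli_hom_ext ?_
    rw [← cancel_epi (Z' ◁ i.hom), comp_whiskerRight_assoc, comp_whiskerRight_assoc, e']
    simpa [tensorHom_def'] using e
  refine ext ?_
  have a := MapSq.app (F := F) i j
  rw [MapSq] at a s
  calc _ = VLam.transpose f' ▷ X' ≫ appHom X' Y' ≫ j.hom := by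
        rw [a, Category.assoc, Category.assoc, ← tensorHom_id,
          tensorHom_comp_tensorHom_assoc, Category.id_comp]
    _ = (l ⊗ₘ i.hom) ≫ μ F Z X ≫ F.map (VLam.transpose f ▷ X ≫ appHom X Y) := by
        rw [← Category.assoc, transpose_whisker_appHom, s, transpose_whisker_appHom,
          Category.assoc]
    _ = _ := by
        rw [F.map_comp, ← Functor.LaxMonoidal.μ_natural_left_assoc, ← tensorHom_id,
          tensorHom_comp_tensorHom_assoc, Category.comp_id, Category.assoc]

end MapSq

theorem MapSq.braiding {F : C ⥤ D} [F.Braided] {X Y : C} {X' Y' : D} (h : X' ⟶ F.obj X)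
    (k : Y' ⟶ F.obj Y) : MapSq F ((h ⊗ₘ k) ≫ μ F X Y) ((k ⊗ₘ h) ≫ μ F Y X)
      (β_ X' Y').hom (β_ X Y).hom := by
  rw [MapSq, Category.assoc, Functor.LaxBraided.braided, BraidedCategory.braiding_naturality_assoc]

section Push

variable [F.Braided] [∀ X Y, IsIso (homComparison F X Y)] {G : Type uG} (g : G → C)

theorem mapSq_join : (Γ : Ctx G) → (A : Ty G) → MapSq F
    (((hIso F g (tens Γ)).hom ⊗ₘ (hIso F g A).hom) ≫ μ F _ _) (hIso F g (tens (A :: Γ))).hom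
    (join (fun X => F.obj (g X)) Γ A).hom (join g Γ A).hom
  | [], _ => MapSq.leftUnitor _
  | _ :: _, _ => MapSq.id _

theorem mapSq_splitHom {Γ Δ E : Ctx G} (s : Sf Γ Δ E) : MapSq F (hIso F g (tens E)).hom
    (((hIso F g (tens Γ)).hom ⊗ₘ (hIso F g (tens Δ)).hom) ≫ μ F _ _)
    (splitHom (fun X => F.obj (g X)) s) (splitHom g s) := by
  induction s with
  | nil => exact (MapSq.leftUnitor (ε F)).inv
  | left s ih =>
    rw [splitHom_left, splitHom_left]
    exact (mapSq_join F g _ _).inv.comp ((ih.whiskerRight _).comp ((MapSq.associator _ _ _).comp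
      ((MapSq.whiskerLeft _ (MapSq.braiding _ _)).comp ((MapSq.associator _ _ _).inv.comp
        ((mapSq_join F g _ _).whiskerRight _)))))
  | right s ih =>
    rw [splitHom_right, splitHom_right]
    exact (mapSq_join F g _ _).inv.comp ((ih.whiskerRight _).comp ((MapSq.associator _ _ _).comp
      (MapSq.whiskerLeft _ (mapSq_join F g _ _))))

variable {S : Signature.{uG, uO}} (M : Interp S C)

/-- The comparison of the objects in which derivations take their values. -/
noncomputable def hGoal : (k : Goal S.Ground) → ((M.push F).goal k ⟶ F.obj (M.goal k))
  | .one A => (hIso F M.ground A).hom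
  | .many As => (hIso F M.ground (tens As)).hom

/-- Each clause of `interp` is a composite of operations under which commuting squares are closed,
so the proof pastes squares in the order of that clause. For operation symbols the square commutes
by the definition of `F_* M`. -/
theorem mapSq_interp {Γ : Ctx S.Ground} {k : Goal S.Ground} (v : Der S Γ k) :
    MapSq F (hIso F M.ground (tens Γ)).hom (hGoal F M k) ((M.push F).interp v) (M.interp v) := by
  induction v with
  | op f vs ih =>
    refine ih.comp ?_
    have aux : ∀ {X Y Z W : D} (h : X ⟶ Y) (k : Y ⟶ Z) (i : W ≅ Z),
      (h ≫ k ≫ i.inv) ≫ i.hom = h ≫ k := by simp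
    exact aux _ _ _
  | hyp => exact MapSq.id _
  | star => exact MapSq.id _
  | pm s v w ihv ihw =>
    exact (mapSq_splitHom F M.ground s).comp ((ihv.whiskerRight _).comp ((MapSq.braiding _ _).comp
      ((MapSq.associator _ _ _).inv.comp (((mapSq_join F M.ground _ _).whiskerRight _).comp
        ((mapSq_join F M.ground _ _).comp ihw)))))
  | pair s v w ihv ihw => exact (mapSq_splitHom F M.ground s).comp (ihv.tensor ihw)
  | seq s v w ihv ihw =>
    exact (mapSq_splitHom F M.ground s).comp ((ihv.whiskerRight _).comp
      ((MapSq.leftUnitor _).comp ihw))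
  | lam v ih => exact MapSq.transpose ((mapSq_join F M.ground _ _).comp ih)
  | app s v w ihv ihw =>
    exact (mapSq_splitHom F M.ground s).comp ((ihv.tensor ihw).comp (MapSq.app _ _))
  | nil => exact MapSq.id _
  | snoc s vs v ih ih' =>
    exact (mapSq_splitHom F M.ground s).comp ((ih.tensor ih').comp (mapSq_join F M.ground _ _))

theorem mapSq_tm {Γ : Ctx S.Ground} {A : Ty S.Ground} (v : Tm S Γ A) :
    (M.push F).tm v ≫ (hIso F M.ground A).hom = (hIso F M.ground (tens Γ)).hom ≫ F.map (M.tm v) :=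
  mapSq_interp F M v

end Push

end MapSq

/-! ### Associativity of regrouping and of substitution. -/

/-- The associator term matches two pairs in turn, and its action therefore regroups the context
twice. The twofold regrouping agrees with the direct one, up to a swap. -/
theorem Sf.assoc_assoc_swap {G : Type uG} {A B C F E : Ctx G} (s : Sf A B F) (p : Sf F C E) :
    assoc (assoc s.swap p).inner (assoc s.swap p).outer.swap =
      ⟨(assoc s p).ctx, (assoc s p).inner.swap, (assoc s p).outer⟩ := by
  induction p generalizing A B with
  | nil => cases s; rfl
  | right p ih =>
    rw [assoc_right, assoc_right]
    exact congrArg (Two.pushInner _) (ih s)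
  | left p ih =>
    cases s with
    | left s => exact congrArg (Two.pushOuter _) (ih s)
    | right s => exact (assoc_right _ _).trans (congrArg (Two.pushInner' _) (ih s))

namespace Der

variable {S : Signature.{uG, uO}}

theorem ids_sub {Γ E : Ctx S.Ground} (r : Tup S E Γ) : (ids Γ).sub r = r := by
  induction Γ generalizing E with
  | nil => cases r; rfl
  | cons A Γ ih =>
    cases r with
    | snoc p vs v =>
      rw [ids, lift, sub, split, split_nilR, Split.pushR, Sf.assoc_nilR_left, ih]
      rfl

/-- A relation on tuples by which the third one is the composite of the first two. -/
inductive SubComp : {Γ Δ E : Ctx S.Ground} → Tup S Δ Γ → Tup S E Δ → Tup S E Γ → Prop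
  | inst {Γ Δ E F : Ctx S.Ground} {A : Ty S.Ground} (p : Sf E Δ F) (r : Tup S E Γ) (t : Tm S Δ A) :
      SubComp (lift A r) (.snoc p (ids E) t) (.snoc p r t)
  | lift {Γ Δ E : Ctx S.Ground} (A : Ty S.Ground) {r : Tup S Δ Γ} {r' : Tup S E Δ}
      {r'' : Tup S E Γ} (h : SubComp r r' r'') : SubComp (lift A r) (lift A r') (lift A r'')
  | ids {Γ Δ : Ctx S.Ground} (r : Tup S Δ Γ) : SubComp r (ids Δ) r
  | single {Δ E : Ctx S.Ground} {A : Ty S.Ground} (v : Tm S Δ A) (r : Tup S E Δ) :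
      SubComp (.snoc (.nilL Δ) .nil v) r (.snoc (.nilL E) .nil (v.sub r))

theorem split_nilR_single {Γ : Ctx S.Ground} {A : Ty S.Ground} (v : Tm S Γ A) :
    split (.left .nil) (.snoc (.nilL Γ) .nil v) =
      ⟨Γ, [], .snoc (.nilL Γ) .nil v, .nil, .nilR Γ⟩ := split_nilR (Γ := [A]) _

theorem split_nilL_single {Γ : Ctx S.Ground} {A : Ty S.Ground} (v : Tm S Γ A) :
    split (.right .nil) (.snoc (.nilL Γ) .nil v) =
      ⟨[], Γ, .nil, .snoc (.nilL Γ) .nil v, .nilL Γ⟩ := split_nilL (Γ := [A]) _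

/-- The four kinds of composites are closed under splitting: the part that contains the substituted
variable is again of the same kind, and the other part is composed with identities. With closure
under `lift` this carries the induction in `sub_sub`, without composing arbitrary tuples. -/
theorem SubComp.split {Γ Δ E : Ctx S.Ground} {r : Tup S Δ Γ} {r' : Tup S E Δ} {r'' : Tup S E Γ}
    (h : SubComp r r' r'') {Γ₁ Γ₂ : Ctx S.Ground} (s : Sf Γ₁ Γ₂ Γ) :
    ∃ tL tR, Der.split s r'' = ⟨_, _, tL, tR, (Der.split (Der.split s r).sf r').sf⟩ ∧
      SubComp (Der.split s r).tupL (Der.split (Der.split s r).sf r').tupL tL ∧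
      SubComp (Der.split s r).tupR (Der.split (Der.split s r).sf r').tupR tR := by
  induction h generalizing Γ₁ Γ₂ with
  | @inst Γ Δ E F A p r t =>
    cases s with
    | left s =>
      have e : Der.split (.left (Der.split s r).sf) (.snoc p (Der.ids E) t) = _ :=
        congrArg (Split.pushL · p t) (split_ids (Der.split s r).sf)
      rw [split_left_lift, e]
      exact ⟨_, _, rfl, .inst _ _ _, .ids _⟩
    | right s =>
      have e : Der.split (.right (Der.split s r).sf) (.snoc p (Der.ids E) t) = _ :=
        congrArg (Split.pushR · p t) (split_ids (Der.split s r).sf)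
      rw [split_right_lift, e]
      exact ⟨_, _, rfl, .ids _, .inst _ _ _⟩
  | lift A h ih =>
    cases s with
    | left s =>
      obtain ⟨tL, tR, e, hL, hR⟩ := ih s
      rw [split_left_lift, split_left_lift, split_left_lift, e]
      exact ⟨_, _, rfl, .lift _ hL, hR⟩
    | right s =>
      obtain ⟨tL, tR, e, hL, hR⟩ := ih s
      rw [split_right_lift, split_right_lift, split_right_lift, e]
      exact ⟨_, _, rfl, hL, .lift _ hR⟩
  | ids r =>
    rw [split_ids]
    exact ⟨_, _, rfl, .ids _, .ids _⟩
  | single v r =>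
    cases s with
    | left s =>
      cases s
      rw [split_nilR_single, split_nilR_single, split_nilR]
      exact ⟨_, _, rfl, .single _ _, .ids .nil⟩
    | right s =>
      cases s
      rw [split_nilL_single, split_nilL_single, split_nilL]
      exact ⟨_, _, rfl, .ids .nil, .single _ _⟩

theorem sub_sub {Γ Δ E : Ctx S.Ground} {k : Goal S.Ground} (v : Der S Γ k) {r : Tup S Δ Γ}
    {r' : Tup S E Δ} {r'' : Tup S E Γ} (h : SubComp r r' r'') : (v.sub r).sub r' = v.sub r'' := by
  induction v generalizing Δ E with
  | op f vs ih => rw [sub, sub, sub, ih h]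
  | hyp =>
    cases h with
    | inst p r t => cases r; rfl
    | @lift _ _ _ _ r r' r'' h =>
      cases r
      cases r'
      cases r''
      rfl
    | ids r => exact sub_ids _
    | single v r => rfl
  | star =>
    cases h
    cases r
    rfl
  | nil =>
    cases h
    cases r
    rfl
  | lam v ih => rw [sub, sub, sub, ih (h.lift _)]
  | pm s v w ihv ihw =>
    obtain ⟨tL, tR, e, hL, hR⟩ := h.split s
    simp only [sub]
    rw [e, ihv hL, ihw ((hR.lift _).lift _)]
  | pair s v w ihv ihw =>
    obtain ⟨tL, tR, e, hL, hR⟩ := h.split s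
    rw [sub, sub, sub, e, ihv hL, ihw hR]
  | seq s v w ihv ihw =>
    obtain ⟨tL, tR, e, hL, hR⟩ := h.split s
    rw [sub, sub, sub, e, ihv hL, ihw hR]
  | app s v w ihv ihw =>
    obtain ⟨tL, tR, e, hL, hR⟩ := h.split s
    rw [sub, sub, sub, e, ihv hL, ihw hR]
  | snoc s v w ihv ihw =>
    obtain ⟨tL, tR, e, hL, hR⟩ := h.split s
    rw [sub, sub, sub, e, ihv hL, ihw hR]

theorem inst_sub_lift {Γ Δ E F : Ctx S.Ground} {A B : Ty S.Ground} (p : Sf E Δ F)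
    (v : Tm S (A :: Γ) B) (r : Tup S E Γ) (t : Tm S Δ A) :
    inst p (v.sub (lift A r)) t = v.sub (.snoc p r t) := sub_sub v (.inst p r t)

theorem ap_sub {Γ E : Ctx S.Ground} {A B : Ty S.Ground} (f : Tm S [A] B) (v : Tm S Γ A)
    (r : Tup S E Γ) : (ap f v).sub r = ap f (v.sub r) := sub_sub f (.single v r)

end Der

/-! ### Generalized elements of the syntactic category. -/

section GeneralizedElements

variable {V : Type uV} [CommMonoid V] [CompleteLattice V] [IsQuantale V]
  {S : Signature.{uG, uO}} {B : LabelBasis V} {T : VTheory S B}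

namespace Q

/-- `pm x to a ⊗ b. y` -/
def pm {Γ Δ E : Ctx S.Ground} {A C D : Ty S.Ground} (s : Sf Γ Δ E) :
    Q T Γ (.tensor A C) → Q T (C :: A :: Δ) D → Q T E D :=
  Quotient.map₂ (Der.pm s) fun _ _ h _ _ h' => VTheory.Eqv.pm s h h'

/-- `x to ∗. y` -/
def seq {Γ Δ E : Ctx S.Ground} {D : Ty S.Ground} (s : Sf Γ Δ E) :
    Q T Γ .unit → Q T Δ D → Q T E D :=
  Quotient.map₂ (Der.seq s) fun _ _ h _ _ h' => VTheory.Eqv.seq s h h'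

theorem ap_pm {Γ Δ E : Ctx S.Ground} {A C D D' : Ty S.Ground} (s : Sf Γ Δ E)
    (x : Q T Γ (.tensor A C)) (y : Q T (C :: A :: Δ) D) (f : Q T [D] D') :
    f.ap (pm s x y) = pm s x (f.ap y) := by
  induction f using ind with | h f =>
  induction x using ind with | h x =>
  induction y using ind with | h y => exact sound (VTheory.ap_pm_conv s x y f)

theorem ap_seq {Γ Δ E : Ctx S.Ground} {D D' : Ty S.Ground} (s : Sf Γ Δ E)
    (x : Q T Γ .unit) (y : Q T Δ D) (f : Q T [D] D') :
    f.ap (seq s x y) = seq s x (f.ap y) := by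
  induction f using ind with | h f =>
  induction x using ind with | h x =>
  induction y using ind with | h y => exact sound (VTheory.ap_seq_conv s x y f)

theorem inst_ap_pair {Γ Θ E : Ctx S.Ground} {A D K : Ty S.Ground} (s : Sf Θ Γ E) (v : Tm S Γ A)
    (y : Tm S Θ D) (f : Tm S [.tensor D A] K) :
    T.Eqv (Der.inst s (Der.ap f (.pair (.right (.nilR Θ)) y .hyp)) v)
      (Der.ap f (.pair s y v)) := by
  refine (VTheory.inst_ap _ _ _ _).trans ?_
  rw [Der.inst_pair_right, Sf.assoc_nilR_left]
  exact VTheory.Eqv.rfl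

/-- The `η` law for `⊗`, stated for the second component of a pair to which a morphism is applied.
It reduces the action on an arbitrary element of tensor type to the action on a pair of variables.
-/
theorem pm_eta {Γ Θ E : Ctx S.Ground} {A C D K : Ty S.Ground} (s : Sf Γ Θ E)
    (x : Q T Γ (.tensor A C)) (y : Q T Θ D) (f : Q T [.tensor D (.tensor A C)] K) :
    f.ap (pair s.swap y x) =
      pm s x (f.ap (pair (.right (.right (.nilR Θ))) y (pair (.two A C) hyp hyp))) := by
  induction f using ind with | h f =>
  induction x using ind with | h x =>
  induction y using ind with | h y =>
  refine sound ?_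
  refine (inst_ap_pair s.swap x y f).symm.trans ?_
  refine (VTheory.Eqv.of_lamEq (.pm_eta s x _)).symm.trans ?_
  exact VTheory.Eqv.pm _ .rfl (inst_ap_pair _ _ _ _)

theorem seq_eta {Γ Θ E : Ctx S.Ground} {D K : Ty S.Ground} (s : Sf Γ Θ E)
    (x : Q T Γ .unit) (y : Q T Θ D) (f : Q T [.tensor D .unit] K) :
    f.ap (pair s.swap y x) = seq s x (f.ap (pair (.nilR Θ) y star)) := by
  induction f using ind with | h f =>
  induction x using ind with | h x =>
  induction y using ind with | h y =>
  refine sound ?_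
  refine (inst_ap_pair s.swap x y f).symm.trans ?_
  refine (VTheory.Eqv.of_lamEq (.seq_eta s x _)).symm.trans ?_
  exact VTheory.Eqv.seq _ .rfl (inst_ap_pair _ _ _ _)

theorem eq_seq_star {K : Ty S.Ground} (f : Q T [.unit] K) :
    f = seq (.left .nil) hyp (f.ap star) := by
  induction f using ind with | h f =>
  exact sound ((VTheory.Eqv.of_lamEq (.seq_eta (.left .nil) .hyp f)).trans
    (.of_eq (Der.ap_hyp f))).symm

theorem seq_ap_star {K : Ty S.Ground} (x : Q T [] K) :
    (seq (.left .nil) hyp x).ap star = x := by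
  induction x using ind with | h v =>
  refine sound ?_
  have e : Der.ap (.seq (.left .nil) .hyp v) (.star (S := S)) = .seq .nil .star v :=
    congrArg (Der.seq .nil .star) (Der.sub_ids v)
  rw [e]
  exact .of_lamEq (.seq_beta v)

theorem dist_seq {Γ Δ E : Ctx S.Ground} {K : Ty S.Ground} (s : Sf Γ Δ E) (x : Q T Γ .unit)
    (y z : Q T Δ K) : dist y z ≤ dist (seq s x y) (seq s x z) := by
  induction x using ind with | h x =>
  induction y using ind with | h y =>
  induction z using ind with | h z =>
  refine le_trans ?_ (VTheory.dist_seq s x x y z)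
  exact (one_mul _).symm.trans_le
    (VTheory.mul_le_mul_of_quantale (VTheory.one_le_dist_self _) le_rfl)

theorem dist_lam {Γ : Ctx S.Ground} {A K : Ty S.Ground} (x y : Q T (A :: Γ) K) :
    dist x y ≤ dist (lam x) (lam y) := by
  induction x using ind with | h x =>
  induction y using ind with | h y => exact VTheory.dist_lam x y

theorem dist_ap_left {Γ : Ctx S.Ground} {A K : Ty S.Ground} (f : Q T [A] K) (x y : Q T Γ A) :
    dist x y ≤ dist (f.ap x) (f.ap y) :=
  ((one_mul _).symm.trans_le (VTheory.mul_le_mul_of_quantale (one_le_dist f) le_rfl)).trans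
    (dist_ap f f x y)

theorem cur_ap {Γ : Ctx S.Ground} {A C D : Ty S.Ground} (f : Q T [.tensor A C] D) (y : Q T Γ C) :
    (cur f).ap y = lam (f.ap (pair (.left (.nilL Γ)) hyp y)) := by
  induction f using ind with | h f =>
  induction y using ind with | h y =>
  refine sound (VTheory.Eqv.lam ?_)
  have e : (Der.pair (S := S) (.left (.right .nil)) (.hyp (A := A)) (.hyp (A := C))).sub
      (.lift A (.snoc (.nilL Γ) .nil y)) = .pair (.left (.nilL Γ)) .hyp y := by
    rw [Der.sub, VTheory.split_aHom']
    rfl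
  exact .of_eq ((Der.ap_sub f _ _).trans (congrArg (Der.ap f) e))

end Q

namespace Syn

/-- The classes of terms in the context `Γ` whose type is an object of the syntactic category. -/
def El (Γ : Ctx S.Ground) (X : Syn T) : Type (max uG uO) := Q T Γ X

/-- The action of morphisms on generalized elements. -/
def act {Γ : Ctx S.Ground} {X Y : Syn T} (f : X ⟶ Y) (x : El Γ X) : El Γ Y := Q.ap f x

/-- The tensor product of generalized elements. -/
def pr {Γ Δ E : Ctx S.Ground} {X Y : Syn T} (s : Sf Γ Δ E) (x : El Γ X) (y : El Δ Y) :
    El E (X ⊗ Y) := Q.pair s x y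

/-- The element `∗` of the unit object. -/
def unitEl : El [] (𝟙_ (Syn T)) := Q.star (T := T)

variable {Γ Δ Θ E F E' : Ctx S.Ground} {X Y Z X' Y' : Syn T}

theorem act_comp (f : X ⟶ Y) (g : Y ⟶ Z) (x : El Γ X) : act (f ≫ g) x = act g (act f x) :=
  Q.ap_ap g f x

theorem act_id (x : El Γ X) : act (𝟙 X) x = x := Q.hyp_ap x

theorem act_inv_act (e : X ≅ Y) (x : El Γ X) : act e.inv (act e.hom x) = x := by
  rw [← act_comp, e.hom_inv_id, act_id]

theorem act_tensorHom (f : X ⟶ X') (g : Y ⟶ Y') (s : Sf Γ Δ E) (x : El Γ X) (y : El Δ Y) :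
    act (f ⊗ₘ g) (pr s x y) = pr s (act f x) (act g y) := Q.ap_tHom f g s x y

theorem act_whiskerRight (f : X ⟶ X') (s : Sf Γ Δ E) (x : El Γ X) (y : El Δ Y) :
    act (f ▷ Y) (pr s x y) = pr s (act f x) y := by
  rw [← tensorHom_id, act_tensorHom, act_id]

theorem act_whiskerLeft (f : Y ⟶ Y') (s : Sf Γ Δ E) (x : El Γ X) (y : El Δ Y) :
    act (X ◁ f) (pr s x y) = pr s x (act f y) := by
  rw [← id_tensorHom, act_tensorHom, act_id]

theorem act_braiding (s : Sf Γ Δ E) (x : El Γ X) (y : El Δ Y) :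
    act (β_ X Y).hom (pr s x y) = pr s.swap y x := Q.ap_bHom s x y

theorem act_associator (s : Sf Γ Δ F) (p : Sf F Θ E) (x : El Γ X) (y : El Δ Y) (z : El Θ Z) :
    act (α_ X Y Z).hom (pr p (pr s x y) z) =
      pr (Sf.assoc s p).outer x (pr (Sf.assoc s p).inner y z) :=
  Q.ap_aHom_of _ _ _ _ (Sf.assoc_assoc_swap s p) x y z

theorem act_associator_inv (s : Sf Γ Δ F) (p : Sf Θ F E) (x : El Γ X) (y : El Δ Y) (z : El Θ Z) :
    act (α_ Z X Y).inv (pr p z (pr s x y)) =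
      pr (Sf.assoc' s p.swap).outer.swap (pr (Sf.assoc' s p.swap).inner.swap z x) y :=
  Q.ap_aInv s p x y z

theorem act_leftUnitor (x : El Γ X) : act (λ_ X).hom (pr (.nilL Γ) unitEl x) = x := Q.ap_lHom x

theorem act_leftUnitor_inv (x : El Γ X) : act (λ_ X).inv x = pr (.nilL Γ) unitEl x := Q.ap_lInv x

/-- A type as an object of the syntactic category. -/
def of (T : VTheory S B) (A : Ty S.Ground) : Syn T := A

/-- The interpretation of ground types by themselves. -/
def gr (T : VTheory S B) (X : S.Ground) : Syn T := of T (.ground X)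

/-- The interpretation of types in the syntactic category is the identity. -/
def incl (T : VTheory S B) (A : Ty S.Ground) : of T A ≅ tyOf (gr T) A :=
  eqToIso (tyOf_syn T A).symm

/-- The class of a term. -/
def cl (T : VTheory S B) {E : Ctx S.Ground} {A : Ty S.Ground} (v : Tm S E A) : El E (of T A) :=
  Q.mk T v

/-- The element of the interpretation of a type that is given by a term. -/
def el (T : VTheory S B) {E : Ctx S.Ground} {A : Ty S.Ground} (v : Tm S E A) :
    El E (tyOf (gr T) A) := act (incl T A).hom (cl T v)

/-- The tuple of the components as an element of the tensor product of a context. -/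
def gten (T : VTheory S B) {E As : Ctx S.Ground} (r : Tup S E As) : El E (ctxOf (gr T) As) :=
  match r with
  | .nil => unitEl
  | .snoc (As := As) (A := A) s vs v => act (join (gr T) As A).hom (pr s (gten T vs) (el T v))

theorem gten_snoc {As : Ctx S.Ground} {A : Ty S.Ground} (s : Sf Γ Δ E) (vs : Tup S Γ As)
    (v : Tm S Δ A) : gten T (.snoc s vs v) =
      act (join (gr T) As A).hom (pr s (gten T vs) (el T v)) := rfl

/-- The associators and braidings in `splitHom` act on elements by the very regroupings that define
`split`. This is the analogue of `tup_split` for elements. -/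
theorem act_splitHom {Γ Δ F E : Ctx S.Ground} (s : Sf Γ Δ F) (r : Tup S E F) :
    act (splitHom (gr T) s) (gten T r) = pr (Der.split s r).sf
      (gten T (Der.split s r).tupL) (gten T (Der.split s r).tupR) := by
  induction s generalizing E with
  | nil => cases r; exact act_leftUnitor_inv _
  | left s ih =>
    cases r with
    | snoc p vs v =>
      rw [splitHom_left]
      simp only [act_comp, gten_snoc, act_inv_act, act_whiskerRight, ih, act_associator,
        act_whiskerLeft, act_braiding, act_associator_inv]
      -- The morphism regroups twice, with a braiding in between, whereas `split` regroups once
      -- after a swap.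
      have h := Sf.assoc_assoc_swap (Der.split s vs).sf.swap p
      rw [Sf.swap_swap] at h
      rw [Sf.assoc', Sf.swap_swap, h, Sf.swap_swap]
      rfl
  | right s ih =>
    cases r with
    | snoc p vs v =>
      rw [splitHom_right]
      simp only [act_comp, gten_snoc, act_inv_act, act_whiskerRight, ih, act_associator,
        act_whiskerLeft]
      rfl

/-- Abstraction of a variable of a generalized element. -/
def lam (x : El (X :: Γ) Y) : El Γ (lolli X Y) := Q.lam (A := X) x

/-- Application of a generalized element of an internal hom. -/
def app (s : Sf Γ Δ E) (x : El Γ (lolli X Y)) (y : El Δ X) : El E Y := Q.app (A := X) s x y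

/-- The generic element. -/
def var (X : Syn T) : El [X] X := Q.hyp (T := T)

theorem act_transpose (f : Z ⊗ X ⟶ Y) (x : El Γ Z) :
    act (transpose f) x = lam (act f (pr (.right (.nilR Γ)) x (var X))) := by
  rw [transpose_eq]
  refine (Q.cur_ap _ _).trans (congrArg Q.lam ?_)
  refine (Q.ap_ap _ _ _).trans (congrArg (Q.ap f) ((Q.ap_bHom _ _ _).trans ?_))
  exact congrArg (fun s => Q.pair (.right s) x Q.hyp) (Sf.swap_nilL Γ)

theorem act_appHom (s : Sf Γ Δ E) (x : El Γ (lolli X Y)) (y : El Δ X) :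
    act (appHom X Y) (pr s x y) = app s x y := by
  have h : act (β_ _ _).hom (pr s.swap y x) = pr s x y := by rw [act_braiding, Sf.swap_swap]
  -- Transposition is currying after the braiding, so the transpose of application being the
  -- identity says that application is, up to the braiding, the uncurried identity.
  have e : (β_ _ _).hom ≫ appHom X Y = (Q.unc Q.hyp : X ⊗ lolli X Y ⟶ Y) := by
    have e' := (transpose_eq (appHom X Y)).symm.trans (transpose_appHom X Y)
    exact (Q.unc_cur _).symm.trans (congrArg Q.unc e')
  rw [← h, ← act_comp, e]
  refine (Q.ap_unc _ _ _ _).trans ?_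
  rw [Sf.swap_swap]
  exact congrArg (Q.app s · y) (Q.hyp_ap x)

/-- A type equals its interpretation by itself only propositionally. Making the endpoints variables
allows the equalities to be eliminated, after which all transports are identities; `app_act` and
`incl_tensor` use the same device. -/
theorem lam_act (e : X ≅ X') (e' : Y ≅ Y') (he : X = X') (he' : Y = Y')
    (hh : lolli X Y = lolli X' Y') (f : Z ⊗ X' ⟶ Y') (x : El Γ Z) :
    e = eqToIso he → e' = eqToIso he' →
    act (eqToHom hh) (lam (act e'.inv (act f (pr (.right (.nilR Γ)) x (act e.hom (var X)))))) =
      lam (act f (pr (.right (.nilR Γ)) x (var X'))) := by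
  subst he he'
  rintro rfl rfl
  exact (act_id _).trans (congrArg lam ((act_id _).trans
    (congrArg (fun y => act f (pr _ x y)) (act_id _))))

theorem app_act (e : X ≅ X') (e' : Y ≅ Y') (he : X = X') (he' : Y = Y')
    (hh : lolli X Y = lolli X' Y') (s : Sf Γ Δ E) (x : El Γ (lolli X Y)) (y : El Δ X) :
    e = eqToIso he → e' = eqToIso he' →
    app s (act (eqToHom hh) x) (act e.hom y) = act e'.hom (app s x y) := by
  subst he he'
  rintro rfl rfl
  exact (congrArg₂ (app s) (act_id _) (act_id _)).trans (act_id _).symm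

theorem incl_tensor (A C : Ty S.Ground) :
    (incl T (.tensor A C)).hom = ((incl T A).hom ⊗ₘ (incl T C).hom : of T A ⊗ of T C ⟶ _) := by
  have aux : ∀ {X X' Y Y' : Syn T} (h : X = X') (h' : Y = Y') (h'' : X ⊗ Y = X' ⊗ Y'),
      eqToHom h'' = (eqToHom h ⊗ₘ eqToHom h') := by
    rintro X _ Y _ rfl rfl h''
    exact (id_tensorHom_id X Y).symm
  exact aux (X := of T A) (Y := of T C) (tyOf_syn T A).symm (tyOf_syn T C).symm
    (tyOf_syn T (.tensor A C)).symm

theorem el_pair {A C : Ty S.Ground} (s : Sf Γ Δ E) (v : Tm S Γ A) (w : Tm S Δ C) :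
    el T (.pair s v w) = pr s (el T v) (el T w) :=
  (congrArg (fun f => act f (cl T (.pair s v w))) (incl_tensor A C)).trans
    (act_tensorHom (incl T A).hom (incl T C).hom s (cl T v) (cl T w))

theorem el_star : el T .star = unitEl := act_id (X := of T .unit) _

theorem el_lam {A C : Ty S.Ground} (v : Tm S (A :: Γ) C) (x : El Γ Z)
    (f : Z ⊗ tyOf (gr T) A ⟶ tyOf (gr T) C)
    (h : act f (pr (.right (.nilR Γ)) x (el T .hyp)) = el T v) :
    act (transpose f) x = el T (.lam v) := by
  rw [act_transpose]
  refine (lam_act (incl T A) (incl T C) (tyOf_syn T A).symm (tyOf_syn T C).symm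
    (tyOf_syn T (.lolli A C)).symm f x rfl rfl).symm.trans ?_
  exact congrArg (fun y => act (incl T (.lolli A C)).hom (lam (X := of T A) (Y := of T C) y))
    ((congrArg (act (incl T C).inv) h).trans (act_inv_act _ _))

theorem el_app {A C : Ty S.Ground} (s : Sf Γ Δ E) (v : Tm S Γ (.lolli A C)) (w : Tm S Δ A) :
    app s (X := tyOf (gr T) A) (Y := tyOf (gr T) C) (el T v) (el T w) = el T (.app s v w) :=
  app_act (incl T A) (incl T C) (tyOf_syn T A).symm (tyOf_syn T C).symm
    (tyOf_syn T (.lolli A C)).symm s _ _ rfl rfl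

theorem gten_single {A : Ty S.Ground} (v : Tm S E A) :
    gten T (.snoc (.nilL E) .nil v) = el T v := act_leftUnitor (el T v)

theorem gten_eq_single {A : Ty S.Ground} (r : Tup S E [A]) : gten T r = el T (Der.single r) := by
  cases r with
  | snoc p vs v =>
    cases vs
    cases p.eq_of_nilL
    have : p = .nilL _ := p.eq_nilL
    subst this
    exact gten_single v

/-- A term is the value of a morphism at the generic tuple. -/
theorem exists_act_gten {A : Ty S.Ground} (v : Tm S Γ A) : ∃ g : ctxOf (gr T) Γ ⟶ of T A,
    ∀ (E : Ctx S.Ground) (r : Tup S E Γ), act g (gten T r) = cl T (v.sub r) := by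
  induction Γ generalizing A with
  | nil =>
    -- For the empty context the morphism matches its argument of unit type against `∗`.
    refine ⟨Q.seq (.left .nil) .hyp (cl T v), fun E r => ?_⟩
    cases r
    exact (Q.seq_ap_star _).trans (congrArg (cl T) (Der.sub_ids v).symm)
  | cons C Γ ih =>
    -- The last variable is abstracted, so that the induction hypothesis applies to a term in a
    -- shorter context. Applying the resulting function to that variable recovers `v` by `β`.
    obtain ⟨g, hg⟩ : ∃ g : ctxOf (gr T) Γ ⟶ lolli (of T C) (of T A), ∀ (E : Ctx S.Ground)
      (r : Tup S E Γ), act g (gten T r) = cl T (.lam (v.sub (.lift C r))) := ih (.lam v)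
    refine ⟨(join (gr T) Γ C).inv ≫ (g ⊗ₘ (incl T C).inv) ≫ appHom (of T C) (of T A),
      fun E r => ?_⟩
    cases r with
    | snoc p vs u =>
      rw [act_comp, act_comp, gten_snoc, act_inv_act]
      refine (congrArg (act _) (act_tensorHom (Y' := of T C) _ _ _ _ _)).trans
        ((act_appHom _ _ _).trans ?_)
      rw [hg, el, act_inv_act]
      refine (Q.sound (.of_lamEq (.lam_beta _ _ _))).trans (congrArg (cl T) ?_)
      exact Der.inst_sub_lift p v vs u

/-- Abstraction does not decrease distances and transposition preserves them, so the variables can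
be removed one by one. In the empty context a morphism is recovered from its value at `∗` by the `η`
law for `I`. In this way distances of terms in several variables bound those of morphisms from the
tensor product. -/
theorem dist_act_gten (f g : ctxOf (gr T) Γ ⟶ X) :
    Q.dist (act f (gten T (Der.ids Γ))) (act g (gten T (Der.ids Γ))) ≤ homDist V f g := by
  induction Γ generalizing X with
  | nil =>
    refine (Q.dist_seq (.left .nil) (Q.hyp (T := T)) _ _).trans (le_of_eq ?_)
    exact congrArg₂ Q.dist (Q.eq_seq_star f).symm (Q.eq_seq_star g).symm
  | cons A Γ ih =>
    have e : ∀ f : ctxOf (gr T) (A :: Γ) ⟶ X,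
        lam (X := of T A) (act f (gten T (Der.ids (A :: Γ)))) =
          act (transpose (ctxOf (gr T) Γ ◁ (incl T A).hom ≫ (join (gr T) Γ A).hom ≫ f))
            (gten T (Der.ids Γ)) := fun f => by
      rw [act_transpose, act_comp, act_comp, act_whiskerLeft]
      rfl
    refine (Q.dist_lam _ _).trans ?_
    refine (le_of_eq (congrArg₂ Q.dist (e f) (e g))).trans ?_
    refine (ih _ _).trans ?_
    rw [homDist_transpose]
    -- Precomposition with the inverses of `join` and `incl` strips these isomorphisms and does not
    -- decrease distances.
    refine (homDist_comp_left ((join (gr T) Γ A).inv ≫ ctxOf (gr T) Γ ◁ (incl T A).inv) _ _).trans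
      (le_of_eq ?_)
    simp only [Category.assoc, ← whiskerLeft_comp_assoc, Iso.inv_hom_id, whiskerLeft_id,
      Category.id_comp, Iso.inv_hom_id_assoc]

/-- The interpretation of `f` by a morphism whose value at generic elements is
`f(x₁, …, xₙ)`. -/
noncomputable def generic (T : VTheory S B) : Interp S (Syn T) where
  ground := gr T
  op f := (exists_act_gten (T := T) (.op f (.ids (S.dom f)))).choose ≫ (incl T (S.cod f)).hom

theorem generic_op (f : S.Op) (r : Tup S E (S.dom f)) :
    act ((generic T).op f) (gten T r) = el T (.op f r) := by
  have h := (exists_act_gten (T := T) (.op f (.ids (S.dom f)))).choose_spec E r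
  refine (act_comp _ _ _).trans (congrArg (act (incl T (S.cod f)).hom) (h.trans ?_))
  exact congrArg (fun r => cl T (.op f r)) (Der.ids_sub r)

/-- The value of a derivation at its own generic tuple. -/
def val (T : VTheory S B) {E : Ctx S.Ground} : {k : Goal S.Ground} → Der S E k →
    El E ((generic T).goal k)
  | .one _, v => el T v
  | .many _, r => gten T r

/-- `pm x to a ⊗ b. f[y ⊗ (a ⊗ b)]` -/
theorem act_pm (s : Sf Γ Θ E) {A C K : Ty S.Ground} (v : Tm S Γ (.tensor A C))
    (w : Tm S (C :: A :: Θ) K) (y : El Θ Z)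
    (f : Z ⊗ (tyOf (gr T) A ⊗ tyOf (gr T) C) ⟶ tyOf (gr T) K)
    (h : act f (pr (.right (.right (.nilR Θ))) y (pr (.two A C) (el T .hyp) (el T .hyp))) =
      el T w) :
    act f (pr s.swap y (el T v)) = el T (.pm s v w) := by
  let i : of T (.tensor A C) ⟶ tyOf (gr T) A ⊗ tyOf (gr T) C := (incl T (.tensor A C)).hom
  have e : ∀ {Δ F : Ctx S.Ground} (t : Sf Θ Δ F) (x : El Δ (of T (.tensor A C))),
      act f (pr t y (act i x)) = act (Z ◁ i ≫ f) (pr t y x) := fun t x => by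
    rw [act_comp, act_whiskerLeft]
  refine (e s.swap (cl T v)).trans ?_
  refine (Q.pm_eta s (cl T v) y (Z ◁ i ≫ f)).trans ?_
  refine (congrArg (Q.pm s (cl T v)) (Eq.trans ?_ h)).trans
    (Q.ap_pm s (cl T v) (cl T w) (incl T K).hom).symm
  refine (e _ (cl T (.pair (.two A C) .hyp .hyp))).symm.trans ?_
  exact congrArg (fun x => act f (pr _ y x)) (el_pair (.two A C) .hyp .hyp)

/-- The rearrangement in the denotation of `pm`, evaluated at a pair of generalized elements,
adjoins the two components to `y` one after the other. With variables as components this is the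
lifted tuple at which the body is evaluated. -/
theorem act_unassoc_join {A C AC D ACD K : Syn T} (j : D ⊗ A ⟶ AC) (k : AC ⊗ C ⟶ ACD)
    (w : ACD ⟶ K) {A' C' : Ty S.Ground} (y : El Θ D) (a : El [A'] A) (c : El [C'] C) :
    act ((α_ D A C).inv ≫ j ▷ C ≫ k ≫ w) (pr (.right (.right (.nilR Θ))) y (pr (.two A' C') a c)) =
      act w (act k (pr (.right (.nilR (A' :: Θ))) (act j (pr (.right (.nilR Θ)) y a)) c)) := by
  have h : Sf.assoc' (.two A' C') (Sf.swap (.right (.right (.nilR Θ)))) =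
      ⟨A' :: Θ, .left (.nilL Θ), .left (.nilL (A' :: Θ))⟩ := by
    have h' := congrArg (fun t => (Sf.Two.pushInner A' t).pushOuter C')
      (Sf.assoc_nilL_left (Sf.nilL Θ))
    rw [← Sf.swap_nilR Θ] at h'
    refine Eq.trans h' ?_
    rw [Sf.swap_nilR]
    rfl
  rw [act_comp, act_associator_inv, h, act_comp, act_whiskerRight, act_comp]
  simp only [Sf.swap, Sf.swap_nilL]

theorem act_unit_right {K : Syn T} (w : Z ⟶ K) (y : El Θ Z) :
    act ((β_ Z (𝟙_ (Syn T))).hom ≫ (λ_ Z).hom ≫ w) (pr (.nilR Θ) y unitEl) = act w y := by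
  rw [act_comp, act_braiding, Sf.swap_nilR, act_comp, act_leftUnitor]

theorem act_seq (s : Sf Γ Θ E) {K : Ty S.Ground} (v : Tm S Γ .unit) (w : Tm S Θ K) (y : El Θ Z)
    (f : Z ⊗ 𝟙_ (Syn T) ⟶ tyOf (gr T) K)
    (h : act f (pr (.nilR Θ) y unitEl) = el T w) :
    act f (pr s.swap y (el T v)) = el T (.seq s v w) := by
  refine (congrArg (fun x => act f (pr s.swap y x)) (act_id _)).trans ?_
  refine (Q.seq_eta s (cl T v) y f).trans ?_
  refine (congrArg (Q.seq s (cl T v)) h).trans ?_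
  exact (Q.ap_seq s (cl T v) (cl T w) (incl T K).hom).symm

/-- Denotations compute substitution, with values in the syntactic category. Introduction forms and
application follow from the action of the structure morphisms; matching on a tensor or a unit needs
the `η` laws, because the matched term is not itself a pair or `∗`. Operation symbols hold by the
choice of `generic`. -/
theorem act_interp {k : Goal S.Ground} (v : Der S Γ k) (r : Tup S E Γ) :
    act ((generic T).interp v) (gten T r) = val T (v.sub r) := by
  induction v generalizing E with
  | op f vs ih =>
    refine (act_comp _ _ _).trans ((congrArg (act _) (ih r)).trans ?_)
    exact generic_op f (vs.sub r)
  | hyp => exact (act_id _).trans (gten_eq_single r)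
  | star => cases r; exact (act_id _).trans el_star.symm
  | nil => cases r; exact act_id _
  | @pm Γ Δ E A C K s v w ihv ihw =>
    refine (act_comp _ _ _).trans ((congrArg (act _) (act_splitHom s r)).trans ?_)
    refine (act_comp _ _ _).trans ((congrArg (act _) ((act_whiskerRight _ _ _ _).trans
      (congrArg (fun x => pr _ x _) (ihv _)))).trans ?_)
    refine (act_comp _ _ _).trans ((congrArg (act _) (act_braiding _ _ _)).trans ?_)
    -- By `η` the body has to be evaluated only where the matched term is a pair of variables.
    refine act_pm (Der.split s r).sf _ _ _ _ ?_
    exact (act_unassoc_join _ _ _ _ _ _).trans (ihw (.lift C (.lift A (Der.split s r).tupR)))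
  | pair s v w ihv ihw =>
    refine (act_comp _ _ _).trans ((congrArg (act _) (act_splitHom s r)).trans ?_)
    refine (act_tensorHom _ _ _ _ _).trans ((congrArg₂ (pr _) (ihv _) (ihw _)).trans ?_)
    exact (el_pair _ _ _).symm
  | seq s v w ihv ihw =>
    refine (act_comp _ _ _).trans ((congrArg (act _) (act_splitHom s r)).trans ?_)
    refine (act_comp _ _ _).trans ((congrArg (act _) ((act_whiskerRight _ _ _ _).trans
      (congrArg (fun x => pr _ x _) (ihv _)))).trans ?_)
    -- The denotation of `seq` keeps the matched term on the left, while `act_seq` expects it on the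
    -- right; a braiding is inserted to pass between the two.
    have e : pr (Der.split s r).sf (val T (v.sub (Der.split s r).tupL))
        (gten T (Der.split s r).tupR) = act (β_ _ _).hom (pr (Der.split s r).sf.swap
          (gten T (Der.split s r).tupR) (el T (v.sub (Der.split s r).tupL))) := by
      rw [act_braiding, Sf.swap_swap]
      rfl
    refine (congrArg (act _) e).trans ((act_comp _ _ _).symm.trans ?_)
    refine act_seq (Der.split s r).sf _ _ _ _ ?_
    exact (act_unit_right _ _).trans (ihw _)
  | lam v ih =>
    refine el_lam _ _ _ ?_
    exact (act_comp _ _ _).trans (ih (.lift _ r))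
  | app s v w ihv ihw =>
    refine (act_comp _ _ _).trans ((congrArg (act _) (act_splitHom s r)).trans ?_)
    refine (act_comp _ _ _).trans ((congrArg (act _) ((act_tensorHom _ _ _ _ _).trans
      (congrArg₂ (pr _) (ihv _) (ihw _)))).trans ?_)
    exact (act_appHom _ _ _).trans (el_app _ _ _)
  | snoc s vs v ih ih' =>
    refine (act_comp _ _ _).trans ((congrArg (act _) (act_splitHom s r)).trans ?_)
    refine (act_comp _ _ _).trans ((congrArg (act _) ((act_tensorHom _ _ _ _ _).trans
      (congrArg₂ (pr _) (ih _) (ih' _)))).trans ?_)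
    rfl

end Syn

end GeneralizedElements

/-! ### Canonical denotations in the syntactic category. -/

variable {V : Type uV} [CommMonoid V] [CompleteLattice V] [IsQuantale V]
  {S : Signature.{uG, uO}} {B : LabelBasis V}

namespace Syn

/-- In a context with one variable, the generic element is the identity up to `incl`, so acting on
it determines the morphism. -/
theorem generic_tm_cls (T : VTheory S B) {A K : Ty S.Ground} (v : Tm S [A] K) :
    (generic T).tm v = (incl T A).inv ≫ cls T v ≫ (incl T K).hom := by
  have h : act ((generic T).tm v) (el T (.hyp (A := A))) = el T (v.sub (.ids [A])) :=
    (congrArg (act _) (gten_eq_single (.ids [A])).symm).trans (act_interp v (.ids [A]))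
  rw [Der.sub_ids] at h
  refine ((incl T A).eq_inv_comp).2 (Eq.trans ?_ h)
  exact (congrArg (act ((generic T).tm v)) (Q.ap_hyp (incl T A).hom)).symm

/-- The operations of `generic` were obtained from an existence statement, but any interpretation
gets its operations back from the unpacked terms. Those terms now denote their own classes, which
are the operations of `synInterp`. -/
theorem generic_op_eq (T : VTheory S B) : (generic T).op = (synInterp T).op :=
  funext fun f => ((generic T).tm_unpack_op f).symm.trans (generic_tm_cls T _)

theorem synInterp_tm_cls (T : VTheory S B) {A K : Ty S.Ground} (v : Tm S [A] K) :
    (synInterp T).tm v = (incl T A).inv ≫ cls T v ≫ (incl T K).hom := by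
  have aux : ∀ o, (generic T).op = o → (Interp.mk (gr T) o).tm v =
      (incl T A).inv ≫ cls T v ≫ (incl T K).hom := by
    rintro _ rfl
    exact generic_tm_cls T v
  exact aux _ (generic_op_eq T)

/-- At the identity tuple the denotation of a term takes the term itself as its value, up to `incl`.
Hence `dist_act_gten` bounds the distance of denotations, also in contexts with several variables.
-/
theorem dist_le_homDist_synInterp (T : VTheory S B) {Γ : Ctx S.Ground} {A : Ty S.Ground}
    (v w : Tm S Γ A) : T.dist v w ≤ homDist V ((synInterp T).tm v) ((synInterp T).tm w) := by
  rw [show synInterp T = generic T from congrArg (Interp.mk (gr T)) (generic_op_eq T).symm]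
  have h : ∀ v : Tm S Γ A, act ((generic T).tm v) (gten T (.ids Γ)) = el T v := fun v =>
    (act_interp v (.ids Γ)).trans (congrArg (el T) (Der.sub_ids v))
  refine le_trans ?_ (dist_act_gten ((generic T).tm v) ((generic T).tm w))
  refine (Q.dist_ap_left (incl T A).hom (cl T v) (cl T w)).trans (le_of_eq ?_)
  exact congrArg₂ Q.dist (h v).symm (h w).symm

end Syn

/-! ### The two constructions are mutually inverse. -/

section Correspondence

variable {C : Type uC} [Category.{vC} C] [MonoidalCategory C] [SymmetricCategory C]
  [MonoidalClosed C]

open Functor.LaxMonoidal (ε μ)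

/-- An axiom bounds the distance of terms, hence that of their denotations in the syntactic
category, and `F` does not decrease the latter. Conjugation by `h` gives the denotations in `F_*
Syn(T)`. -/
theorem isModel_push {T : VTheory S B} [VCatSepAutonomous V C] (F : VAutFunctor V (Syn T) C) :
    T.IsModel ((synInterp T).push F.functor) := by
  intro Γ A q v w h
  have e : ∀ v : Tm S Γ A, ((synInterp T).push F.functor).tm v =
      (hIso F.functor (synInterp T).ground (tens Γ)).hom ≫ F.functor.map ((synInterp T).tm v) ≫
        (hIso F.functor (synInterp T).ground A).inv := fun v => by
    rw [← Category.assoc]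
    exact (Iso.eq_comp_inv _).2 (mapSq_tm F.functor (synInterp T) v)
  refine ((VTheory.le_dist (.ax h)).trans (Syn.dist_le_homDist_synInterp T v w)).trans ?_
  refine (F.enriched _ _ _ _).trans ?_
  refine le_trans ?_ (le_of_eq (congrArg₂ (homDist V) (e v) (e w)).symm)
  exact (homDist_comp_right _ _ _).trans (homDist_comp_left _ _ _)

theorem lolliIso_refl (X Y : C) : lolliIso (Iso.refl X) (Iso.refl Y) = Iso.refl (lolli X Y) := by
  ext
  simp [lolliIso, postHom, preHom, transpose_appHom]

theorem lolliIso_eqToIso {X X' Y Y' : C} (h : X = X') (h' : Y = Y') :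
    lolliIso (eqToIso h) (eqToIso h') = eqToIso (by rw [h, h']) := by
  subst h h'
  exact lolliIso_refl X Y

theorem eqToIso_tensor {X X' Y Y' : C} (h : X = X') (h' : Y = Y') :
    eqToIso h ⊗ᵢ eqToIso h' = eqToIso (by rw [h, h']) := by
  subst h h'
  ext
  exact id_tensorHom_id X Y

section Comparison

variable {T : VTheory S B} (F : Syn T ⥤ C) [F.Braided] [∀ X Y, IsIso (homComparison F X Y)]

/-- The comparison isomorphism `⟦A⟧_{F_* Syn(T)} ≅ F A`. -/
noncomputable def synComparison (A : Ty S.Ground) :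
    tyOf (fun X => F.obj (Syn.gr T X)) A ≅ F.obj (Syn.of T A) :=
  hIso F (Syn.gr T) A ≪≫ F.mapIso (Syn.incl T A).symm

/-- The transport square, with the denotation in the syntactic category replaced by the class of the
term. The inclusions `incl` on the side of `K` cancel, and the one on the side of `A` becomes part
of the comparison. -/
theorem synComparison_naturality {A K : Ty S.Ground} (v : Tm S [A] K) :
    ((synInterp T).push F).tm v ≫ (synComparison F K).hom =
      (synComparison F A).hom ≫ F.map (Syn.cls T v) := by
  have h := mapSq_tm F (synInterp T) v
  rw [Syn.synInterp_tm_cls] at h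
  refine (Category.assoc _ _ _).symm.trans ((congrArg (· ≫ F.map (Syn.incl T K).inv) h).trans ?_)
  have aux : ∀ {X Y Z W : Syn T} {X' : C} (h : X' ⟶ F.obj X) (f : X ⟶ Y) (g : Y ⟶ Z) (e : Z ≅ W),
      (h ≫ F.map (f ≫ g ≫ e.hom)) ≫ F.map e.inv = (h ≫ F.map f) ≫ F.map g := by
    intros
    simp only [Category.assoc, ← F.map_comp, Iso.hom_inv_id, Category.comp_id]
  exact aux _ _ _ _

theorem synComparison_unit : (synComparison F .unit).hom = ε F :=
  (congrArg (ε F ≫ ·) (F.map_id (𝟙_ (Syn T)))).trans (Category.comp_id _)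

theorem synComparison_tensor (A K : Ty S.Ground) : (synComparison F (.tensor A K)).hom =
    ((synComparison F A).hom ⊗ₘ (synComparison F K).hom) ≫ μ F (Syn.of T A) (Syn.of T K) := by
  have e : Syn.incl T (.tensor A K) = (Syn.incl T A ⊗ᵢ Syn.incl T K) :=
    Iso.ext (Syn.incl_tensor A K)
  have aux : ∀ {X Y X' Y' : Syn T} {Z W : C} (h : Z ≅ F.obj X) (k : W ≅ F.obj Y) (f : X' ≅ X)
      (g : Y' ≅ Y), (((h ⊗ᵢ k) ≪≫ Functor.Monoidal.μIso F X Y) ≪≫ F.mapIso (f ⊗ᵢ g).symm).hom =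
        ((h ≪≫ F.mapIso f.symm).hom ⊗ₘ (k ≪≫ F.mapIso g.symm).hom) ≫ μ F X' Y' := by
    intros
    simp [← tensorHom_comp_tensorHom]
  refine Eq.trans ?_ (aux (hIso F (Syn.gr T) A) (hIso F (Syn.gr T) K) (Syn.incl T A)
    (Syn.incl T K))
  rw [← e]
  rfl

end Comparison

variable [VCatSepAutonomous V C] {T : VTheory S B}

/-- The isomorphism of `[v] ↦ ⟦v⟧_{F_* Syn(T)}` and `F`. -/
noncomputable def inducedPushIso (hV : (1 : V) = ⊤) (F : VAutFunctor V (Syn T) C) :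
    (inducedVAutFunctor hV (isModel_push F)).functor ≅ F.functor :=
  NatIso.ofComponents (fun A => synComparison F.functor A) fun {A K} f => by
    induction f using Q.ind with | h f => exact synComparison_naturality F.functor f

theorem inducedPushIso_isMonoidal (hV : (1 : V) = ⊤) (F : VAutFunctor V (Syn T) C) :
    NatTrans.IsMonoidal (inducedPushIso hV F).hom where
  unit := (Category.id_comp _).trans (synComparison_unit F.functor)
  tensor A K := (Category.id_comp _).trans (synComparison_tensor F.functor A K)

/-- All comparison morphisms of a strict functor are identities, so those composed from them are
too. Source and target agree only propositionally, since `tyOf (gr T) A` is not `A` by definition.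
-/
theorem hIso_induced (hV : (1 : V) = ⊤) {M : Interp S C} (hM : T.IsModel M) (A : Ty S.Ground) :
    ∃ h, hIso (inducedVAutFunctor hV hM).functor (Syn.gr T) A = eqToIso h := by
  induction A with
  | ground X => exact ⟨rfl, rfl⟩
  | unit => exact ⟨rfl, rfl⟩
  | tensor A K ihA ihK =>
    obtain ⟨hA, eA⟩ := ihA
    obtain ⟨hK, eK⟩ := ihK
    refine ⟨congrArg₂ (fun X Y : C => X ⊗ Y) hA hK, ?_⟩
    rw [hIso, eA, eK, eqToIso_tensor]
    exact Iso.ext (Category.comp_id _)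
  | lolli A K ihA ihK =>
    obtain ⟨hA, eA⟩ := ihA
    obtain ⟨hK, eK⟩ := ihK
    refine ⟨congrArg₂ (fun X Y : C => lolli X Y) hA hK, ?_⟩
    rw [hIso, eA, eK, lolliIso_eqToIso]
    -- The inverse of the hom comparison is an identity because the comparison itself is;
    -- generalizing the objects permits elimination of the equalities.
    have aux : ∀ {X Y Z : C} (h : X = Y) (g : Z = Y) (f : Z ⟶ Y) (_ : IsIso f), f = eqToHom g →
        eqToIso h ≪≫ (asIso f).symm = eqToIso (h.trans g.symm) := by
      rintro X _ _ rfl rfl f _ rfl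
      ext
      simp
    exact aux _ rfl _ _ (inducedFunctor_homComparison hV hM _ _)

theorem synComparison_induced (hV : (1 : V) = ⊤) {M : Interp S C} (hM : T.IsModel M)
    (A : Ty S.Ground) :
    synComparison (inducedVAutFunctor hV hM).functor A = Iso.refl (M.ty A) := by
  obtain ⟨h, e⟩ := hIso_induced hV hM A
  rw [synComparison, e]
  ext
  refine (congrArg (eqToHom h ≫ ·) (eqToHom_map (inducedVAutFunctor hV hM).functor
    (tyOf_syn T A))).trans ?_
  exact eqToHom_trans _ _

/-- Naturality of the comparison is applied to the term that represents `f`. The comparison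
isomorphisms are identities here, and `tm_unpack_op` evaluates the term to the operation on both
sides. -/
theorem push_induced (hV : (1 : V) = ⊤) {M : Interp S C} (hM : T.IsModel M) :
    (synInterp T).push (inducedVAutFunctor hV hM).functor = M := by
  refine congrArg (Interp.mk M.ground) (funext fun f => ?_)
  have h := synComparison_naturality (inducedVAutFunctor hV hM).functor
    (Der.unpack (S.dom f) [] (.op f (Der.vars (S.dom f))))
  rw [Interp.tm_unpack_op, synComparison_induced, synComparison_induced] at h
  refine (Category.comp_id _).symm.trans (h.trans ((Category.id_comp _).trans ?_))
  exact M.tm_unpack_op f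

end Correspondence

end VLam

theorem mainTheorem4 {V : Type uV} [CommMonoid V] [CompleteLattice V] [IsQuantale V]
    (hV : (1 : V) = ⊤) (B : VLam.LabelBasis V) (S : VLam.Signature.{uG, uO})
    (T : VLam.VTheory S B) (C : Type uC) [Category.{vC} C] [MonoidalCategory C]
    [SymmetricCategory C] [MonoidalClosed C] [VLam.VCatSepAutonomous V C] :
    -- every autonomous functor `F` induces the model `F_* Syn(T)`
    ∃ hmodel : ∀ F : VLam.VAutFunctor V (VLam.Syn T) C,
        T.IsModel (VLam.Interp.push F.functor (VLam.synInterp T)),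
    -- every model `M` induces the strict autonomous functor `Φ M`, namely `[v] ↦ ⟦v⟧_M`
    ∃ Φ : VLam.Model T C → VLam.VAutFunctor V (VLam.Syn T) C,
      (∀ M, (Φ M).IsStrict ∧ VLam.IsInducedBy T (Φ M).functor M.toInterp) ∧
      -- the two constructions are inverse to each other up to isomorphism
      (∀ F : VLam.VAutFunctor V (VLam.Syn T) C,
        ∃ α : (Φ ⟨VLam.Interp.push F.functor (VLam.synInterp T), hmodel F⟩).functor ≅ F.functor,
          NatTrans.IsMonoidal α.hom) ∧
      ∀ M, VLam.Interp.push (Φ M).functor (VLam.synInterp T) = M.toInterp := by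
  exact ⟨VLam.isModel_push, fun M => VLam.inducedVAutFunctor hV M.isModel,
    fun M => ⟨VLam.inducedVAutFunctor_isStrict hV M.isModel,
      VLam.inducedVAutFunctor_isInducedBy hV M.isModel⟩,
    fun F => ⟨VLam.inducedPushIso hV F, VLam.inducedPushIso_isMonoidal hV F⟩,
    fun M => VLam.push_induced hV M.isModel⟩
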